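/- Let $\mathfrak n$ be a real Lie algebra with a basis $Z_1,\dots,Z_r,Y_1,\dots,Y_d,X_1,\dots,X_d$ ($d\ge 1$, $r=\dim\mathfrak n-2d$) such that $[\mathfrak n,\mathfrak n]\subset\mathfrak z(\mathfrak n)=\operatorname{span}\{Z_k\}$, $[Y_i,Y_j]=[X_i,X_j]=0$ for all $i,j$, and some $\ell\in\mathfrak n^*$ satisfies $\{V:\ell[V,\mathfrak n]=0\}=\mathfrak z(\mathfrak n)$. Let $N=\exp\mathfrak n$ be the connected, simply connected Lie group of $\mathfrak n$, with Haar measure equal to Lebesgue measure in the coordinates $(z,y,x)\mapsto\exp(\sum z_kZ_k)\exp(\sum y_jY_j)\exp(\sum x_iX_i)$, and let $L$ be its left regular representation. Identify $\lambda\in\mathbb R^r$ with the functional $Z_k\mapsto\lambda_k$, $Y_j,X_i\mapsto 0$; let $\Sigma\subset\mathbb R^r$ be the set of $\lambda$ with $\{V:\lambda[V,\mathfrak n]=0\}=\mathfrak z(\mathfrak n)$, let $B(\lambda)=-(\lambda[X_i,Y_j])_{i,j}$, and let $d\mu(\lambda)=|\det B(\lambda)|\,d\lambda$ on $\Sigma$.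 Let $\pi_\lambda$ be the representation of $N$ on $L^2(\mathbb R^d)$ given by $$\pi_\lambda\Big(e^{\sum z_kZ_k}e^{\sum y_jY_j}e^{\sum x_iX_i}\Big)F(s)=e^{2\pi i\langle\lambda,z\rangle}e^{2\pi i\langle s,B(\lambda)y\rangle}F(s-x).$$ Let $f\mapsto\widehat f$, $L^2(N)\to\int_\Sigma^\oplus L^2(\mathbb R^d)\otimes L^2(\mathbb R^d)\,d\mu(\lambda)$, be the Plancherel transform, the continuous extension of $\widehat f(\lambda)=\int_N f(n)\pi_\lambda(n)\,dn$ from $L^1(N)\cap L^2(N)$, where $L^2(\mathbb R^d)\otimes L^2(\mathbb R^d)$ is the space of Hilbert–Schmidt operators on $L^2(\mathbb R^d)$. Let $a\in(0,\infty)^r$, $q,b\in(0,\infty)^d$, let $\mathbf I\subseteq\{\lambda\in\Sigma:0\le\lambda_k\le a_k\text{ for all }k\}$ be measurable, let $\mathbf u\in L^2(\mathbb R^d)$ be a unit vector, and let $\mathcal H\subset L^2(N)$ be the multiplicity-free space of those $f$ whose Plancherel transform lies in $\int_{\mathbf I}^\oplus L^2(\mathbb R^d)\otimes\mathbf u\,d\mu(\lambda)$.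 Put $$\Gamma_{a,q,b}=\Big\{e^{\sum\frac{m_j}{a_j}Z_j}e^{\sum\frac{k_j}{q_j}Y_j}e^{\sum\frac{n_j}{b_j}X_j}:m\in\mathbb Z^r,\ k,n\in\mathbb Z^d\Big\},\qquad \Gamma_{q,b}=\Big\{e^{\sum\frac{k_j}{q_j}Y_j}e^{\sum\frac{n_j}{b_j}X_j}:k,n\in\mathbb Z^d\Big\},$$ $A(b)=\operatorname{diag}(1/b_1,\dots,1/b_d)$ and $D(q)=\operatorname{diag}(1/q_1,\dots,1/q_d)$. Let $\phi\in\mathcal H$ and suppose that $\{L(\gamma)\phi:\gamma\in\Gamma_{a,q,b}\}$ is a Parseval frame for $\mathcal H$. Then for $\mu$-almost every $\lambda\in\mathbf I$: 1. with $\widehat\phi(\lambda)=F\otimes\mathbf u$, $F\in L^2(\mathbb R^d)$, and $L^2(\mathbb R^d)\otimes\mathbf u$ identified with $L^2(\mathbb R^d)$ through $F\otimes\mathbf u\mapsto F$, the system $$\Big\{\prod_{k=1}^{r}\sqrt{a_k}\;|\det B(\lambda)|^{1/2}\,\pi_\lambda(\gamma)F:\gamma\in\Gamma_{q,b}\Big\}$$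 is a Parseval frame of $L^2(\mathbb R^d)$, and it is the Gabor system $\{e^{2\pi i\langle\xi,s\rangle}g(s-t):t\in A(b)\mathbb Z^d,\ \xi\in B(\lambda)D(q)\mathbb Z^d\}$ with window $g=\prod_{k}\sqrt{a_k}\,|\det B(\lambda)|^{1/2}F$; 2. $|\det(A(b)B(\lambda)D(q))|\le 1$. -/

import Mathlib

open MeasureTheory Filter Topology
open scoped ENNReal Matrix

noncomputable section

/-! ### The class of Lie algebras -/

/-- A basis `Z_1, …, Z_r, Y_1, …, Y_d, X_1, …, X_d` exhibiting the real Lie algebra `𝔫`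
as a member of the class considered: `𝔫` is two-step nilpotent with centre `𝔷 = span Z`,
`𝔭 = 𝔷 ⊕ span Y` and `𝔪 = span X` are commutative, and the generic coadjoint stabilizers
are equal to the centre, i.e. the group is square-integrable modulo the centre.
Here `r = dim 𝔫 - 2 d`. -/
structure AdmissibleBasis (𝔫 : Type*) [LieRing 𝔫] [LieAlgebra ℝ 𝔫] (r d : ℕ) where
  toBasis : Module.Basis (Fin r ⊕ (Fin d ⊕ Fin d)) ℝ 𝔫
  two_step : ∀ v w : 𝔫, ⁅v, w⁆ ∈ LieAlgebra.center ℝ 𝔫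
  span_Z : Submodule.span ℝ (Set.range fun k : Fin r => toBasis (Sum.inl k)) =
    (LieAlgebra.center ℝ 𝔫).toSubmodule
  comm_Y : ∀ i j : Fin d, ⁅toBasis (Sum.inr (Sum.inl i)), toBasis (Sum.inr (Sum.inl j))⁆ = 0
  comm_X : ∀ i j : Fin d, ⁅toBasis (Sum.inr (Sum.inr i)), toBasis (Sum.inr (Sum.inr j))⁆ = 0
  exists_generic : ∃ ℓ : Module.Dual ℝ 𝔫,
    ∀ v : 𝔫, (∀ w : 𝔫, ℓ ⁅v, w⁆ = 0) → v ∈ LieAlgebra.center ℝ 𝔫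

namespace AdmissibleBasis

variable {𝔫 : Type*} [LieRing 𝔫] [LieAlgebra ℝ 𝔫] {r d : ℕ}

/-- The central basis vectors. -/
def Z (D : AdmissibleBasis 𝔫 r d) (k : Fin r) : 𝔫 := D.toBasis (Sum.inl k)

/-- The basis vectors of `𝔭` modulo the centre. -/
def Y (D : AdmissibleBasis 𝔫 r d) (j : Fin d) : 𝔫 := D.toBasis (Sum.inr (Sum.inl j))

/-- The basis vectors of `𝔪`. -/
def X (D : AdmissibleBasis 𝔫 r d) (i : Fin d) : 𝔫 := D.toBasis (Sum.inr (Sum.inr i))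

/-- `z ↦ z_1 Z_1 + ⋯ + z_r Z_r`. -/
def vZ (D : AdmissibleBasis 𝔫 r d) : (Fin r → ℝ) →ₗ[ℝ] 𝔫 := Fintype.linearCombination ℝ D.Z

/-- `y ↦ y_1 Y_1 + ⋯ + y_d Y_d`. -/
def vY (D : AdmissibleBasis 𝔫 r d) : (Fin d → ℝ) →ₗ[ℝ] 𝔫 := Fintype.linearCombination ℝ D.Y

/-- `x ↦ x_1 X_1 + ⋯ + x_d X_d`. -/
def vX (D : AdmissibleBasis 𝔫 r d) : (Fin d → ℝ) →ₗ[ℝ] 𝔫 := Fintype.linearCombination ℝ D.X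

/-- The `Z`-coordinates of an element of `𝔫`. -/
def cZ (D : AdmissibleBasis 𝔫 r d) : 𝔫 →ₗ[ℝ] (Fin r → ℝ) :=
  LinearMap.pi fun k => D.toBasis.coord (Sum.inl k)

/-- The `Y`-coordinates of an element of `𝔫`. -/
def cY (D : AdmissibleBasis 𝔫 r d) : 𝔫 →ₗ[ℝ] (Fin d → ℝ) :=
  LinearMap.pi fun j => D.toBasis.coord (Sum.inr (Sum.inl j))

/-- The `X`-coordinates of an element of `𝔫`. -/
def cX (D : AdmissibleBasis 𝔫 r d) : 𝔫 →ₗ[ℝ] (Fin d → ℝ) :=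
  LinearMap.pi fun i => D.toBasis.coord (Sum.inr (Sum.inr i))

theorem coords_sum (D : AdmissibleBasis 𝔫 r d) (v : 𝔫) : D.vZ (D.cZ v) + D.vY (D.cY v) + D.vX (D.cX v) = v := by
  have h := D.toBasis.sum_repr v
  rw [Fintype.sum_sum_type, Fintype.sum_sum_type] at h
  rw [add_assoc]
  simpa [vZ, vY, vX, cZ, cY, cX, Z, Y, X, Fintype.linearCombination_apply] using h

@[simp] theorem cZ_vZ (D : AdmissibleBasis 𝔫 r d) (z : Fin r → ℝ) : D.cZ (D.vZ z) = z := by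
  ext k; simp [vZ, cZ, Z, Fintype.linearCombination_apply, Finsupp.single_apply]
@[simp] theorem cY_vZ (D : AdmissibleBasis 𝔫 r d) (z : Fin r → ℝ) : D.cY (D.vZ z) = 0 := by
  ext k; simp [vZ, cY, Z, Fintype.linearCombination_apply]
@[simp] theorem cX_vZ (D : AdmissibleBasis 𝔫 r d) (z : Fin r → ℝ) : D.cX (D.vZ z) = 0 := by
  ext k; simp [vZ, cX, Z, Fintype.linearCombination_apply]
@[simp] theorem cZ_vY (D : AdmissibleBasis 𝔫 r d) (y : Fin d → ℝ) : D.cZ (D.vY y) = 0 := by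
  ext k; simp [vY, cZ, Y, Fintype.linearCombination_apply]
@[simp] theorem cY_vY (D : AdmissibleBasis 𝔫 r d) (y : Fin d → ℝ) : D.cY (D.vY y) = y := by
  ext k; simp [vY, cY, Y, Fintype.linearCombination_apply, Finsupp.single_apply]
@[simp] theorem cX_vY (D : AdmissibleBasis 𝔫 r d) (y : Fin d → ℝ) : D.cX (D.vY y) = 0 := by
  ext k; simp [vY, cX, Y, Fintype.linearCombination_apply]
@[simp] theorem cZ_vX (D : AdmissibleBasis 𝔫 r d) (x : Fin d → ℝ) : D.cZ (D.vX x) = 0 := by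
  ext k; simp [vX, cZ, X, Fintype.linearCombination_apply]
@[simp] theorem cY_vX (D : AdmissibleBasis 𝔫 r d) (x : Fin d → ℝ) : D.cY (D.vX x) = 0 := by
  ext k; simp [vX, cY, X, Fintype.linearCombination_apply]
@[simp] theorem cX_vX (D : AdmissibleBasis 𝔫 r d) (x : Fin d → ℝ) : D.cX (D.vX x) = x := by
  ext k; simp [vX, cX, X, Fintype.linearCombination_apply, Finsupp.single_apply]

theorem lie_lie_right (D : AdmissibleBasis 𝔫 r d) (u v w : 𝔫) : ⁅u, ⁅v, w⁆⁆ = 0 :=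
  (LieModule.mem_maxTrivSubmodule ℝ 𝔫 𝔫 _).1 (D.two_step v w) u

theorem lie_lie_left (D : AdmissibleBasis 𝔫 r d) (u v w : 𝔫) : ⁅⁅u, v⁆, w⁆ = 0 := by
  rw [← lie_skew, D.lie_lie_right, neg_zero]

theorem lie_vZ (D : AdmissibleBasis 𝔫 r d) (z : Fin r → ℝ) (w : 𝔫) : ⁅w, D.vZ z⁆ = 0 := by
  have h : D.vZ z ∈ (LieAlgebra.center ℝ 𝔫).toSubmodule := by
    rw [← D.span_Z, vZ, Fintype.linearCombination_apply]
    exact Submodule.sum_mem _ fun k _ =>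
      Submodule.smul_mem _ _ (Submodule.subset_span ⟨k, rfl⟩)
  exact (LieModule.mem_maxTrivSubmodule ℝ 𝔫 𝔫 _).1 h w

theorem vZ_lie (D : AdmissibleBasis 𝔫 r d) (z : Fin r → ℝ) (w : 𝔫) : ⁅D.vZ z, w⁆ = 0 := by
  rw [← lie_skew, D.lie_vZ, neg_zero]

theorem vY_lie_vY (D : AdmissibleBasis 𝔫 r d) (y y' : Fin d → ℝ) : ⁅D.vY y, D.vY y'⁆ = 0 := by
  simp [vY, Y, Fintype.linearCombination_apply, sum_lie, lie_sum, D.comm_Y]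

theorem vX_lie_vX (D : AdmissibleBasis 𝔫 r d) (x x' : Fin d → ℝ) : ⁅D.vX x, D.vX x'⁆ = 0 := by
  simp [vX, X, Fintype.linearCombination_apply, sum_lie, lie_sum, D.comm_X]

theorem vZ_cZ_of_center (D : AdmissibleBasis 𝔫 r d) {v : 𝔫} (hv : v ∈ LieAlgebra.center ℝ 𝔫) : D.vZ (D.cZ v) = v := by
  have h : v ∈ Submodule.span ℝ (Set.range D.Z) := by
    have := D.span_Z
    change Submodule.span ℝ (Set.range D.Z) = _ at this
    rw [this]; exact hv
  rw [← Fintype.range_linearCombination] at h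
  obtain ⟨z, rfl⟩ := h
  change D.vZ (D.cZ (D.vZ z)) = D.vZ z
  simp

theorem vZ_cZ_lie (D : AdmissibleBasis 𝔫 r d) (v w : 𝔫) : D.vZ (D.cZ ⁅v, w⁆) = ⁅v, w⁆ := D.vZ_cZ_of_center (D.two_step v w)

end AdmissibleBasis

/-! ### The simply connected group and its Haar measure -/

/-- The connected, simply connected Lie group `N` with Lie algebra `𝔫`, realized on `𝔫`
through `exp` with the Baker–Campbell–Hausdorff product, which stops after the first
bracket as `𝔫` is two-step. -/
@[ext] structure NilGroup {𝔫 : Type*} [LieRing 𝔫] [LieAlgebra ℝ 𝔫] {r d : ℕ}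
    (D : AdmissibleBasis 𝔫 r d) where
  exp ::
  log : 𝔫

namespace NilGroup

variable {𝔫 : Type*} [LieRing 𝔫] [LieAlgebra ℝ 𝔫] {r d : ℕ} {D : AdmissibleBasis 𝔫 r d}

instance : Mul (NilGroup D) := ⟨fun g h => exp (g.log + h.log + (1 / 2 : ℝ) • ⁅g.log, h.log⁆)⟩
instance : One (NilGroup D) := ⟨exp 0⟩
instance : Inv (NilGroup D) := ⟨fun g => exp (-g.log)⟩

@[simp] theorem log_mul (g h : NilGroup D) :
    (g * h).log = g.log + h.log + (1 / 2 : ℝ) • ⁅g.log, h.log⁆ := rfl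
@[simp] theorem log_one : (1 : NilGroup D).log = 0 := rfl
@[simp] theorem log_inv (g : NilGroup D) : (g⁻¹).log = -g.log := rfl

instance : Group (NilGroup D) :=
  Group.ofLeftAxioms
    (fun a b c => by
      ext
      simp only [log_mul, lie_add, add_lie, lie_smul, smul_lie, D.lie_lie_left, D.lie_lie_right,
        smul_zero, add_zero, smul_add]
      abel)
    (fun a => by ext; simp)
    (fun a => by ext; simp)

/-- The element `exp(∑ z_k Z_k) exp(∑ y_j Y_j) exp(∑ x_i X_i)` of `N`. -/
def point (D : AdmissibleBasis 𝔫 r d) (p : (Fin r → ℝ) × (Fin d → ℝ) × (Fin d → ℝ)) :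
    NilGroup D :=
  exp (D.vZ p.1) * exp (D.vY p.2.1) * exp (D.vX p.2.2)

theorem log_point (p : (Fin r → ℝ) × (Fin d → ℝ) × (Fin d → ℝ)) :
    (point D p).log = D.vZ p.1 + D.vY p.2.1 + D.vX p.2.2 +
      (1 / 2 : ℝ) • ⁅D.vY p.2.1, D.vX p.2.2⁆ := by
  simp only [point, log_mul, D.vZ_lie, smul_zero, add_zero, add_lie, zero_add]

/-- Every `n ∈ N` is uniquely `exp(∑ z_k Z_k) exp(∑ y_j Y_j) exp(∑ x_i X_i)`;
these are the coordinates `(z, y, x)` on `N`. -/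
def coords (D : AdmissibleBasis 𝔫 r d) :
    NilGroup D ≃ (Fin r → ℝ) × (Fin d → ℝ) × (Fin d → ℝ) where
  toFun g := (D.cZ (g.log - (1 / 2 : ℝ) • ⁅D.vY (D.cY g.log), D.vX (D.cX g.log)⁆),
    D.cY g.log, D.cX g.log)
  invFun := point D
  left_inv g := by
    ext
    rw [log_point]
    simp only [map_sub, map_smul, D.vZ_cZ_lie]
    rw [show ∀ a b c e : 𝔫, a - e + b + c + e = a + b + c by intros; abel]
    exact D.coords_sum _
  right_inv p := by
    obtain ⟨z, y, x⟩ := p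
    have hY : D.cY ⁅D.vY y, D.vX x⁆ = 0 := by rw [← D.vZ_cZ_lie]; simp
    have hX : D.cX ⁅D.vY y, D.vX x⁆ = 0 := by rw [← D.vZ_cZ_lie]; simp
    simp [log_point, hY, hX]

/-- The measurable structure of `N` is that of its coordinate space. -/
instance : MeasurableSpace (NilGroup D) := MeasurableSpace.comap (coords D) inferInstance

/-- The coordinates as a measurable equivalence. -/
def coordsMeas (D : AdmissibleBasis 𝔫 r d) :
    NilGroup D ≃ᵐ (Fin r → ℝ) × (Fin d → ℝ) × (Fin d → ℝ) where
  toEquiv := coords D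
  measurable_toFun := comap_measurable _
  measurable_invFun := by
    rintro s ⟨t, ht, rfl⟩
    rw [← Set.preimage_comp]
    simpa using ht

/-- The Haar measure of `N`: Lebesgue measure in the coordinates `(z, y, x)`. -/
def haar (D : AdmissibleBasis 𝔫 r d) : Measure (NilGroup D) :=
  Measure.map (coordsMeas D).symm volume

theorem coords_mul (g h : NilGroup D) : coords D (g * h) =
    ((coords D h).1 + ((coords D g).1 + D.cZ ⁅D.vX (coords D g).2.2, D.vY (coords D h).2.1⁆),
      (coords D g).2.1 + (coords D h).2.1, (coords D g).2.2 + (coords D h).2.2) := by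
  obtain ⟨p, rfl⟩ := (coords D).symm.surjective g
  obtain ⟨q, rfl⟩ := (coords D).symm.surjective h
  apply (coords D).symm.injective
  simp only [Equiv.symm_apply_apply, Equiv.apply_symm_apply]
  change point D p * point D q = point D _
  ext
  simp only [log_mul, log_point, map_add, lie_add, add_lie, lie_smul, smul_lie, D.lie_lie_left,
    D.lie_lie_right, D.lie_vZ, D.vZ_lie, D.vY_lie_vY, D.vX_lie_vX, D.vZ_cZ_lie, smul_zero,
    add_zero, zero_add, smul_add]
  rw [← lie_skew (D.vX p.2.2) (D.vY q.2.1)]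
  module

theorem measurePreserving_mul_left (g : NilGroup D) :
    MeasurePreserving (fun h : NilGroup D => g * h) (haar D) (haar D) := by
  have e : MeasurePreserving (coordsMeas D).symm volume (haar D) :=
    ⟨(coordsMeas D).symm.measurable, rfl⟩
  have e' : MeasurePreserving (coordsMeas D) (haar D) volume := by
    simpa using e.symm (coordsMeas D).symm
  set c : (Fin d → ℝ) × (Fin d → ℝ) → (Fin r → ℝ) := fun w =>
    (coords D g).1 + D.cZ ⁅D.vX (coords D g).2.2, D.vY w.1⁆ with hc
  have hcm : Measurable c := by
    let L : (Fin d → ℝ) →ₗ[ℝ] (Fin r → ℝ) :=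
      D.cZ ∘ₗ ((LieModule.toEnd ℝ 𝔫 𝔫 (D.vX (coords D g).2.2) : 𝔫 →ₗ[ℝ] 𝔫) ∘ₗ D.vY)
    have hL : Continuous L := L.continuous_of_finiteDimensional
    exact (continuous_const.add (hL.comp continuous_fst)).measurable
  have h1 : MeasurePreserving
      (fun p : ((Fin d → ℝ) × (Fin d → ℝ)) × (Fin r → ℝ) =>
        ((coords D g).2 + p.1, p.2 + c p.1)) (volume.prod volume) (volume.prod volume) := by
    refine (measurePreserving_add_left (volume.prod volume) (coords D g).2).skew_product
      (g := fun w z => z + c w) ?_ ?_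
    · exact measurable_snd.add (hcm.comp measurable_fst)
    · exact Eventually.of_forall fun w => (measurePreserving_add_right volume (c w)).map_eq
  have h2 := (Measure.measurePreserving_swap.comp h1).comp
    (Measure.measurePreserving_swap (μ := (volume : Measure (Fin r → ℝ)))
      (ν := (volume : Measure ((Fin d → ℝ) × (Fin d → ℝ)))))
  have h3 := e.comp ((show MeasurePreserving _ volume volume from h2).comp e')
  convert h3 using 1
  funext h
  apply (coords D).injective
  rw [coords_mul]
  change _ = coords D ((coords D).symm _)
  rw [Equiv.apply_symm_apply]
  rfl

/-- The left regular representation: `(L(g) f)(h) = f(g⁻¹ h)` on `L²(N)`. -/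
def leftRegular (g : NilGroup D) : Lp ℂ 2 (haar D) →ₗᵢ[ℂ] Lp ℂ 2 (haar D) :=
  Lp.compMeasurePreservingₗᵢ ℂ (fun h : NilGroup D => g⁻¹ * h) (measurePreserving_mul_left g⁻¹)

end NilGroup

/-! ### Gabor systems in `L²(ℝ^d)` -/

/-- The Hilbert space `L²(ℝ^d)`. -/
abbrev L2R (d : ℕ) : Type := Lp ℂ 2 (volume : Measure (Fin d → ℝ))

/-- Translation by `t`: `f ↦ f(· - t)`. -/
def translation {d : ℕ} (t : Fin d → ℝ) : L2R d →ₗᵢ[ℂ] L2R d :=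
  Lp.compMeasurePreservingₗᵢ ℂ (fun s => s - t) (measurePreserving_sub_right volume t)

theorem norm_expChar (a : ℝ) : ‖Complex.exp (2 * Real.pi * Complex.I * a)‖ = 1 := by
  rw [show (2 * Real.pi * Complex.I * a : ℂ) = ((2 * Real.pi * a : ℝ) : ℂ) * Complex.I by
    push_cast; ring]
  exact Complex.norm_exp_ofReal_mul_I _

theorem memLp_modulation {d : ℕ} (ξ : Fin d → ℝ) (f : L2R d) :
    MemLp (fun s => Complex.exp (2 * Real.pi * Complex.I * (s ⬝ᵥ ξ : ℝ)) * f s) 2 volume := by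
  refine (Lp.memLp f).of_le ?_ (Eventually.of_forall fun s => ?_)
  · refine Continuous.aestronglyMeasurable ?_ |>.mul (Lp.aestronglyMeasurable f)
    unfold dotProduct
    fun_prop
  · rw [norm_mul, norm_expChar, one_mul]

/-- Modulation by `ξ`: `f ↦ e^{2πi⟨·, ξ⟩} f`. -/
def modulation {d : ℕ} (ξ : Fin d → ℝ) : L2R d →ₗᵢ[ℂ] L2R d where
  toFun f := (memLp_modulation ξ f).toLp _
  map_add' f g := by
    rw [← MemLp.toLp_add]
    refine MemLp.toLp_congr _ _ ?_
    filter_upwards [Lp.coeFn_add f g] with s hs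
    rw [hs]; simp [mul_add]
  map_smul' c f := by
    rw [RingHom.id_apply, ← MemLp.toLp_const_smul]
    refine MemLp.toLp_congr _ _ ?_
    filter_upwards [Lp.coeFn_smul c f] with s hs
    simp [hs, mul_left_comm]
  norm_map' f := by
    change ‖(memLp_modulation ξ f).toLp _‖ = ‖f‖
    rw [Lp.norm_toLp, Lp.norm_def]
    congr 1
    refine eLpNorm_congr_norm_ae (Eventually.of_forall fun s => ?_)
    rw [norm_mul, norm_expChar, one_mul]

/-- The Gabor system `{e^{2πi⟨ξ, x⟩} g(x - t) : t ∈ A ℤ^d, ξ ∈ B ℤ^d}`. -/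
def gaborSystem {d : ℕ} (g : L2R d) (A B : Matrix (Fin d) (Fin d) ℝ) : Set (L2R d) :=
  {f | ∃ n k : Fin d → ℤ,
    f = modulation (B *ᵥ fun j => (k j : ℝ)) (translation (A *ᵥ fun j => (n j : ℝ)) g)}

/-- The family `f` is a Parseval frame for the subspace (with underlying set) `H`. -/
def IsParsevalFrame {ι E : Type*} [NormedAddCommGroup E] [InnerProductSpace ℂ E]
    (H : Set E) (f : ι → E) : Prop :=
  (∀ i, f i ∈ H) ∧ ∀ ψ ∈ H, HasSum (fun i => ‖inner ℂ (f i) ψ‖ ^ 2) (‖ψ‖ ^ 2)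

/-- The squared Hilbert–Schmidt norm `∑ ‖T e_i‖²` of a (linear) operator on a Hilbert space,
computed in some orthonormal basis `(e_i)`; it does not depend on that basis. -/
def hsNormSq {E : Type*} [NormedAddCommGroup E] [InnerProductSpace ℂ E] [CompleteSpace E]
    (T : E → E) : ℝ≥0∞ :=
  ∑' e : (exists_hilbertBasis ℂ E).choose, ‖T (e : E)‖ₑ ^ 2

namespace AdmissibleBasis

variable {𝔫 : Type*} [LieRing 𝔫] [LieAlgebra ℝ 𝔫] {r d : ℕ}

/-! ### The dual, the irreducible representations and the Plancherel transform -/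

/-- The linear functional on `𝔫` with `Z_k ↦ l_k`, `Y_j ↦ 0`, `X_i ↦ 0`. -/
def functional (D : AdmissibleBasis 𝔫 r d) (l : Fin r → ℝ) : Module.Dual ℝ 𝔫 :=
  D.toBasis.constr ℝ (Sum.elim l 0)

/-- The cross-section `Σ` of the generic coadjoint orbits, in `𝔷* ≅ ℝ^r`: the functionals `λ`
for which `𝔫(λ) = {v : λ[v, 𝔫] = 0}` is the centre. -/
def crossSection (D : AdmissibleBasis 𝔫 r d) : Set (Fin r → ℝ) :=
  {l | ∀ v : 𝔫, (∀ w : 𝔫, D.functional l ⁅v, w⁆ = 0) → v ∈ LieAlgebra.center ℝ 𝔫}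

/-- The matrix `B(λ) = -(λ[X_i, Y_j])_{i,j}`. -/
def B (D : AdmissibleBasis 𝔫 r d) (l : Fin r → ℝ) : Matrix (Fin d) (Fin d) ℝ :=
  Matrix.of fun i j => -D.functional l ⁅D.X i, D.Y j⁆

/-- The Plancherel measure `dμ(λ) = |det B(λ)| dλ` on `Σ`. -/
def plancherelMeasure (D : AdmissibleBasis 𝔫 r d) : Measure (Fin r → ℝ) :=
  (volume.restrict D.crossSection).withDensity fun l => ENNReal.ofReal |(D.B l).det|

/-- The irreducible representation `π_λ`, realized on `L²(ℝ^d)`: for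
`n = exp(∑ z_k Z_k) exp(∑ y_j Y_j) exp(∑ x_i X_i)`,
`(π_λ(n) F)(s) = e^{2πi λ(z)} e^{2πi ⟨s, B(λ) y⟩} F(s - x)`. -/
def rep (D : AdmissibleBasis 𝔫 r d) (l : Fin r → ℝ) (n : NilGroup D) : L2R d →L[ℂ] L2R d :=
  Complex.exp (2 * Real.pi * Complex.I * (l ⬝ᵥ (NilGroup.coords D n).1 : ℝ)) •
    ((modulation (D.B l *ᵥ (NilGroup.coords D n).2.1)).toContinuousLinearMap ∘L
      (translation (NilGroup.coords D n).2.2).toContinuousLinearMap)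

theorem coeFn_rep (D : AdmissibleBasis 𝔫 r d) (l : Fin r → ℝ) (n : NilGroup D) (F : L2R d) :
    D.rep l n F =ᵐ[volume] fun s =>
      Complex.exp (2 * Real.pi * Complex.I * (l ⬝ᵥ (NilGroup.coords D n).1 : ℝ)) *
        (Complex.exp (2 * Real.pi * Complex.I *
          (s ⬝ᵥ (D.B l *ᵥ (NilGroup.coords D n).2.1) : ℝ)) * F (s - (NilGroup.coords D n).2.2)) := by
  have h1 := Lp.coeFn_smul
    (Complex.exp (2 * Real.pi * Complex.I * (l ⬝ᵥ (NilGroup.coords D n).1 : ℝ)))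
    (modulation (D.B l *ᵥ (NilGroup.coords D n).2.1) (translation (NilGroup.coords D n).2.2 F))
  have h2 := (memLp_modulation (D.B l *ᵥ (NilGroup.coords D n).2.1)
    (translation (NilGroup.coords D n).2.2 F)).coeFn_toLp
  have h3 : translation (NilGroup.coords D n).2.2 F =ᵐ[volume] _ :=
    Lp.coeFn_compMeasurePreserving F
      (measurePreserving_sub_right volume (NilGroup.coords D n).2.2)
  filter_upwards [h1, h2, h3] with s h1 h2 h3
  refine h1.trans ?_
  rw [Pi.smul_apply, smul_eq_mul]
  congr 1
  exact h2.trans (by rw [h3]; rfl)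

/-- The explicit formula does define a representation of `N`. -/
theorem rep_mul (D : AdmissibleBasis 𝔫 r d) (l : Fin r → ℝ) (g h : NilGroup D) :
    D.rep l (g * h) = D.rep l g ∘L D.rep l h := by
  ext1 F
  refine Lp.ext ?_
  have h2 := (measurePreserving_sub_right volume
    (NilGroup.coords D g).2.2).quasiMeasurePreserving.ae (D.coeFn_rep l h F)
  rw [ContinuousLinearMap.comp_apply]
  filter_upwards [D.coeFn_rep l (g * h) F, D.coeFn_rep l g (D.rep l h F), h2] with s h0 h1 h2
  rw [h0, h1, h2, NilGroup.coords_mul, sub_sub]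
  simp only [← mul_assoc, ← Complex.exp_add]
  congr 2
  have key : l ⬝ᵥ D.cZ ⁅D.vX (NilGroup.coords D g).2.2, D.vY (NilGroup.coords D h).2.1⁆ =
      -((NilGroup.coords D g).2.2 ⬝ᵥ (D.B l *ᵥ (NilGroup.coords D h).2.1)) := by
    have e : ∀ z, l ⬝ᵥ z = D.functional l (D.vZ z) := fun z => by
      simp [functional, vZ, Z, Fintype.linearCombination_apply, dotProduct, mul_comm]
    rw [e, D.vZ_cZ_lie]
    simp only [vX, vY, Fintype.linearCombination_apply, sum_lie, lie_sum, smul_lie, lie_smul,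
      map_sum, map_smul, smul_eq_mul, dotProduct, Matrix.mulVec, B, Matrix.of_apply,
      Finset.mul_sum, ← Finset.sum_neg_distrib]
    refine Finset.sum_comm.trans ?_
    exact Finset.sum_congr rfl fun i _ => Finset.sum_congr rfl fun j _ => by ring
  simp only [dotProduct_add, Matrix.mulVec_add, sub_dotProduct, key]
  push_cast
  ring

/-- The group Fourier transform `𝓕 f (λ) = ∫_N f(n) π_λ(n) dn` of an integrable `f`, as an
operator on `L²(ℝ^d)`; the integral converges strongly. -/
def groupFourier (D : AdmissibleBasis 𝔫 r d) (f : NilGroup D → ℂ) (l : Fin r → ℝ)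
    (v : L2R d) : L2R d :=
  ∫ n, f n • D.rep l n v ∂(NilGroup.haar D)

/-- `T` is (a representative of) the Plancherel transform of `f ∈ L²(N)`: a measurable field of
operators which is the limit, in the direct integral over `Σ` of the Hilbert–Schmidt operators
`L²(ℝ^d) ⊗ L²(ℝ^d)` with respect to `μ`, of the Fourier transforms of a sequence
in `L¹(N) ∩ L²(N)` converging to `f` in `L²(N)`. -/
def IsPlancherelTransform (D : AdmissibleBasis 𝔫 r d) (f : Lp ℂ 2 (NilGroup.haar D))
    (T : (Fin r → ℝ) → (L2R d →L[ℂ] L2R d)) : Prop :=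
  (∀ v w : L2R d, AEMeasurable (fun l => inner ℂ w (T l v)) D.plancherelMeasure) ∧
  ∃ fs : ℕ → Lp ℂ 2 (NilGroup.haar D),
    (∀ m, Integrable (fs m) (NilGroup.haar D)) ∧
    Tendsto fs atTop (𝓝 f) ∧
    Tendsto (fun m => ∫⁻ l, hsNormSq (fun v => D.groupFourier (fs m) l v - T l v)
      ∂D.plancherelMeasure) atTop (𝓝 0)

/-- The elementary tensor `v ⊗ u`, as the rank-one Hilbert–Schmidt operator `w ↦ ⟨w, u⟩ v`. -/
def tensor (v u : L2R d) : L2R d →L[ℂ] L2R d := InnerProductSpace.rankOne ℂ v u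

/-- The multiplicity-free space `H`, the preimage under the Plancherel transform of the direct
integral over `I` of `L²(ℝ^d) ⊗ u` with respect to `μ`. -/
def multFreeSpace (D : AdmissibleBasis 𝔫 r d) (I : Set (Fin r → ℝ)) (u : L2R d) :
    Set (Lp ℂ 2 (NilGroup.haar D)) :=
  {f | ∃ T, D.IsPlancherelTransform f T ∧ ∀ᵐ l ∂D.plancherelMeasure,
    (l ∈ I → ∃ v : L2R d, T l = tensor v u) ∧ (l ∉ I → T l = 0)}

/-! ### Quasi-lattices -/

/-- The quasi-lattice `Γ_{a,q,b}`. (The exponentials of the `Z_j` commute with each other, and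
so do those of the `Y_j` and those of the `X_j`.) -/
def quasiLattice (D : AdmissibleBasis 𝔫 r d) (a : Fin r → ℝ) (q b : Fin d → ℝ) :
    Set (NilGroup D) :=
  {g | ∃ (m : Fin r → ℤ) (k n : Fin d → ℤ),
    g = NilGroup.exp (D.vZ fun j => m j / a j) * NilGroup.exp (D.vY fun j => k j / q j) *
      NilGroup.exp (D.vX fun j => n j / b j)}

/-- The reduced quasi-lattice `Γ_{q,b}`. -/
def reducedQuasiLattice (D : AdmissibleBasis 𝔫 r d) (q b : Fin d → ℝ) : Set (NilGroup D) :=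
  {g | ∃ k n : Fin d → ℤ,
    g = NilGroup.exp (D.vY fun j => k j / q j) * NilGroup.exp (D.vX fun j => n j / b j)}

end AdmissibleBasis

/-- The diagonal matrix with entries `1 / c_i`; it is `A(b)` for `c = b` and `D(q)` for
`c = q`. -/
def diagInv {d : ℕ} (c : Fin d → ℝ) : Matrix (Fin d) (Fin d) ℝ := Matrix.diagonal fun i => 1 / c i

end

/-! In the coordinates `(z, y, x)`, the operator `𝓕 f (λ)` is `v ↦ ∫ K(s, x) v(s - x) dx`, where
`K(s, x)` is the Fourier integral of `f` in `(z, y)` at the frequency `(λ, B(λ)ᵀ s)`, with `x` fixed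
(`hasKernel_groupFourier`). Its Hilbert–Schmidt norm is the `L²` norm of `K`, and the substitution
`η = B(λ)ᵀ s` has Jacobian `|det B(λ)|`, the density of `μ`. Plancherel on Euclidean space therefore
controls the group transform, makes it unique (`IsPlancherelTransform.ae_eq`), and yields, for `E ⊆
I` and `w ∈ L²(ℝ^d)`, a function `ψ ∈ L²(N)` whose transform is `1_E w ⊗ u`
(`exists_plancherel_tensor`).

The frame identity is tested on these `ψ`. With `F(λ) = φ̂(λ) u`, the coefficient `⟨L(γ)φ, ψ⟩`
equals `∫_E ⟨π_λ(γ) F(λ), w⟩ dμ(λ)` (`IsPlancherelTransform.inner_leftRegular`). The central part of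
`γ` acts by the scalar `e^{2πi⟨λ, m/a⟩}`. As `E` lies in the box `∏ [0, a_k]`, these characters form
an orthogonal basis of `L²` of the box, and Parseval removes the sum over `m`, leaving the weight `∏
a_k |det B(λ)|`: one factor `|det B|` is the density of `μ`, the other survives the squaring. Hence
`∫_E ∑_{γ ∈ Γ_{q,b}} ∏ a_k |det B| |⟨π_λ(γ)F, w⟩|² dμ = ‖ψ‖² = μ(E) ‖w‖²`. Since `E` is arbitrary,
the integrands agree for almost every `λ`; a countable dense set of `w` gives one null set for all
`w` (`ae_isParsevalFrame_rep`). Reading off `π_λ` on `Γ_{q,b}` shows that the system is a Gabor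
system.

For the determinant, let `g` be the window and `C = B(λ) D(q)`. Testing the Gabor frame on
indicators of small pieces of a lattice cell, on which the modulations are orthogonal, gives `‖g‖² =
|det(A(b) C)|` (`enorm_sq_eq_of_gabor`). As `g` itself belongs to the Parseval frame, `‖g‖⁴ ≤ ‖g‖²`,
so `‖g‖² ≤ 1`. -/

noncomputable section

/-! ### Plancherel for the Fourier integral in the variables `(z, y)` -/

section

open scoped FourierTransform SchwartzMap ContDiff in
/-- On `L¹ ∩ L²` the Fourier integral represents the `L²` Fourier transform. -/
theorem fourier_toLp_ae_eq {E : Type*} [NormedAddCommGroup E] [InnerProductSpace ℝ E]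
    [FiniteDimensional ℝ E] [MeasurableSpace E] [BorelSpace E] {h : E → ℂ}
    (h1 : Integrable h) (h2 : MemLp h 2) :
    (𝓕 (h2.toLp h) : Lp ℂ 2 (volume : Measure E)) =ᵐ[volume] (𝓕 h : E → ℂ) := by
  have hc : Continuous (𝓕 h) :=
    VectorFourier.fourierIntegral_continuous Real.continuous_fourierChar
      (by exact continuous_inner) h1
  -- Both sides define the same tempered distribution by the multiplication formula, and locally
  -- integrable functions are determined by smooth compactly supported tests.
  refine ae_eq_of_integral_contDiff_smul_eq
    ((Lp.memLp _).locallyIntegrable (by norm_num)) hc.locallyIntegrable ?_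
  intro g hg hgs
  have hg' : ContDiff ℝ ∞ (fun x => (g x : ℂ)) := Complex.ofRealCLM.contDiff.comp hg
  have hgs' : HasCompactSupport (fun x => (g x : ℂ)) :=
    hgs.comp_left (g := fun x : ℝ => (x : ℂ)) Complex.ofReal_zero
  obtain ⟨G, hG⟩ : ∃ G : 𝓢(E, ℂ), ∀ x, G x = g x := ⟨hgs'.toSchwartzMap hg', fun _ => rfl⟩
  have e1 := congrArg (fun T => T G) (Lp.fourier_toTemperedDistribution_eq (h2.toLp h))
  simp only [TemperedDistribution.fourier_apply, Lp.toTemperedDistribution_apply] at e1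
  have e2 : ∫ x, (𝓕 G) x • (h2.toLp h) x = ∫ x, (𝓕 G) x • h x := by
    refine integral_congr_ae ?_
    filter_upwards [h2.coeFn_toLp] with x hx
    rw [hx]
  have e3 : ∫ x, (𝓕 (G : E → ℂ)) x • h x = ∫ x, G x • (𝓕 h) x := by
    have := VectorFourier.integral_fourierIntegral_smul_eq_flip (μ := volume) (ν := volume)
      (L := innerₗ E) Real.continuous_fourierChar (by exact continuous_inner)
      (G.integrable (μ := volume)) h1
    rw [flip_innerₗ] at this
    exact this
  rw [e2, SchwartzMap.fourier_coe, e3] at e1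
  simpa [hG] using e1.symm

open scoped FourierTransform in
-- The `L²` isometry applies to the integral itself through `fourier_toLp_ae_eq`; the reflection `w
-- ↦ -w` exchanges `𝓕` and `𝓕⁻`.
theorem lintegral_fourierInv_sq {E : Type*} [NormedAddCommGroup E] [InnerProductSpace ℝ E]
    [FiniteDimensional ℝ E] [MeasurableSpace E] [BorelSpace E] {h : E → ℂ}
    (h1 : Integrable h) (h2 : MemLp h 2) :
    ∫⁻ w, ‖𝓕⁻ h w‖ₑ ^ 2 = ∫⁻ v, ‖h v‖ₑ ^ 2 := by
  have e0 : ∫⁻ w, ‖𝓕⁻ h w‖ₑ ^ 2 = ∫⁻ w, ‖𝓕 h w‖ₑ ^ 2 := by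
    simp_rw [Real.fourierInv_eq_fourier_neg]
    exact lintegral_neg_eq_self (μ := volume) (fun w => ‖𝓕 h w‖ₑ ^ 2)
  have e1 := Lp.norm_fourier_eq (h2.toLp h)
  have e2 : ‖(𝓕 (h2.toLp h) : Lp ℂ 2 (volume : Measure E))‖ₑ = ‖h2.toLp h‖ₑ := by
    rw [← ofReal_norm, ← ofReal_norm, e1]
  rw [Lp.enorm_def, Lp.enorm_def, eLpNorm_congr_ae (fourier_toLp_ae_eq h1 h2),
    eLpNorm_congr_ae h2.coeFn_toLp] at e2
  rw [e0]
  have key : ∀ f : E → ℂ, ∫⁻ w, ‖f w‖ₑ ^ 2 = (eLpNorm f 2 volume) ^ 2 := fun f => by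
    have := eLpNorm_nnreal_pow_eq_lintegral (f := f) (p := 2) (μ := volume) (by norm_num)
    simpa using this.symm
  rw [key, key, e2]

/-- The Fourier integral `(λ, η) ↦ ∫ e^{2πi(⟨λ, z⟩ + ⟨η, y⟩)} g(z, y) dz dy`. -/
def fourierPair {r d : ℕ} (g : (Fin r → ℝ) × (Fin d → ℝ) → ℂ)
    (ω : (Fin r → ℝ) × (Fin d → ℝ)) : ℂ :=
  ∫ w, Complex.exp (2 * Real.pi * Complex.I * (ω.1 ⬝ᵥ w.1 + ω.2 ⬝ᵥ w.2 : ℝ)) * g w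

/-- Coordinates gathering `(z, y)` into a single Euclidean space. -/
def euclideanPair (r d : ℕ) :
    (Fin r → ℝ) × (Fin d → ℝ) ≃ᵐ EuclideanSpace ℝ (Fin r ⊕ Fin d) :=
  (MeasurableEquiv.sumPiEquivProdPi (fun _ : Fin r ⊕ Fin d => ℝ)).symm.trans
    (MeasurableEquiv.toLp 2 (Fin r ⊕ Fin d → ℝ))

theorem measurePreserving_euclideanPair (r d : ℕ) :
    MeasurePreserving (euclideanPair r d) volume volume :=
  (volume_measurePreserving_sumPiEquivProdPi_symm (fun _ : Fin r ⊕ Fin d => ℝ)).trans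
    (PiLp.volume_preserving_toLp (Fin r ⊕ Fin d))

open scoped FourierTransform in
-- The exponent of `π_λ` has a plus sign, hence `𝓕⁻`. The passage to Euclidean space replaces the
-- sup norm by an inner product whose pairing is the sum of the two dot products.
theorem fourierPair_eq_fourierInv {r d : ℕ} (g : (Fin r → ℝ) × (Fin d → ℝ) → ℂ)
    (ω : (Fin r → ℝ) × (Fin d → ℝ)) :
    fourierPair g ω = 𝓕⁻ (g ∘ (euclideanPair r d).symm) (euclideanPair r d ω) := by
  rw [Real.fourierInv_eq', ← (measurePreserving_euclideanPair r d).integral_comp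
    (euclideanPair r d).measurableEmbedding, fourierPair]
  refine integral_congr_ae (Eventually.of_forall fun w => ?_)
  simp only [Function.comp_apply, MeasurableEquiv.symm_apply_apply, smul_eq_mul]
  congr 2
  have : inner ℝ (euclideanPair r d w) (euclideanPair r d ω) = ω.1 ⬝ᵥ w.1 + ω.2 ⬝ᵥ w.2 := by
    simp [euclideanPair, PiLp.inner_apply, Fintype.sum_sum_type, dotProduct,
      MeasurableEquiv.sumPiEquivProdPi, Equiv.sumPiEquivProdPi]
  rw [this]
  push_cast
  ring

theorem lintegral_fourierPair_sq {r d : ℕ} {g : (Fin r → ℝ) × (Fin d → ℝ) → ℂ}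
    (h1 : Integrable g) (h2 : MemLp g 2) :
    ∫⁻ ω, ‖fourierPair g ω‖ₑ ^ 2 = ∫⁻ w, ‖g w‖ₑ ^ 2 := by
  have hm := measurePreserving_euclideanPair r d
  have hms := hm.symm
  simp_rw [fourierPair_eq_fourierInv]
  rw [hm.lintegral_comp_emb (euclideanPair r d).measurableEmbedding
    (fun v => ‖Real.instFourierTransformInv.fourierInv (g ∘ (euclideanPair r d).symm) v‖ₑ ^ 2)]
  rw [lintegral_fourierInv_sq (hms.integrable_comp_of_integrable h1)
    (h2.comp_measurePreserving hms)]
  exact hms.lintegral_comp_emb (euclideanPair r d).symm.measurableEmbedding (fun w => ‖g w‖ₑ ^ 2)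

theorem continuous_expChar : Continuous fun a : ℝ => Complex.exp (2 * Real.pi * Complex.I * a) := by
  fun_prop

theorem star_expChar (a : ℝ) : starRingEnd ℂ (Complex.exp (2 * Real.pi * Complex.I * a)) =
    Complex.exp (2 * Real.pi * Complex.I * (-a : ℝ)) := by
  rw [← Complex.exp_conj]
  congr 1
  simp only [map_mul, Complex.conj_ofReal, Complex.conj_I, map_ofNat]
  push_cast
  ring

/-- Fubini, with a kernel of modulus one: the formal adjoint of the transform is the transform
conjugated by complex conjugation. -/
theorem integral_star_fourierPair_mul {r d : ℕ} {f g : (Fin r → ℝ) × (Fin d → ℝ) → ℂ}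
    (hf : Integrable f) (hg : Integrable g) :
    ∫ ω, starRingEnd ℂ (fourierPair f ω) * g ω =
      ∫ w, starRingEnd ℂ (f w) * starRingEnd ℂ (fourierPair (fun ω => starRingEnd ℂ (g ω)) w) := by
  simp only [fourierPair, ← integral_conj, ← integral_const_mul, ← integral_mul_const, map_mul,
    starRingEnd_self_apply, star_expChar]
  rw [integral_integral_swap]
  · refine integral_congr_ae (Eventually.of_forall fun w => integral_congr_ae
      (Eventually.of_forall fun ω => ?_))
    simp only [dotProduct_comm ω.1, dotProduct_comm ω.2]
    ring
  · have hf' : Integrable (fun w => starRingEnd ℂ (f w)) :=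
      (LinearIsometryEquiv.integrable_comp_iff Complex.conjLIE).2 hf
    refine ((hg.mul_prod hf').bdd_mul (c := 1)
      (f := fun p => Complex.exp (2 * Real.pi * Complex.I *
        (-(p.1.1 ⬝ᵥ p.2.1 + p.1.2 ⬝ᵥ p.2.2) : ℝ))) ?_ ?_).congr ?_
    · refine (continuous_expChar.comp ?_).aestronglyMeasurable
      unfold dotProduct
      fun_prop
    · exact Eventually.of_forall fun p => (norm_expChar _).le
    · exact Eventually.of_forall fun p => by simp only [Function.uncurry]; ring

end

/-! ### The partial Fourier transform on coordinate space -/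

section

theorem eLpNorm_two_sq {α E : Type*} [MeasurableSpace α] [NormedAddCommGroup E] (μ : Measure α)
    (f : α → E) : eLpNorm f 2 μ ^ 2 = ∫⁻ a, ‖f a‖ₑ ^ 2 ∂μ := by
  simpa using eLpNorm_nnreal_pow_eq_lintegral (f := f) (p := 2) (μ := μ) (by norm_num)

theorem enorm_Lp_two_sq {α E : Type*} [MeasurableSpace α] [NormedAddCommGroup E] {μ : Measure α}
    (f : Lp E 2 μ) : ‖f‖ₑ ^ 2 = ∫⁻ a, ‖f a‖ₑ ^ 2 ∂μ := by
  rw [Lp.enorm_def, eLpNorm_two_sq]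

theorem memLp_two_of_lintegral_lt_top {α E : Type*} [MeasurableSpace α] [NormedAddCommGroup E]
    {μ : Measure α} {f : α → E} (hf : AEStronglyMeasurable f μ)
    (h : ∫⁻ a, ‖f a‖ₑ ^ 2 ∂μ < ∞) : MemLp f 2 μ := by
  refine ⟨hf, ?_⟩
  rw [← eLpNorm_two_sq] at h
  by_contra hc
  rw [not_lt, top_le_iff] at hc
  simp [hc] at h

theorem MeasureTheory.MemLp.lintegral_sq_lt_top {α E : Type*} [MeasurableSpace α]
    [NormedAddCommGroup E] {μ : Measure α} {f : α → E} (hf : MemLp f 2 μ) :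
    ∫⁻ a, ‖f a‖ₑ ^ 2 ∂μ < ∞ := by
  rw [← eLpNorm_two_sq]
  exact ENNReal.pow_lt_top hf.2

theorem exists_seq_integrable_tendsto {α : Type*} [MeasurableSpace α] {μ : Measure α}
    (f : Lp ℂ 2 μ) : ∃ fs : ℕ → Lp ℂ 2 μ, (∀ m, Integrable (fs m) μ) ∧ Tendsto fs atTop (𝓝 f) := by
  have hd := Lp.simpleFunc.denseRange (E := ℂ) (μ := μ) (p := 2) (by norm_num)
  obtain ⟨x, hx, hl⟩ := mem_closure_iff_seq_limit.1 (hd f)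
  refine ⟨x, fun m => ?_, hl⟩
  obtain ⟨g, hg⟩ := hx m
  rw [← hg]
  have h1 := Lp.simpleFunc.toSimpleFunc_eq_toFun g
  refine Integrable.congr ?_ h1
  exact (SimpleFunc.memLp_iff_integrable (by norm_num) (by norm_num)).1 (Lp.simpleFunc.memLp g)

variable {r d : ℕ}

/-- The partial Fourier integral in the first two variables. -/
def partialFourier (f : (Fin r → ℝ) × (Fin d → ℝ) × (Fin d → ℝ) → ℂ)
    (p : (Fin r → ℝ) × (Fin d → ℝ) × (Fin d → ℝ)) : ℂ :=
  fourierPair (fun w => f (w.1, w.2, p.2.2)) (p.1, p.2.1)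

theorem measurePreserving_assoc (r d : ℕ) : MeasurePreserving
    (MeasurableEquiv.prodAssoc : ((Fin r → ℝ) × (Fin d → ℝ)) × (Fin d → ℝ) ≃ᵐ _)
    volume volume :=
  volume_preserving_prodAssoc

theorem stronglyMeasurable_partialFourier {f : (Fin r → ℝ) × (Fin d → ℝ) × (Fin d → ℝ) → ℂ}
    (hf : StronglyMeasurable f) : StronglyMeasurable (partialFourier f) := by
  unfold partialFourier fourierPair
  refine StronglyMeasurable.integral_prod_right
    (f := fun (p : (Fin r → ℝ) × (Fin d → ℝ) × (Fin d → ℝ)) (w : (Fin r → ℝ) × (Fin d → ℝ)) =>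
      Complex.exp (2 * Real.pi * Complex.I * (p.1 ⬝ᵥ w.1 + p.2.1 ⬝ᵥ w.2 : ℝ)) *
        f (w.1, w.2, p.2.2)) ?_
  refine StronglyMeasurable.mul (f := fun x : ((Fin r → ℝ) × (Fin d → ℝ) × (Fin d → ℝ)) ×
      ((Fin r → ℝ) × (Fin d → ℝ)) =>
      Complex.exp (2 * Real.pi * Complex.I * (x.1.1 ⬝ᵥ x.2.1 + x.1.2.1 ⬝ᵥ x.2.2 : ℝ)))
      (g := fun x => f (x.2.1, x.2.2, x.1.2.2)) ?_ ?_
  · refine (continuous_expChar.comp ?_).stronglyMeasurable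
    unfold dotProduct
    fun_prop
  · exact hf.comp_measurable (by fun_prop)

theorem lintegral_assoc {H : (Fin r → ℝ) × (Fin d → ℝ) × (Fin d → ℝ) → ℝ≥0∞}
    (hH : AEMeasurable H) :
    ∫⁻ p, H p = ∫⁻ x : Fin d → ℝ, ∫⁻ w : (Fin r → ℝ) × (Fin d → ℝ), H (w.1, w.2, x) := by
  rw [← (measurePreserving_assoc r d).lintegral_comp_emb
    (MeasurableEquiv.measurableEmbedding _), Measure.volume_eq_prod ((Fin r → ℝ) × (Fin d → ℝ)),
    lintegral_prod_symm]
  · rfl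
  · exact hH.comp_quasiMeasurePreserving (measurePreserving_assoc r d).quasiMeasurePreserving

theorem ae_slice_integrable {f : (Fin r → ℝ) × (Fin d → ℝ) × (Fin d → ℝ) → ℂ}
    (hf : Integrable f) : ∀ᵐ x : Fin d → ℝ,
      Integrable (fun w : (Fin r → ℝ) × (Fin d → ℝ) => f (w.1, w.2, x)) :=
  ((measurePreserving_assoc r d).integrable_comp_of_integrable hf).prod_left_ae

theorem integral_assoc {f : (Fin r → ℝ) × (Fin d → ℝ) × (Fin d → ℝ) → ℂ}
    (hf : Integrable f) :
    ∫ p, f p = ∫ x : Fin d → ℝ, ∫ w : (Fin r → ℝ) × (Fin d → ℝ), f (w.1, w.2, x) := by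
  rw [← (measurePreserving_assoc r d).integral_comp (MeasurableEquiv.measurableEmbedding _),
    Measure.volume_eq_prod ((Fin r → ℝ) × (Fin d → ℝ)), integral_prod_symm]
  · rfl
  · exact (measurePreserving_assoc r d).integrable_comp_of_integrable hf

theorem ae_slice_memLp {f : (Fin r → ℝ) × (Fin d → ℝ) × (Fin d → ℝ) → ℂ}
    (hf : MemLp f 2) (hm : StronglyMeasurable f) : ∀ᵐ x : Fin d → ℝ,
      MemLp (fun w : (Fin r → ℝ) × (Fin d → ℝ) => f (w.1, w.2, x)) 2 := by
  have h := hf.lintegral_sq_lt_top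
  have hm' : Measurable fun p => ‖f p‖ₑ ^ 2 := hm.enorm.pow_const 2
  rw [lintegral_assoc hm'.aemeasurable] at h
  have h2 := ae_lt_top (Measurable.lintegral_prod_right'
    (f := fun q : (Fin d → ℝ) × ((Fin r → ℝ) × (Fin d → ℝ)) => ‖f (q.2.1, q.2.2, q.1)‖ₑ ^ 2)
    (hm'.comp (by fun_prop : Measurable fun q : (Fin d → ℝ) × ((Fin r → ℝ) × (Fin d → ℝ)) =>
      (q.2.1, q.2.2, q.1)))) h.ne
  filter_upwards [h2] with x hx
  exact memLp_two_of_lintegral_lt_top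
    (hm.comp_measurable (by fun_prop)).aestronglyMeasurable hx

/-- Plancherel in `(z, y)` on almost every slice `x = const`, then integration over `x`. -/
theorem lintegral_partialFourier_sq {f : (Fin r → ℝ) × (Fin d → ℝ) × (Fin d → ℝ) → ℂ}
    (hm : StronglyMeasurable f) (h1 : Integrable f) (h2 : MemLp f 2) :
    ∫⁻ p, ‖partialFourier f p‖ₑ ^ 2 = ∫⁻ p, ‖f p‖ₑ ^ 2 := by
  have e1 := lintegral_assoc (r := r) (d := d) (H := fun p => ‖partialFourier f p‖ₑ ^ 2)
    (Measurable.aemeasurable ((stronglyMeasurable_partialFourier hm).enorm.pow_const 2))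
  have e2 := lintegral_assoc (r := r) (d := d) (H := fun p => ‖f p‖ₑ ^ 2)
    (Measurable.aemeasurable (hm.enorm.pow_const 2))
  rw [e1, e2]
  refine lintegral_congr_ae ?_
  filter_upwards [ae_slice_integrable h1, ae_slice_memLp h2 hm] with x hx1 hx2
  have := lintegral_fourierPair_sq hx1 hx2
  exact this

theorem memLp_partialFourier {f : (Fin r → ℝ) × (Fin d → ℝ) × (Fin d → ℝ) → ℂ}
    (hm : StronglyMeasurable f) (h1 : Integrable f) (h2 : MemLp f 2) :
    MemLp (partialFourier f) 2 := by
  refine memLp_two_of_lintegral_lt_top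
    (stronglyMeasurable_partialFourier hm).aestronglyMeasurable ?_
  rw [lintegral_partialFourier_sq hm h1 h2]
  exact h2.lintegral_sq_lt_top

/-- Only almost everywhere: on the null set of `x` with a non-integrable slice the integral takes
the value `0` and additivity may fail. -/
theorem partialFourier_sub_ae {f g : (Fin r → ℝ) × (Fin d → ℝ) × (Fin d → ℝ) → ℂ}
    (hf : Integrable f) (hg : Integrable g) :
    partialFourier (f - g) =ᵐ[volume] partialFourier f - partialFourier g := by
  have h : ∀ᵐ q : ((Fin r → ℝ) × (Fin d → ℝ)) × (Fin d → ℝ),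
      Integrable (fun w : (Fin r → ℝ) × (Fin d → ℝ) => f (w.1, w.2, q.2)) ∧
      Integrable (fun w : (Fin r → ℝ) × (Fin d → ℝ) => g (w.1, w.2, q.2)) := by
    have := (ae_slice_integrable hf).and (ae_slice_integrable hg)
    exact Measure.quasiMeasurePreserving_snd.ae this
  have h' := (measurePreserving_assoc r d).symm.quasiMeasurePreserving.ae h
  filter_upwards [h'] with p hp
  obtain ⟨hp1, hp2⟩ : Integrable (fun w : (Fin r → ℝ) × (Fin d → ℝ) => f (w.1, w.2, p.2.2)) volume ∧
      Integrable (fun w : (Fin r → ℝ) × (Fin d → ℝ) => g (w.1, w.2, p.2.2)) volume := hp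
  have hb : ∀ {u : (Fin r → ℝ) × (Fin d → ℝ) → ℂ}, Integrable u → Integrable fun w =>
      Complex.exp (2 * Real.pi * Complex.I * (p.1 ⬝ᵥ w.1 + p.2.1 ⬝ᵥ w.2 : ℝ)) * u w := by
    intro u hu
    refine hu.bdd_mul (c := 1) ?_ (Eventually.of_forall fun w => (norm_expChar _).le)
    refine (continuous_expChar.comp ?_).aestronglyMeasurable
    unfold dotProduct
    fun_prop
  change fourierPair _ _ = fourierPair _ _ - fourierPair _ _
  unfold fourierPair
  refine Eq.trans ?_ (integral_sub (hb hp1) (hb hp2))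
  simp [mul_sub]

theorem integral_star_partialFourier_mul {f g : (Fin r → ℝ) × (Fin d → ℝ) × (Fin d → ℝ) → ℂ}
    (hfm : StronglyMeasurable f) (hf1 : Integrable f) (hf2 : MemLp f 2)
    (hgm : StronglyMeasurable g) (hg1 : Integrable g) (hg2 : MemLp g 2) :
    ∫ p, starRingEnd ℂ (partialFourier f p) * g p =
      ∫ p, starRingEnd ℂ (f p) *
        starRingEnd ℂ (partialFourier (fun q => starRingEnd ℂ (g q)) p) := by
  have hg1' : Integrable (fun q => starRingEnd ℂ (g q)) :=
    (LinearIsometryEquiv.integrable_comp_iff Complex.conjLIE).2 hg1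
  have hgm' : StronglyMeasurable (fun q => starRingEnd ℂ (g q)) :=
    Complex.continuous_conj.comp_stronglyMeasurable hgm
  rw [integral_assoc, integral_assoc]
  · refine integral_congr_ae ?_
    filter_upwards [ae_slice_integrable hf1, ae_slice_integrable hg1] with x h1 h2
    exact integral_star_fourierPair_mul h1 h2
  · exact (hf2.star).integrable_mul (memLp_partialFourier hgm' hg1' hg2.star).star
  · exact (memLp_partialFourier hfm hf1 hf2).star.integrable_mul hg2

/-- On `L¹ ∩ L²` the adjoint is the same transform conjugated by complex conjugation, hence again
isometric, and it extends to all of `L²` by density and completeness. The norm equality says that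
the adjoint loses nothing, which is how the transform is inverted later. -/
theorem exists_adjoint_partialFourier
    (G : Lp ℂ 2 (volume : Measure ((Fin r → ℝ) × (Fin d → ℝ) × (Fin d → ℝ)))) :
    ∃ ψ : Lp ℂ 2 (volume : Measure ((Fin r → ℝ) × (Fin d → ℝ) × (Fin d → ℝ))),
      ‖ψ‖ = ‖G‖ ∧ ∀ f, StronglyMeasurable f → Integrable f → ∀ hf : MemLp f 2 volume,
        ∫ p, starRingEnd ℂ (partialFourier f p) * G p = inner ℂ (hf.toLp f) ψ := by
  obtain ⟨gs, hgi, hgt⟩ := exists_seq_integrable_tendsto G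
  let c : ((Fin r → ℝ) × (Fin d → ℝ) × (Fin d → ℝ) → ℂ) →
    ((Fin r → ℝ) × (Fin d → ℝ) × (Fin d → ℝ) → ℂ) := fun g q => starRingEnd ℂ (g q)
  have hci : ∀ {g}, Integrable g → Integrable (c g) := fun h =>
    (LinearIsometryEquiv.integrable_comp_iff Complex.conjLIE).2 h
  have hcm : ∀ {g}, StronglyMeasurable g → StronglyMeasurable (c g) := fun h =>
    Complex.continuous_conj.comp_stronglyMeasurable h
  have hc2 : ∀ {g}, MemLp g 2 volume → MemLp (c g) 2 volume := fun h => h.star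
  have hV : ∀ g : Lp ℂ 2 (volume : Measure ((Fin r → ℝ) × (Fin d → ℝ) × (Fin d → ℝ))),
      Integrable g → MemLp (c (partialFourier (c g))) 2 volume := fun g hg =>
    hc2 (memLp_partialFourier (hcm (Lp.stronglyMeasurable g)) (hci hg) (hc2 (Lp.memLp g)))
  let v : ℕ → Lp ℂ 2 (volume : Measure ((Fin r → ℝ) × (Fin d → ℝ) × (Fin d → ℝ))) := fun n =>
    (hV (gs n) (hgi n)).toLp
  have hnc : ∀ g, eLpNorm (c g) 2 volume = eLpNorm g 2 volume := fun g =>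
    eLpNorm_congr_norm_ae (Eventually.of_forall fun p => by simp [c])
  have hpf : ∀ {g : (Fin r → ℝ) × (Fin d → ℝ) × (Fin d → ℝ) → ℂ}, StronglyMeasurable g →
      Integrable g volume → MemLp g 2 volume →
      eLpNorm (partialFourier g) 2 volume = eLpNorm g 2 volume := fun h0 h1 h2 => by
    have := lintegral_partialFourier_sq h0 h1 h2
    rw [← eLpNorm_two_sq, ← eLpNorm_two_sq] at this
    exact (ENNReal.pow_right_strictMono two_ne_zero).injective this
  -- Conjugation and `partialFourier` preserve `L²` norms, so `v` inherits the Cauchy property from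
  -- `gs`.
  have hdist : ∀ m n, dist (v m) (v n) = dist (gs m) (gs n) := by
    intro m n
    rw [Lp.dist_def, Lp.dist_def]
    congr 1
    have e1 : eLpNorm (⇑(v m) - ⇑(v n)) 2 volume =
        eLpNorm (c (partialFourier (c (gs m)) - partialFourier (c (gs n)))) 2 volume := by
      refine eLpNorm_congr_ae ?_
      filter_upwards [(hV (gs m) (hgi m)).coeFn_toLp, (hV (gs n) (hgi n)).coeFn_toLp] with p h1 h2
      simp only [Pi.sub_apply, v, h1, h2, c, map_sub]
    rw [e1, hnc, ← eLpNorm_congr_ae (partialFourier_sub_ae (hci (hgi m)) (hci (hgi n))), hpf, ← hnc]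
    · congr 1
      funext p
      simp [c]
    · exact (hcm (Lp.stronglyMeasurable _)).sub (hcm (Lp.stronglyMeasurable _))
    · exact (hci (hgi m)).sub (hci (hgi n))
    · exact (hc2 (Lp.memLp _)).sub (hc2 (Lp.memLp _))
  have hnorm : ∀ n, ‖v n‖ = ‖gs n‖ := by
    intro n
    rw [Lp.norm_toLp, Lp.norm_def, hnc, hpf (hcm (Lp.stronglyMeasurable _)) (hci (hgi n))
      (hc2 (Lp.memLp _)), hnc]
  have hcau : CauchySeq v := by
    have := hgt.cauchySeq
    rw [Metric.cauchySeq_iff] at this ⊢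
    simpa only [hdist] using this
  obtain ⟨ψ, hψ⟩ := cauchySeq_tendsto_of_complete hcau
  refine ⟨ψ, ?_, fun f hfm hf1 hf2 => ?_⟩
  · refine tendsto_nhds_unique hψ.norm ?_
    simp only [hnorm]
    exact hgt.norm
  · have hpf2 := memLp_partialFourier hfm hf1 hf2
    have e0 : ∀ g : Lp ℂ 2 (volume : Measure ((Fin r → ℝ) × (Fin d → ℝ) × (Fin d → ℝ))),
        ∫ p, starRingEnd ℂ (partialFourier f p) * g p = inner ℂ hpf2.toLp g := fun g => by
      rw [L2.inner_def]
      refine integral_congr_ae ?_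
      filter_upwards [hpf2.coeFn_toLp] with p hp
      rw [hp, RCLike.inner_apply, mul_comm]
    rw [e0]
    refine tendsto_nhds_unique (tendsto_const_nhds.inner hgt) ?_
    have e1 : ∀ n, inner ℂ hpf2.toLp (gs n) = inner ℂ hf2.toLp (v n) := fun n => by
      rw [← e0, integral_star_partialFourier_mul hfm hf1 hf2 (Lp.stronglyMeasurable _) (hgi n)
        (Lp.memLp _), L2.inner_def]
      refine integral_congr_ae ?_
      filter_upwards [hf2.coeFn_toLp, (hV (gs n) (hgi n)).coeFn_toLp] with p h1 h2
      rw [h1, h2, RCLike.inner_apply, mul_comm]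
    simp only [e1]
    exact tendsto_const_nhds.inner hψ

end

/-! ### Hilbert–Schmidt norms and integral operators -/

section

/-- In `ℝ≥0∞` sums and integrals can be interchanged without summability conditions; all frame
identities below are handled in this form. -/
theorem hasSum_sq_iff {F ι : Type*} [NormedAddCommGroup F] (c : ι → ℂ) (w : F) :
    HasSum (fun i => ‖c i‖ ^ 2) (‖w‖ ^ 2) ↔ ∑' i, ‖c i‖ₑ ^ 2 = ‖w‖ₑ ^ 2 := by
  have h1 : ∀ x : ℂ, ‖x‖ₑ ^ 2 = ENNReal.ofReal (‖x‖ ^ 2) := fun x => by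
    rw [ENNReal.ofReal_pow (norm_nonneg _), ofReal_norm]
  have h2 : ‖w‖ₑ ^ 2 = ENNReal.ofReal (‖w‖ ^ 2) := by
    rw [ENNReal.ofReal_pow (norm_nonneg _), ofReal_norm]
  simp only [h1, h2]
  constructor
  · intro h
    rw [← ENNReal.ofReal_tsum_of_nonneg (fun _ => by positivity) h.summable, h.tsum_eq]
  · intro h
    have h3 := ENNReal.hasSum_toReal (f := fun i => ENNReal.ofReal (‖c i‖ ^ 2))
      (by rw [h]; exact ENNReal.ofReal_ne_top)
    rw [← ENNReal.tsum_toReal_eq (fun _ => ENNReal.ofReal_ne_top), h,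
      ENNReal.toReal_ofReal (by positivity)] at h3
    simpa using h3

section Hilbert

variable {E : Type*} [NormedAddCommGroup E] [InnerProductSpace ℂ E]

/-- Orthonormal vectors are at distance `√2`, so the balls of radius `1/2` around them are disjoint
open sets in a separable space. -/
theorem Orthonormal.countable [TopologicalSpace.SeparableSpace E] {ι : Type*} {v : ι → E}
    (hv : Orthonormal ℂ v) : Countable ι := by
  have hd : Set.PairwiseDisjoint Set.univ fun i => Metric.ball (v i) (1 / 2) := by
    intro i _ j _ hij
    refine Metric.ball_disjoint_ball ?_
    have h1 : ‖v i - v j‖ ^ 2 = 2 := by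
      rw [@norm_sub_sq ℂ, hv.1 i, hv.1 j, hv.2 hij]
      norm_num
    rw [dist_eq_norm]
    nlinarith [norm_nonneg (v i - v j)]
  have := hd.countable_of_isOpen (fun i _ => Metric.isOpen_ball)
    (fun i _ => ⟨v i, Metric.mem_ball_self (by norm_num)⟩)
  exact Set.countable_univ_iff.1 this

theorem HilbertBasis.tsum_enorm_inner_sq {ι : Type*} (b : HilbertBasis ι ℂ E) (x : E) :
    ∑' i, ‖inner ℂ (b i) x‖ₑ ^ 2 = ‖x‖ₑ ^ 2 := by
  rw [← hasSum_sq_iff]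
  have h := Complex.hasSum_re (b.hasSum_inner_mul_inner x x)
  rw [inner_self_eq_norm_sq_to_K] at h
  convert h using 1
  · funext i
    rw [← inner_conj_symm, Complex.mul_conj', RCLike.norm_conj]
    norm_cast
  · norm_cast

theorem exists_basis_hsNormSq (E : Type*) [NormedAddCommGroup E] [InnerProductSpace ℂ E]
    [CompleteSpace E] [TopologicalSpace.SeparableSpace E] :
    ∃ (S : Set E) (b : HilbertBasis S ℂ E), Countable S ∧
      ∀ T : E → E, hsNormSq T = ∑' e, ‖T (b e)‖ₑ ^ 2 := by
  obtain ⟨b, hb⟩ := (exists_hilbertBasis ℂ E).choose_spec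
  exact ⟨_, b, b.orthonormal.countable, fun T => by simp only [hb, hsNormSq]⟩

variable [CompleteSpace E]

/-- Cauchy–Schwarz on the partial sums of the expansion of `u` in the basis. -/
theorem enorm_apply_sq_le_hsNormSq [TopologicalSpace.SeparableSpace E] (T : E →L[ℂ] E) (u : E) :
    ‖T u‖ₑ ^ 2 ≤ hsNormSq T * ‖u‖ₑ ^ 2 := by
  obtain ⟨S, b, hS, hb⟩ := exists_basis_hsNormSq E
  have h1 : Tendsto (fun F : Finset S => ‖∑ e ∈ F, T (inner ℂ (b e) u • b e)‖ₑ ^ 2) atTop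
      (𝓝 (‖T u‖ₑ ^ 2)) := by
    have h := T.hasSum (b.hasSum_repr u)
    simp only [b.repr_apply_apply] at h
    exact (ENNReal.continuous_pow 2).continuousAt.tendsto.comp
      (continuous_enorm.continuousAt.tendsto.comp h)
  refine le_of_tendsto h1 (Eventually.of_forall fun F => ?_)
  have h2 : ‖∑ e ∈ F, T (inner ℂ (b e) u • b e)‖₊ ^ 2 ≤
      (∑ e ∈ F, ‖T (b e)‖₊ ^ 2) * ∑ e ∈ F, ‖inner ℂ (b e) u‖₊ ^ 2 := by
    refine le_trans ?_ (Finset.sum_mul_sq_le_sq_mul_sq F _ _)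
    gcongr
    refine (nnnorm_sum_le _ _).trans (Finset.sum_le_sum fun e _ => ?_)
    rw [map_smul, nnnorm_smul, mul_comm]
  have h3 : ‖∑ e ∈ F, T (inner ℂ (b e) u • b e)‖ₑ ^ 2 ≤
      (∑ e ∈ F, ‖T (b e)‖ₑ ^ 2) * ∑ e ∈ F, ‖inner ℂ (b e) u‖ₑ ^ 2 := by
    simp only [enorm_eq_nnnorm]
    exact_mod_cast h2
  refine h3.trans ?_
  rw [hb, ← b.tsum_enorm_inner_sq u]
  gcongr <;> exact ENNReal.sum_le_tsum _

/-- The crude constant `4` is enough, since the bound serves only for finiteness and for limits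
equal to zero. -/
theorem hsNormSq_add_le (A B : E → E) :
    hsNormSq (fun v => A v + B v) ≤ 4 * (hsNormSq A + hsNormSq B) := by
  simp only [hsNormSq]
  rw [← ENNReal.tsum_add, ← ENNReal.tsum_mul_left]
  refine ENNReal.tsum_le_tsum fun e => ?_
  have key : ∀ a b : ℝ≥0∞, (a + b) ^ 2 ≤ 4 * (a ^ 2 + b ^ 2) := by
    intro a b
    wlog hab : a ≤ b generalizing a b
    · rw [add_comm a, add_comm (a ^ 2)]
      exact this b a (le_of_not_ge hab)
    calc (a + b) ^ 2 ≤ (b + b) ^ 2 := by gcongr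
      _ = 4 * b ^ 2 := by ring
      _ ≤ _ := by gcongr; exact le_add_self
  exact (pow_le_pow_left' (enorm_add_le _ _) 2).trans (key _ _)

/-- Pettis: the partial sums of the basis expansion are measurable and converge pointwise. -/
theorem aestronglyMeasurable_of_forall_inner [TopologicalSpace.SeparableSpace E]
    {α : Type*} [MeasurableSpace α] {μ : Measure α} {f : α → E}
    (hf : ∀ w, AEMeasurable (fun a => inner ℂ w (f a)) μ) : AEStronglyMeasurable f μ := by
  obtain ⟨S, b, hS, hb⟩ := exists_basis_hsNormSq E
  refine aestronglyMeasurable_of_tendsto_ae (atTop : Filter (Finset S))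
    (f := fun F a => ∑ e ∈ F, inner ℂ (b e) (f a) • b e) (fun F => ?_)
    (Eventually.of_forall fun a => ?_)
  · exact Finset.aestronglyMeasurable_fun_sum _ fun e _ =>
      (hf _).aestronglyMeasurable.smul_const _
  · have h := b.hasSum_repr (f a)
    simp only [b.repr_apply_apply] at h
    exact h

theorem aemeasurable_hsNormSq [TopologicalSpace.SeparableSpace E]
    {α : Type*} [MeasurableSpace α] {μ : Measure α} {T : α → E → E}
    (hT : ∀ v w, AEMeasurable (fun a => inner ℂ w (T a v)) μ) :
    AEMeasurable (fun a => hsNormSq (T a)) μ := by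
  obtain ⟨S, b, hS, hb⟩ := exists_basis_hsNormSq E
  simp only [hb]
  refine AEMeasurable.tsum fun e => ?_
  simp only [← b.tsum_enorm_inner_sq (T _ _)]
  exact AEMeasurable.tsum fun e' => (hT _ _).enorm.pow_const 2

end Hilbert

variable {d : ℕ}

instance : TopologicalSpace.SeparableSpace (L2R d) := by
  have : Fact ((2 : ℝ≥0∞) ≠ ∞) := ⟨by norm_num⟩
  infer_instance

theorem measurePreserving_const_sub (s : Fin d → ℝ) :
    MeasurePreserving (fun x : Fin d → ℝ => s - x) volume volume :=
  Measure.measurePreserving_sub_left volume s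

/-- `T` is the integral operator `v ↦ (s ↦ ∫ K(s, x) v(s - x) dx)`. -/
def HasKernel (T : L2R d → L2R d) (K : (Fin d → ℝ) × (Fin d → ℝ) → ℂ) : Prop :=
  ∀ v : L2R d, T v =ᵐ[volume] fun s => ∫ x, K (s, x) * v (s - x)

theorem ae_memLp_slice {K : (Fin d → ℝ) × (Fin d → ℝ) → ℂ} (hK : StronglyMeasurable K)
    (hK2 : ∫⁻ q, ‖K q‖ₑ ^ 2 < ∞) : ∀ᵐ s, MemLp (fun x => K (s, x)) 2 := by
  rw [Measure.volume_eq_prod, lintegral_prod _ ((hK.enorm.pow_const 2).aemeasurable)] at hK2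
  filter_upwards [ae_lt_top (Measurable.lintegral_prod_right' (hK.enorm.pow_const 2)) hK2.ne]
    with s hs
  exact memLp_two_of_lintegral_lt_top
    (hK.comp_measurable measurable_prodMk_left).aestronglyMeasurable hs

theorem memLp_comp_const_sub (v : L2R d) (s : Fin d → ℝ) : MemLp (fun x => v (s - x)) 2 :=
  (Lp.memLp v).comp_measurePreserving (measurePreserving_const_sub s)

theorem HasKernel.sub {T₁ T₂ : L2R d → L2R d} {K₁ K₂ : (Fin d → ℝ) × (Fin d → ℝ) → ℂ}
    (h₁ : HasKernel T₁ K₁) (h₂ : HasKernel T₂ K₂)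
    (hK₁ : StronglyMeasurable K₁) (hK₂ : StronglyMeasurable K₂)
    (hf₁ : ∫⁻ q, ‖K₁ q‖ₑ ^ 2 < ∞) (hf₂ : ∫⁻ q, ‖K₂ q‖ₑ ^ 2 < ∞) :
    HasKernel (fun v => T₁ v - T₂ v) (fun q => K₁ q - K₂ q) := by
  intro v
  filter_upwards [Lp.coeFn_sub (T₁ v) (T₂ v), h₁ v, h₂ v, ae_memLp_slice hK₁ hf₁,
    ae_memLp_slice hK₂ hf₂] with s h0 h1 h2 m1 m2
  rw [h0, Pi.sub_apply, h1, h2, ← integral_sub]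
  · simp only [sub_mul]
  · exact m1.integrable_mul (memLp_comp_const_sub v s)
  · exact m2.integrable_mul (memLp_comp_const_sub v s)

/-- The Hilbert–Schmidt norm of an integral operator is the `L²` norm of its kernel. -/
theorem HasKernel.hsNormSq_eq {T : L2R d → L2R d} {K : (Fin d → ℝ) × (Fin d → ℝ) → ℂ}
    (h : HasKernel T K) (hK : StronglyMeasurable K) (hK2 : ∫⁻ q, ‖K q‖ₑ ^ 2 < ∞) :
    hsNormSq T = ∫⁻ q, ‖K q‖ₑ ^ 2 := by
  obtain ⟨S, b, hS, hb⟩ := exists_basis_hsNormSq (L2R d)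
  rw [hb]
  have e1 : ∀ e, ‖T (b e)‖ₑ ^ 2 = ∫⁻ s, ‖∫ x, K (s, x) * (b e) (s - x)‖ₑ ^ 2 := fun e => by
    rw [enorm_Lp_two_sq]
    refine lintegral_congr_ae ?_
    filter_upwards [h (b e)] with s hs
    rw [hs]
  simp only [e1]
  rw [← lintegral_tsum, Measure.volume_eq_prod,
    lintegral_prod _ ((hK.enorm.pow_const 2).aemeasurable)]
  · refine lintegral_congr_ae ?_
    filter_upwards [ae_memLp_slice hK hK2] with s hs
    -- For fixed `s`, the value of the operator at `e` is an inner product of `e` with the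
    -- conjugated slice `t ↦ K(s, s - t)`; summing over the basis is Parseval for that slice.
    have hk : MemLp (fun t => starRingEnd ℂ (K (s, s - t))) 2 :=
      (hs.comp_measurePreserving (measurePreserving_const_sub s)).star
    have e2 : ∀ e, ∫ x, K (s, x) * (b e) (s - x) = inner ℂ (hk.toLp) (b e) := fun e => by
      rw [L2.inner_def, ← integral_sub_left_eq_self _ volume s]
      refine integral_congr_ae ?_
      filter_upwards [hk.coeFn_toLp] with t ht
      rw [ht, RCLike.inner_apply, starRingEnd_self_apply, sub_sub_cancel, mul_comm]
    have e3 : ∀ e, ‖∫ x, K (s, x) * (b e) (s - x)‖ₑ ^ 2 = ‖inner ℂ (b e) (hk.toLp)‖ₑ ^ 2 :=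
      fun e => by rw [e2, ← inner_conj_symm, RCLike.enorm_conj]
    simp only [e3]
    rw [b.tsum_enorm_inner_sq, Lp.enorm_toLp, eLpNorm_two_sq]
    simp only [RCLike.enorm_conj]
    exact lintegral_sub_left_eq_self (fun x => ‖K (s, x)‖ₑ ^ 2) s
  · intro e
    refine AEMeasurable.pow_const (AEMeasurable.enorm ?_) 2
    exact (Lp.aestronglyMeasurable (T (b e))).aemeasurable.congr (h (b e))

end

/-! ### Strong continuity of `π_λ(n)` and measurability of the group Fourier transform -/

section

variable {d : ℕ}

theorem coeFn_modulation (ξ : Fin d → ℝ) (f : L2R d) : modulation ξ f =ᵐ[volume]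
    fun s => Complex.exp (2 * Real.pi * Complex.I * (s ⬝ᵥ ξ : ℝ)) * f s :=
  (memLp_modulation ξ f).coeFn_toLp

theorem coeFn_translation (t : Fin d → ℝ) (f : L2R d) :
    translation t f =ᵐ[volume] fun s => f (s - t) :=
  Lp.coeFn_compMeasurePreserving f (measurePreserving_sub_right volume t)

/-- Dominated convergence: the difference of two characters has modulus at most `2`, so `(2 |v|)²`
dominates. -/
theorem tendsto_modulation (v : L2R d) (ξ₀ : Fin d → ℝ) :
    Tendsto (fun ξ => modulation ξ v) (𝓝 ξ₀) (𝓝 (modulation ξ₀ v)) := by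
  have h1 : Tendsto (fun ξ => ∫⁻ s, ‖(Complex.exp (2 * Real.pi * Complex.I * (s ⬝ᵥ ξ : ℝ)) -
      Complex.exp (2 * Real.pi * Complex.I * (s ⬝ᵥ ξ₀ : ℝ))) * v s‖ₑ ^ 2) (𝓝 ξ₀)
      (𝓝 (∫⁻ _ : Fin d → ℝ, 0)) := by
    refine tendsto_lintegral_filter_of_dominated_convergence (fun s => (2 * ‖v s‖ₑ) ^ 2)
      (Eventually.of_forall fun ξ => ?_) (Eventually.of_forall fun ξ => Eventually.of_forall
        fun s => ?_) ?_ (Eventually.of_forall fun s => ?_)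
    · refine Measurable.pow_const (Measurable.enorm ?_) 2
      refine Measurable.mul (Measurable.sub ?_ ?_) (Lp.stronglyMeasurable v).measurable
      · exact (continuous_expChar.comp (continuous_id.dotProduct continuous_const)).measurable
      · exact (continuous_expChar.comp (continuous_id.dotProduct continuous_const)).measurable
    · rw [enorm_mul]
      gcongr
      refine (enorm_sub_le).trans ?_
      rw [← ofReal_norm, ← ofReal_norm, norm_expChar, norm_expChar]
      norm_num
    · simp only [mul_pow]
      rw [lintegral_const_mul' _ _ (by norm_num)]
      exact ENNReal.mul_ne_top (by norm_num) (Lp.memLp v).lintegral_sq_lt_top.ne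
    · have hc : Continuous fun ξ => ‖(Complex.exp (2 * Real.pi * Complex.I * (s ⬝ᵥ ξ : ℝ)) -
          Complex.exp (2 * Real.pi * Complex.I * (s ⬝ᵥ ξ₀ : ℝ))) * v s‖ₑ ^ 2 := by
        refine (ENNReal.continuous_pow 2).comp (continuous_enorm.comp ?_)
        refine ((continuous_expChar.comp (continuous_const.dotProduct continuous_id)).sub
          continuous_const).mul continuous_const
      have := hc.tendsto ξ₀
      simpa using this
  rw [lintegral_zero] at h1
  have h2 : ∀ ξ, ∫⁻ s, ‖(Complex.exp (2 * Real.pi * Complex.I * (s ⬝ᵥ ξ : ℝ)) -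
      Complex.exp (2 * Real.pi * Complex.I * (s ⬝ᵥ ξ₀ : ℝ))) * v s‖ₑ ^ 2 =
      ‖modulation ξ v - modulation ξ₀ v‖ₑ ^ 2 := fun ξ => by
    rw [enorm_Lp_two_sq]
    refine lintegral_congr_ae ?_
    filter_upwards [Lp.coeFn_sub (modulation ξ v) (modulation ξ₀ v), coeFn_modulation ξ v,
      coeFn_modulation ξ₀ v] with s h0 h1 h2
    rw [h0, Pi.sub_apply, h1, h2, sub_mul]
  simp only [h2] at h1
  rw [tendsto_iff_edist_tendsto_0]
  have h3 := (ENNReal.continuous_rpow_const (y := 1 / 2)).continuousAt.tendsto.comp h1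
  have h4 : ∀ x : ℝ≥0∞, (x ^ 2) ^ (1 / 2 : ℝ) = x := fun x => by
    rw [← ENNReal.rpow_natCast, ← ENNReal.rpow_mul]
    norm_num
  refine (h3.congr fun ξ => ?_).trans (by norm_num)
  rw [Function.comp_apply, h4, edist_eq_enorm_sub]

/-- Joint continuity follows from continuity in `ξ` alone because every modulation is an isometry.
-/
theorem continuous_modulation :
    Continuous fun p : (Fin d → ℝ) × L2R d => modulation p.1 p.2 := by
  rw [continuous_iff_continuousAt]
  rintro ⟨ξ₀, v₀⟩
  rw [ContinuousAt, tendsto_iff_dist_tendsto_zero]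
  have h1 : Tendsto (fun p : (Fin d → ℝ) × L2R d => dist p.2 v₀ +
      dist (modulation p.1 v₀) (modulation ξ₀ v₀)) (𝓝 (ξ₀, v₀)) (𝓝 (0 + 0)) := by
    refine Tendsto.add ?_ ?_
    · exact tendsto_iff_dist_tendsto_zero.1 continuous_snd.continuousAt.tendsto
    · exact (tendsto_iff_dist_tendsto_zero.1 (tendsto_modulation v₀ ξ₀)).comp
        continuous_fst.continuousAt.tendsto
  rw [add_zero] at h1
  refine squeeze_zero (fun _ => dist_nonneg) (fun p => ?_) h1
  refine (dist_triangle _ (modulation p.1 v₀) _).trans ?_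
  rw [(modulation p.1).dist_map]

theorem continuous_translation :
    Continuous fun p : (Fin d → ℝ) × L2R d => translation p.1 p.2 := by
  refine Continuous.compMeasurePreservingLp (Z := (Fin d → ℝ) × L2R d) (f := fun p => p.2)
    (g := fun p => ⟨fun s => s - p.1, by fun_prop⟩) continuous_snd ?_ _ (by norm_num)
  refine ContinuousMap.continuous_of_continuous_uncurry _ ?_
  change Continuous fun x : ((Fin d → ℝ) × L2R d) × (Fin d → ℝ) => x.2 - x.1.1
  fun_prop

theorem Continuous.modulation_apply {Z : Type*} [TopologicalSpace Z] {ξ : Z → Fin d → ℝ}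
    {v : Z → L2R d} (hξ : Continuous ξ) (hv : Continuous v) :
    Continuous fun z => modulation (ξ z) (v z) := by
  have h := Continuous.comp (g := fun p : (Fin d → ℝ) × L2R d => modulation p.1 p.2)
    (f := fun z => (ξ z, v z)) continuous_modulation (hξ.prodMk hv)
  exact h

theorem Continuous.translation_apply {Z : Type*} [TopologicalSpace Z] {t : Z → Fin d → ℝ}
    {v : Z → L2R d} (ht : Continuous t) (hv : Continuous v) :
    Continuous fun z => translation (t z) (v z) := by
  have h := Continuous.comp (g := fun p : (Fin d → ℝ) × L2R d => translation p.1 p.2)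
    (f := fun z => (t z, v z)) continuous_translation (ht.prodMk hv)
  exact h

namespace AdmissibleBasis

variable {𝔫 : Type*} [LieRing 𝔫] [LieAlgebra ℝ 𝔫] {r : ℕ} (D : AdmissibleBasis 𝔫 r d)

theorem continuous_B : Continuous D.B := by
  refine continuous_matrix fun i j => ?_
  simp only [B, Matrix.of_apply, functional, Module.Basis.constr_apply_fintype]
  refine Continuous.neg (continuous_finsetSum _ fun k _ => ?_)
  rcases k with k | k
  · change Continuous fun l : Fin r → ℝ => D.toBasis.equivFun ⁅D.X i, D.Y j⁆ (Sum.inl k) * l k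
    fun_prop
  · change Continuous fun _ : Fin r → ℝ => D.toBasis.equivFun ⁅D.X i, D.Y j⁆ (Sum.inr k) * 0
    fun_prop

theorem rep_coordsMeas_symm (l : Fin r → ℝ) (p : (Fin r → ℝ) × (Fin d → ℝ) × (Fin d → ℝ))
    (v : L2R d) : D.rep l ((NilGroup.coordsMeas D).symm p) v =
      Complex.exp (2 * Real.pi * Complex.I * (l ⬝ᵥ p.1 : ℝ)) •
        modulation (D.B l *ᵥ p.2.1) (translation p.2.2 v) := by
  have : NilGroup.coords D ((NilGroup.coordsMeas D).symm p) = p :=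
    (NilGroup.coords D).apply_symm_apply _
  simp only [rep, this]
  rfl

/-- Continuity jointly in `λ`, the group element and the vector supplies measurability for integrals
over `n` depending on `λ`, and for fields `l ↦ D.rep l γ (A l)`. -/
theorem continuous_rep {W : Type*} [TopologicalSpace W] {l : W → Fin r → ℝ}
    {p : W → (Fin r → ℝ) × (Fin d → ℝ) × (Fin d → ℝ)} {v : W → L2R d}
    (hl : Continuous l) (hp : Continuous p) (hv : Continuous v) :
    Continuous fun z => D.rep (l z) ((NilGroup.coordsMeas D).symm (p z)) (v z) := by
  have h1 : Continuous fun z => l z ⬝ᵥ (p z).1 := hl.dotProduct hp.fst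
  have h2 : Continuous fun z => D.B (l z) *ᵥ (p z).2.1 :=
    (D.continuous_B.comp hl).matrix_mulVec hp.snd.fst
  have h3 : Continuous fun z => Complex.exp (2 * Real.pi * Complex.I * (l z ⬝ᵥ (p z).1 : ℝ)) :=
    continuous_expChar.comp h1
  have h4 : Continuous fun z => translation (p z).2.2 (v z) :=
    Continuous.translation_apply hp.snd.snd hv
  have h5 : Continuous fun z => modulation (D.B (l z) *ᵥ (p z).2.1) (translation (p z).2.2 (v z)) :=
    Continuous.modulation_apply h2 h4
  have h6 := Continuous.smul h3 h5
  exact h6.congr fun z => (D.rep_coordsMeas_symm (l z) (p z) (v z)).symm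

theorem norm_rep (l : Fin r → ℝ) (n : NilGroup D) (v : L2R d) : ‖D.rep l n v‖ = ‖v‖ := by
  rw [← (NilGroup.coordsMeas D).symm_apply_apply n, rep_coordsMeas_symm, norm_smul, norm_expChar,
    one_mul, LinearIsometry.norm_map, LinearIsometry.norm_map]

theorem continuous_rep_apply (l : Fin r → ℝ) (v : L2R d) :
    Continuous fun p => D.rep l ((NilGroup.coordsMeas D).symm p) v :=
  D.continuous_rep continuous_const continuous_id continuous_const

theorem measurePreserving_coordsMeas_symm :
    MeasurePreserving (NilGroup.coordsMeas D).symm volume (NilGroup.haar D) :=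
  ⟨(NilGroup.coordsMeas D).symm.measurable, rfl⟩

theorem aestronglyMeasurable_rep (l : Fin r → ℝ) (v : L2R d) :
    AEStronglyMeasurable (fun n => D.rep l n v) (NilGroup.haar D) := by
  have h : MeasurePreserving (NilGroup.coordsMeas D) (NilGroup.haar D) volume :=
    (measurePreserving_coordsMeas_symm D).symm (NilGroup.coordsMeas D).symm
  have := (D.continuous_rep_apply l v).aestronglyMeasurable (μ := volume)
    |>.comp_measurePreserving h
  refine this.congr (Eventually.of_forall fun n => ?_)
  simp

theorem integrable_smul_rep {f : NilGroup D → ℂ} (hf : Integrable f (NilGroup.haar D))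
    (l : Fin r → ℝ) (v : L2R d) :
    Integrable (fun n => f n • D.rep l n v) (NilGroup.haar D) := by
  refine (hf.norm.mul_const ‖v‖).mono' (hf.1.smul (D.aestronglyMeasurable_rep l v))
    (Eventually.of_forall fun n => ?_)
  rw [norm_smul, norm_rep]

/-- The group Fourier transform of an integrable function, as a bounded operator. -/
def groupFourierL {f : NilGroup D → ℂ} (hf : Integrable f (NilGroup.haar D))
    (l : Fin r → ℝ) : L2R d →L[ℂ] L2R d :=
  LinearMap.mkContinuous
    { toFun := D.groupFourier f l
      map_add' := fun v w => by
        simp only [groupFourier, map_add, smul_add]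
        exact integral_add (D.integrable_smul_rep hf l v) (D.integrable_smul_rep hf l w)
      map_smul' := fun c v => by
        simp only [groupFourier, map_smul, RingHom.id_apply]
        rw [← integral_smul]
        simp only [smul_comm c] }
    (∫ n, ‖f n‖ ∂(NilGroup.haar D)) (fun v => by
      refine (norm_integral_le_integral_norm _).trans (le_of_eq ?_)
      rw [← integral_mul_const]
      simp only [norm_smul, norm_rep])

theorem groupFourier_eq_integral_coords (f : NilGroup D → ℂ) (l : Fin r → ℝ) (v : L2R d) :
    D.groupFourier f l v = ∫ p, f ((NilGroup.coordsMeas D).symm p) •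
      D.rep l ((NilGroup.coordsMeas D).symm p) v :=
  ((measurePreserving_coordsMeas_symm D).integral_comp
    (NilGroup.coordsMeas D).symm.measurableEmbedding
    (fun n => f n • D.rep l n v)).symm

theorem aemeasurable_inner_groupFourier {f : NilGroup D → ℂ}
    (hm : StronglyMeasurable f) (v w : L2R d)
    (μ : Measure (Fin r → ℝ)) :
    AEMeasurable (fun l => inner ℂ w (D.groupFourier f l v)) μ := by
  have h : StronglyMeasurable fun l => D.groupFourier f l v := by
    simp only [groupFourier_eq_integral_coords]
    refine StronglyMeasurable.integral_prod_right (f := fun (l : Fin r → ℝ) p =>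
      f ((NilGroup.coordsMeas D).symm p) • D.rep l ((NilGroup.coordsMeas D).symm p) v) ?_
    refine StronglyMeasurable.smul
      (f := fun x : (Fin r → ℝ) × (Fin r → ℝ) × (Fin d → ℝ) × (Fin d → ℝ) =>
        f ((NilGroup.coordsMeas D).symm x.2))
      (g := fun x => D.rep x.1 ((NilGroup.coordsMeas D).symm x.2) v) ?_ ?_
    · exact hm.comp_measurable ((NilGroup.coordsMeas D).symm.measurable.comp measurable_snd)
    · refine Continuous.stronglyMeasurable ?_
      exact D.continuous_rep continuous_fst continuous_snd continuous_const
  exact (stronglyMeasurable_const.inner h).measurable.aemeasurable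

end AdmissibleBasis

end

/-! ### The integral kernel of the group Fourier transform -/

section

section BochnerIntegral

variable {α β : Type*} [MeasurableSpace α] [MeasurableSpace β] {ρ : Measure α} {μ : Measure β}

theorem setIntegral_norm_le_mul_norm (f : Lp ℂ 2 μ) {S : Set β} (hS : μ S < ∞) :
    IntegrableOn f S μ ∧ ∫ s in S, ‖f s‖ ∂μ ≤ (μ S ^ (1 / 2 : ℝ)).toReal * ‖f‖ := by
  have : IsFiniteMeasure (μ.restrict S) := ⟨by simpa using hS⟩
  have hm := (Lp.memLp f).restrict S
  have hi : IntegrableOn f S μ := hm.integrable (by norm_num)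
  refine ⟨hi, ?_⟩
  have h1 := eLpNorm_le_eLpNorm_mul_rpow_measure_univ (p := 1) (q := 2) (by norm_num) hm.1
  rw [integral_norm_eq_lintegral_enorm hi.1, ← eLpNorm_one_eq_lintegral_enorm, mul_comm,
    Lp.norm_def, ← ENNReal.toReal_mul]
  refine ENNReal.toReal_mono (ENNReal.mul_ne_top (Lp.eLpNorm_ne_top f)
    (ENNReal.rpow_ne_top_of_nonneg (by norm_num) hS.ne)) (h1.trans ?_)
  gcongr
  · exact Measure.restrict_le_self
  · simp only [Measure.restrict_apply_univ, ENNReal.toReal_one, ENNReal.toReal_ofNat]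
    norm_num

variable [SigmaFinite μ]

/-- On a set of finite measure the `L²` norm controls the `L¹` norm, so Bochner integrability of `F`
becomes joint integrability of `Φ`, which is what Fubini requires. -/
theorem integrable_prod_of_coeFn {F : α → Lp ℂ 2 μ} (hF : Integrable F ρ) {Φ : α × β → ℂ}
    (hΦ : StronglyMeasurable Φ) (h : ∀ a, F a =ᵐ[μ] fun s => Φ (a, s)) {S : Set β}
    (hS : μ S < ∞) : Integrable Φ (ρ.prod (μ.restrict S)) := by
  rw [integrable_prod_iff hΦ.aestronglyMeasurable]
  have hc : ∀ a, F a =ᵐ[μ.restrict S] fun s => Φ (a, s) := fun a => ae_restrict_of_ae (h a)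
  refine ⟨Eventually.of_forall fun a =>
    (setIntegral_norm_le_mul_norm (F a) hS).1.congr (hc a), ?_⟩
  refine (hF.norm.const_mul (μ S ^ (1 / 2 : ℝ)).toReal).mono' ?_ (Eventually.of_forall fun a => ?_)
  · exact (StronglyMeasurable.integral_prod_right (f := fun a s => ‖Φ (a, s)‖)
      hΦ.norm).aestronglyMeasurable
  · rw [Real.norm_of_nonneg (integral_nonneg fun _ => norm_nonneg _)]
    refine le_trans (le_of_eq ?_) (setIntegral_norm_le_mul_norm (F a) hS).2
    refine integral_congr_ae ?_
    filter_upwards [hc a] with s hs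
    rw [hs]

theorem ae_integrable_slice_of_coeFn [SFinite ρ] {F : α → Lp ℂ 2 μ} (hF : Integrable F ρ)
    {Φ : α × β → ℂ} (hΦ : StronglyMeasurable Φ) (h : ∀ a, F a =ᵐ[μ] fun s => Φ (a, s)) :
    ∀ᵐ s ∂μ, Integrable (fun a => Φ (a, s)) ρ :=
  ae_of_forall_measure_lt_top_ae_restrict _ fun _ _ hS =>
    (integrable_prod_of_coeFn hF hΦ h hS).prod_left_ae

/-- The Bochner integral of a family of `L²` functions is computed pointwise. -/
theorem coeFn_integral_ae [SFinite ρ] {F : α → Lp ℂ 2 μ} (hF : Integrable F ρ) {Φ : α × β → ℂ}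
    (hΦ : StronglyMeasurable Φ) (h : ∀ a, F a =ᵐ[μ] fun s => Φ (a, s)) :
    (∫ a, F a ∂ρ : Lp ℂ 2 μ) =ᵐ[μ] fun s => ∫ a, Φ (a, s) ∂ρ := by
  refine ae_eq_of_forall_setIntegral_eq_of_sigmaFinite
    (fun S _ hS => (setIntegral_norm_le_mul_norm _ hS).1)
    (fun S _ hS => (integrable_prod_of_coeFn hF hΦ h hS).integral_prod_right) fun S hSm hS => ?_
  -- Integration over `S` is the inner product with an indicator, hence commutes with the Bochner
  -- integral.
  rw [← L2.inner_indicatorConstLp_one hSm hS.ne, ← integral_inner hF]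
  simp only [L2.inner_indicatorConstLp_one hSm hS.ne]
  rw [← integral_integral_swap (f := fun a s => Φ (a, s)) (integrable_prod_of_coeFn hF hΦ h hS)]
  exact integral_congr_ae (Eventually.of_forall fun a => integral_congr_ae (ae_restrict_of_ae (h a)))

end BochnerIntegral

namespace AdmissibleBasis

variable {d : ℕ} {𝔫 : Type*} [LieRing 𝔫] [LieAlgebra ℝ 𝔫] {r : ℕ} (D : AdmissibleBasis 𝔫 r d)

/-- The kernel of `𝓕 f (λ)`. -/
theorem hasKernel_groupFourier {f : NilGroup D → ℂ} (hf : Integrable f (NilGroup.haar D))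
    (hm : StronglyMeasurable f) (l : Fin r → ℝ) :
    HasKernel (D.groupFourier f l) fun q =>
      partialFourier (f ∘ (NilGroup.coordsMeas D).symm) (l, (D.B l)ᵀ *ᵥ q.1, q.2) := by
  intro v
  set g := f ∘ (NilGroup.coordsMeas D).symm with hg
  have hgm : StronglyMeasurable g := hm.comp_measurable (NilGroup.coordsMeas D).symm.measurable
  let Φ : ((Fin r → ℝ) × (Fin d → ℝ) × (Fin d → ℝ)) × (Fin d → ℝ) → ℂ := fun x =>
    g x.1 * (Complex.exp (2 * Real.pi * Complex.I * (l ⬝ᵥ x.1.1 : ℝ)) *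
      (Complex.exp (2 * Real.pi * Complex.I * (x.2 ⬝ᵥ (D.B l *ᵥ x.1.2.1) : ℝ)) *
        v (x.2 - x.1.2.2)))
  have hΦ : StronglyMeasurable Φ := by
    refine (hgm.comp_measurable measurable_fst).mul (StronglyMeasurable.mul
      (Continuous.stronglyMeasurable ?_) (StronglyMeasurable.mul
        (Continuous.stronglyMeasurable ?_) ?_))
    · exact continuous_expChar.comp (continuous_const.dotProduct (by fun_prop))
    · exact continuous_expChar.comp (Continuous.dotProduct (by fun_prop)
        (continuous_const.matrix_mulVec (by fun_prop)))
    · exact (Lp.stronglyMeasurable v).comp_measurable (by fun_prop)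
  let F : (Fin r → ℝ) × (Fin d → ℝ) × (Fin d → ℝ) → L2R d := fun p =>
    g p • D.rep l ((NilGroup.coordsMeas D).symm p) v
  have hF : Integrable F := (measurePreserving_coordsMeas_symm D).integrable_comp_of_integrable
    (D.integrable_smul_rep hf l v)
  have hFΦ : ∀ p, F p =ᵐ[volume] fun s => Φ (p, s) := fun p => by
    have hp : NilGroup.coords D ((NilGroup.coordsMeas D).symm p) = p :=
      (NilGroup.coords D).apply_symm_apply _
    have h1 := D.coeFn_rep l ((NilGroup.coordsMeas D).symm p) v
    rw [hp] at h1
    filter_upwards [h1, Lp.coeFn_smul (g p) (D.rep l ((NilGroup.coordsMeas D).symm p) v)]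
      with s h1 h2
    simp only [F, Φ, h2, Pi.smul_apply, h1, smul_eq_mul]
  have e1 := coeFn_integral_ae hF hΦ hFΦ
  have e2 := ae_integrable_slice_of_coeFn hF hΦ hFΦ
  rw [groupFourier_eq_integral_coords]
  filter_upwards [e1, e2] with s h1 h2
  refine h1.trans ?_
  -- Fubini isolates `x`; since `⟨s, B y⟩ = ⟨Bᵀ s, y⟩`, the remaining integral in `(z, y)` is a
  -- Fourier integral at `(λ, Bᵀ s)`.
  rw [integral_assoc h2]
  refine integral_congr_ae (Eventually.of_forall fun x => ?_)
  simp only [partialFourier, fourierPair]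
  rw [← integral_mul_const]
  refine integral_congr_ae (Eventually.of_forall fun w => ?_)
  have e3 : (D.B l)ᵀ *ᵥ s ⬝ᵥ w.2 = s ⬝ᵥ (D.B l *ᵥ w.2) := by
    rw [Matrix.dotProduct_mulVec, Matrix.mulVec_transpose]
  simp only [Φ, e3]
  push_cast
  rw [mul_add, Complex.exp_add]
  ring

/-! ### The change of variables `η = B(λ)ᵀ s` -/

/-- For `A = B(λ)` the Jacobian is the density of `D.plancherelMeasure`, so kernels in the variables
`(λ, η, x)` are measured by plain Lebesgue measure. -/
theorem measurePreserving_change {A : Matrix (Fin d) (Fin d) ℝ} (hA : A.det ≠ 0) :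
    MeasurePreserving (fun q : (Fin d → ℝ) × (Fin d → ℝ) => (Aᵀ *ᵥ q.1, q.2))
      (ENNReal.ofReal |A.det| • volume) volume := by
  have hm : Measurable fun s : Fin d → ℝ => Aᵀ *ᵥ s :=
    (continuous_const.matrix_mulVec continuous_id).measurable
  refine ⟨(hm.comp measurable_fst).prodMk measurable_snd, ?_⟩
  have h1 : Measure.map (fun s : Fin d → ℝ => Aᵀ *ᵥ s) volume =
      ENNReal.ofReal |A.det⁻¹| • volume := by
    have := Real.map_matrix_volume_pi_eq_smul_volume_pi (M := Aᵀ) (by rwa [Matrix.det_transpose])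
    rw [Matrix.det_transpose] at this
    exact this
  have h2 := Measure.map_prod_map (volume : Measure (Fin d → ℝ)) (volume : Measure (Fin d → ℝ)) hm
    measurable_id
  rw [h1, Measure.map_id] at h2
  rw [Measure.map_smul, Measure.volume_eq_prod]
  change _ • Measure.map (Prod.map (fun s : Fin d → ℝ => Aᵀ *ᵥ s) id) _ = _
  rw [← h2, Measure.prod_smul_left, smul_smul, ← ENNReal.ofReal_mul (abs_nonneg _), ← abs_mul,
    mul_inv_cancel₀ hA, abs_one, ENNReal.ofReal_one, one_smul]

theorem measurableEmbedding_change {A : Matrix (Fin d) (Fin d) ℝ} (hA : A.det ≠ 0) :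
    MeasurableEmbedding (fun q : (Fin d → ℝ) × (Fin d → ℝ) => (Aᵀ *ᵥ q.1, q.2)) := by
  refine (measurePreserving_change hA).measurable.measurableEmbedding ?_
  rintro ⟨s, x⟩ ⟨t, y⟩ h
  simp only [Prod.mk.injEq] at h
  have hu : IsUnit Aᵀ := by
    rw [Matrix.isUnit_iff_isUnit_det, Matrix.det_transpose]
    exact hA.isUnit
  rw [Matrix.mulVec_injective_of_isUnit hu h.1, h.2]

theorem lintegral_change {A : Matrix (Fin d) (Fin d) ℝ} (hA : A.det ≠ 0)
    (H : (Fin d → ℝ) × (Fin d → ℝ) → ℝ≥0∞) :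
    ∫⁻ q, H q = ENNReal.ofReal |A.det| * ∫⁻ q : (Fin d → ℝ) × (Fin d → ℝ), H (Aᵀ *ᵥ q.1, q.2) := by
  rw [← (measurePreserving_change hA).lintegral_comp_emb (measurableEmbedding_change hA),
    lintegral_smul_measure, smul_eq_mul]

theorem integral_change {A : Matrix (Fin d) (Fin d) ℝ} (hA : A.det ≠ 0)
    (h : (Fin d → ℝ) × (Fin d → ℝ) → ℂ) :
    ∫ q, h q = |A.det| • ∫ q : (Fin d → ℝ) × (Fin d → ℝ), h (Aᵀ *ᵥ q.1, q.2) := by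
  rw [← (measurePreserving_change hA).integral_comp (measurableEmbedding_change hA),
    integral_smul_measure, ENNReal.toReal_ofReal (abs_nonneg _)]

theorem measurable_abs_det : Measurable fun l => ENNReal.ofReal |(D.B l).det| :=
  (D.continuous_B.matrix_det.abs).measurable.ennreal_ofReal

theorem ae_det_ne_zero : ∀ᵐ l ∂D.plancherelMeasure, (D.B l).det ≠ 0 := by
  rw [plancherelMeasure, ae_withDensity_iff D.measurable_abs_det]
  exact Eventually.of_forall fun l h => by simpa using h

theorem lintegral_plancherelMeasure (H : (Fin r → ℝ) → ℝ≥0∞) (hH : Measurable H) :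
    ∫⁻ l, H l ∂D.plancherelMeasure =
      ∫⁻ l in D.crossSection, ENNReal.ofReal |(D.B l).det| * H l := by
  rw [plancherelMeasure, lintegral_withDensity_eq_lintegral_mul _ D.measurable_abs_det hH]
  rfl

theorem measurable_transpose_mulVec : Measurable
    fun x : (Fin r → ℝ) × (Fin d → ℝ) × (Fin d → ℝ) => (x.1, (D.B x.1)ᵀ *ᵥ x.2.1, x.2.2) := by
  have : Continuous fun x : (Fin r → ℝ) × (Fin d → ℝ) × (Fin d → ℝ) => (D.B x.1)ᵀ *ᵥ x.2.1 :=
    ((D.continuous_B.comp continuous_fst).matrix_transpose).matrix_mulVec (by fun_prop)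
  exact measurable_fst.prodMk (this.measurable.prodMk (by fun_prop))

/-- An inequality is enough for all estimates, and it avoids comparing `D.crossSection` with the
whole of `ℝ^r`; where `det B(λ) = 0` the left-hand density vanishes. -/
theorem lintegral_plancherel_change_le {H : (Fin r → ℝ) × (Fin d → ℝ) × (Fin d → ℝ) → ℝ≥0∞}
    (hH : Measurable H) :
    ∫⁻ l, (∫⁻ q : (Fin d → ℝ) × (Fin d → ℝ), H (l, (D.B l)ᵀ *ᵥ q.1, q.2)) ∂D.plancherelMeasure ≤
      ∫⁻ p, H p := by
  have hm : Measurable fun l => ∫⁻ q : (Fin d → ℝ) × (Fin d → ℝ), H (l, (D.B l)ᵀ *ᵥ q.1, q.2) :=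
    Measurable.lintegral_prod_right' (f := fun x : (Fin r → ℝ) × (Fin d → ℝ) × (Fin d → ℝ) =>
      H (x.1, (D.B x.1)ᵀ *ᵥ x.2.1, x.2.2))
      (hH.comp D.measurable_transpose_mulVec)
  rw [lintegral_plancherelMeasure D _ hm, Measure.volume_eq_prod (Fin r → ℝ),
    lintegral_prod _ hH.aemeasurable]
  refine (setLIntegral_le_lintegral _ _).trans (lintegral_mono fun l => ?_)
  by_cases h : (D.B l).det = 0
  · simp [h]
  · exact (lintegral_change h fun q => H (l, q)).ge

end AdmissibleBasis

end

/-! ### The Plancherel bound and the inverse transform of rank-one fields -/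

section

namespace AdmissibleBasis

variable {d : ℕ} {𝔫 : Type*} [LieRing 𝔫] [LieAlgebra ℝ 𝔫] {r : ℕ} (D : AdmissibleBasis 𝔫 r d)

theorem measurePreserving_coordsMeas :
    MeasurePreserving (NilGroup.coordsMeas D) (NilGroup.haar D) volume :=
  (measurePreserving_coordsMeas_symm D).symm (NilGroup.coordsMeas D).symm

/-- Functions on coordinate space as functions on `N`. -/
def ofCoords : Lp ℂ 2 (volume : Measure ((Fin r → ℝ) × (Fin d → ℝ) × (Fin d → ℝ))) →ₗᵢ[ℂ]
    Lp ℂ 2 (NilGroup.haar D) :=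
  Lp.compMeasurePreservingₗᵢ ℂ (NilGroup.coordsMeas D) D.measurePreserving_coordsMeas

theorem stronglyMeasurable_inCoords (f : Lp ℂ 2 (NilGroup.haar D)) :
    StronglyMeasurable (f ∘ (NilGroup.coordsMeas D).symm) :=
  (Lp.stronglyMeasurable f).comp_measurable (NilGroup.coordsMeas D).symm.measurable

theorem memLp_inCoords (f : Lp ℂ 2 (NilGroup.haar D)) :
    MemLp (f ∘ (NilGroup.coordsMeas D).symm) 2 volume :=
  (Lp.memLp f).comp_measurePreserving D.measurePreserving_coordsMeas_symm

theorem integrable_inCoords {f : Lp ℂ 2 (NilGroup.haar D)} (hf : Integrable f (NilGroup.haar D)) :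
    Integrable (f ∘ (NilGroup.coordsMeas D).symm) volume :=
  D.measurePreserving_coordsMeas_symm.integrable_comp_of_integrable hf

theorem ofCoords_inCoords (f : Lp ℂ 2 (NilGroup.haar D)) :
    D.ofCoords (D.memLp_inCoords f).toLp = f := by
  refine Lp.ext ?_
  have h1 : D.ofCoords (D.memLp_inCoords f).toLp =ᵐ[NilGroup.haar D]
      (D.memLp_inCoords f).toLp ∘ NilGroup.coordsMeas D :=
    Lp.coeFn_compMeasurePreserving _ D.measurePreserving_coordsMeas
  have h2 := D.measurePreserving_coordsMeas.quasiMeasurePreserving.ae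
    (D.memLp_inCoords f).coeFn_toLp
  filter_upwards [h1, h2] with n h1 h2
  rw [h1, Function.comp_apply, h2, Function.comp_apply, MeasurableEquiv.symm_apply_apply]

theorem memLp_partialFourier_inCoords {f : Lp ℂ 2 (NilGroup.haar D)}
    (hf : Integrable f (NilGroup.haar D)) :
    MemLp (partialFourier (f ∘ (NilGroup.coordsMeas D).symm)) 2 volume :=
  memLp_partialFourier (D.stronglyMeasurable_inCoords f) (D.integrable_inCoords hf)
    (D.memLp_inCoords f)

theorem norm_partialFourier_inCoords {f : Lp ℂ 2 (NilGroup.haar D)}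
    (hf : Integrable f (NilGroup.haar D)) :
    ‖(D.memLp_partialFourier_inCoords hf).toLp‖ = ‖f‖ := by
  have h := lintegral_partialFourier_sq (D.stronglyMeasurable_inCoords f)
    (D.integrable_inCoords hf) (D.memLp_inCoords f)
  rw [← eLpNorm_two_sq, ← eLpNorm_two_sq] at h
  have h2 := (ENNReal.pow_right_strictMono two_ne_zero).injective h
  conv_rhs => rw [← D.ofCoords_inCoords f, LinearIsometry.norm_map]
  rw [Lp.norm_toLp, Lp.norm_toLp, h2]

theorem ae_slice_lt_top {H : (Fin r → ℝ) × (Fin d → ℝ) × (Fin d → ℝ) → ℂ}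
    (hm : StronglyMeasurable H) (hH : MemLp H 2 volume) :
    ∀ᵐ l ∂D.plancherelMeasure,
      ∫⁻ q : (Fin d → ℝ) × (Fin d → ℝ), ‖H (l, (D.B l)ᵀ *ᵥ q.1, q.2)‖ₑ ^ 2 < ∞ := by
  have hm' : Measurable fun p => ‖H p‖ₑ ^ 2 := hm.enorm.pow_const 2
  refine ae_lt_top (Measurable.lintegral_prod_right'
    (f := fun x : (Fin r → ℝ) × (Fin d → ℝ) × (Fin d → ℝ) =>
      ‖H (x.1, (D.B x.1)ᵀ *ᵥ x.2.1, x.2.2)‖ₑ ^ 2)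
    (hm'.comp D.measurable_transpose_mulVec)) ?_
  exact ((D.lintegral_plancherel_change_le hm').trans_lt hH.lintegral_sq_lt_top).ne

theorem stronglyMeasurable_slice {H : (Fin r → ℝ) × (Fin d → ℝ) × (Fin d → ℝ) → ℂ}
    (hm : StronglyMeasurable H) (l : Fin r → ℝ) :
    StronglyMeasurable fun q : (Fin d → ℝ) × (Fin d → ℝ) => H (l, (D.B l)ᵀ *ᵥ q.1, q.2) :=
  hm.comp_measurable (D.measurable_transpose_mulVec.comp measurable_prodMk_left)

/-- Fibrewise the difference operator has the difference of the kernels as its kernel, so its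
Hilbert–Schmidt norm is an `L²` norm; the change of variables then integrates over `λ`. -/
theorem lintegral_hsNormSq_sub_le {f : Lp ℂ 2 (NilGroup.haar D)}
    (hf : Integrable f (NilGroup.haar D)) {G : (Fin r → ℝ) × (Fin d → ℝ) × (Fin d → ℝ) → ℂ}
    (hG : StronglyMeasurable G) (hG2 : MemLp G 2 volume) {T : (Fin r → ℝ) → L2R d → L2R d}
    (hT : ∀ᵐ l ∂D.plancherelMeasure,
      HasKernel (T l) fun q => G (l, (D.B l)ᵀ *ᵥ q.1, q.2)) :
    ∫⁻ l, hsNormSq (fun v => D.groupFourier f l v - T l v) ∂D.plancherelMeasure ≤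
      ‖(D.memLp_partialFourier_inCoords hf).toLp - hG2.toLp‖ₑ ^ 2 := by
  set P := partialFourier (f ∘ (NilGroup.coordsMeas D).symm) with hP
  have hPm : StronglyMeasurable P :=
    stronglyMeasurable_partialFourier (D.stronglyMeasurable_inCoords f)
  have hP2 : MemLp P 2 volume := D.memLp_partialFourier_inCoords hf
  have e1 : ‖hP2.toLp - hG2.toLp‖ₑ ^ 2 = ∫⁻ p, ‖P p - G p‖ₑ ^ 2 := by
    rw [← MemLp.toLp_sub, Lp.enorm_toLp, eLpNorm_two_sq]
    rfl
  rw [e1]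
  have hm' : Measurable fun p => ‖P p - G p‖ₑ ^ 2 := (hPm.sub hG).enorm.pow_const 2
  refine le_trans (le_of_eq (lintegral_congr_ae ?_)) (D.lintegral_plancherel_change_le hm')
  filter_upwards [hT, D.ae_slice_lt_top hPm hP2, D.ae_slice_lt_top hG hG2,
    D.ae_slice_lt_top (hPm.sub hG) (hP2.sub hG2)] with l h1 h2 h3 h4
  exact ((D.hasKernel_groupFourier hf (Lp.stronglyMeasurable f) l).sub h1
    (D.stronglyMeasurable_slice hPm l) (D.stronglyMeasurable_slice hG l) h2 h3).hsNormSq_eq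
    ((D.stronglyMeasurable_slice hPm l).sub (D.stronglyMeasurable_slice hG l)) h4

theorem lintegral_hsNormSq_groupFourier_le {f : Lp ℂ 2 (NilGroup.haar D)}
    (hf : Integrable f (NilGroup.haar D)) :
    ∫⁻ l, hsNormSq (D.groupFourier f l) ∂D.plancherelMeasure ≤ ‖f‖ₑ ^ 2 := by
  have h := D.lintegral_hsNormSq_sub_le hf (G := 0) (T := fun _ _ => 0) stronglyMeasurable_zero
    MemLp.zero (Eventually.of_forall fun l v => by
      simp only [Pi.zero_apply, zero_mul, integral_zero]
      exact Lp.coeFn_zero ℂ 2 (volume : Measure (Fin d → ℝ)))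
  simp only [sub_zero] at h
  refine h.trans (le_of_eq ?_)
  rw [MemLp.toLp_zero, sub_zero, ← ofReal_norm, D.norm_partialFourier_inCoords hf, ofReal_norm]

/-! ### Fields of rank-one operators -/

theorem measurable_inv_transpose_mulVec : Measurable
    fun p : (Fin r → ℝ) × (Fin d → ℝ) × (Fin d → ℝ) => ((D.B p.1)ᵀ)⁻¹ *ᵥ p.2.1 := by
  simp only [Matrix.inv_def, Ring.inverse_eq_inv', Matrix.smul_mulVec]
  have h1 : Continuous fun p : (Fin r → ℝ) × (Fin d → ℝ) × (Fin d → ℝ) => (D.B p.1)ᵀ :=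
    (D.continuous_B.comp continuous_fst).matrix_transpose
  exact (h1.matrix_det.measurable.inv).smul
    (h1.matrix_adjugate.matrix_mulVec (by fun_prop)).measurable

/-- The field of kernels of `1_E(λ) w ⊗ u`, in the coordinates `(λ, η, x)`. -/
def tensorField (E : Set (Fin r → ℝ)) (w u : L2R d)
    (p : (Fin r → ℝ) × (Fin d → ℝ) × (Fin d → ℝ)) : ℂ :=
  (E ∩ {l | (D.B l).det ≠ 0}).indicator (fun _ => w (((D.B p.1)ᵀ)⁻¹ *ᵥ p.2.1) *
    starRingEnd ℂ (u (((D.B p.1)ᵀ)⁻¹ *ᵥ p.2.1 - p.2.2))) p.1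

variable {E : Set (Fin r → ℝ)} (w u : L2R d)

theorem stronglyMeasurable_tensorField (hE : MeasurableSet E) :
    StronglyMeasurable (D.tensorField E w u) := by
  have hS : MeasurableSet (E ∩ {l | (D.B l).det ≠ 0}) :=
    hE.inter ((D.continuous_B.matrix_det.measurable (measurableSet_singleton 0)).compl)
  have h1 : Measurable fun p : (Fin r → ℝ) × (Fin d → ℝ) × (Fin d → ℝ) =>
      w (((D.B p.1)ᵀ)⁻¹ *ᵥ p.2.1) * starRingEnd ℂ (u (((D.B p.1)ᵀ)⁻¹ *ᵥ p.2.1 - p.2.2)) := by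
    refine ((Lp.stronglyMeasurable w).measurable.comp D.measurable_inv_transpose_mulVec).mul
      (Complex.continuous_conj.measurable.comp ((Lp.stronglyMeasurable u).measurable.comp ?_))
    exact D.measurable_inv_transpose_mulVec.sub (by fun_prop)
  exact (h1.indicator (measurable_fst hS)).stronglyMeasurable

/-- The inverse matrix in `tensorField` undoes `η = B(λ)ᵀ s`, leaving the kernel `w(s) * conj u(s -
x)` of `w ⊗ u`. -/
theorem tensorField_change {l : Fin r → ℝ} (hl : (D.B l).det ≠ 0)
    (q : (Fin d → ℝ) × (Fin d → ℝ)) : D.tensorField E w u (l, (D.B l)ᵀ *ᵥ q.1, q.2) =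
      E.indicator (fun _ => w q.1 * starRingEnd ℂ (u (q.1 - q.2))) l := by
  have hu : IsUnit (D.B l)ᵀ.det := by rw [Matrix.det_transpose]; exact hl.isUnit
  have : ((D.B l)ᵀ)⁻¹ *ᵥ ((D.B l)ᵀ *ᵥ q.1) = q.1 := by
    rw [Matrix.mulVec_mulVec, Matrix.nonsing_inv_mul _ hu, Matrix.one_mulVec]
  by_cases h : l ∈ E <;> simp [tensorField, Set.indicator, h, hl, this]

theorem hasKernel_tensorField {l : Fin r → ℝ} (hl : (D.B l).det ≠ 0) :
    HasKernel ⇑(E.indicator (fun _ => tensor w u) l)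
      fun q => D.tensorField E w u (l, (D.B l)ᵀ *ᵥ q.1, q.2) := by
  intro v
  have ht := fun s x => D.tensorField_change (E := E) w u hl (s, x)
  simp only at ht
  by_cases h : l ∈ E
  · simp only [Set.indicator_of_mem h, tensor, InnerProductSpace.rankOne_apply]
    filter_upwards [Lp.coeFn_smul (inner ℂ u v) w] with s hs
    rw [hs, Pi.smul_apply, smul_eq_mul, L2.inner_def, ← integral_sub_left_eq_self _ volume s,
      ← integral_mul_const]
    refine integral_congr_ae (Eventually.of_forall fun x => ?_)
    simp only [RCLike.inner_apply, ht, Set.indicator_of_mem h]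
    ring
  · simp only [ht, Set.indicator_of_notMem h, zero_mul, integral_zero]
    exact Lp.coeFn_zero ℂ 2 (volume : Measure (Fin d → ℝ))

theorem restrict_plancherelMeasure (hE : MeasurableSet E) (hEs : E ⊆ D.crossSection) :
    D.plancherelMeasure.restrict E =
      (volume.restrict E).withDensity fun l => ENNReal.ofReal |(D.B l).det| := by
  rw [plancherelMeasure, restrict_withDensity hE, Measure.restrict_restrict hE,
    Set.inter_eq_left.2 hEs]

theorem lintegral_tensor_sq : ∫⁻ q : (Fin d → ℝ) × (Fin d → ℝ),
    ‖w q.1 * starRingEnd ℂ (u (q.1 - q.2))‖ₑ ^ 2 = ‖w‖ₑ ^ 2 * ‖u‖ₑ ^ 2 := by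
  have hw := (Lp.stronglyMeasurable w).measurable
  have hu := (Lp.stronglyMeasurable u).measurable
  simp only [enorm_mul, RCLike.enorm_conj, mul_pow]
  rw [Measure.volume_eq_prod, lintegral_prod]
  · have : ∀ s, ∫⁻ x, ‖w s‖ₑ ^ 2 * ‖u (s - x)‖ₑ ^ 2 = ‖w s‖ₑ ^ 2 * ‖u‖ₑ ^ 2 := fun s => by
      rw [lintegral_const_mul' _ _ (by simp), enorm_Lp_two_sq u,
        lintegral_sub_left_eq_self (fun x => ‖u x‖ₑ ^ 2) s]
    simp only [this]
    rw [lintegral_mul_const' _ _ (by simp), enorm_Lp_two_sq w]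
  · exact Measurable.aemeasurable (((hw.comp measurable_fst).enorm.pow_const 2).mul
      ((hu.comp (by fun_prop)).enorm.pow_const 2))

theorem lintegral_tensorField_sq (hE : MeasurableSet E) (hEs : E ⊆ D.crossSection) :
    ∫⁻ p, ‖D.tensorField E w u p‖ₑ ^ 2 = D.plancherelMeasure E * (‖w‖ₑ ^ 2 * ‖u‖ₑ ^ 2) := by
  have hm : Measurable fun p => ‖D.tensorField E w u p‖ₑ ^ 2 :=
    (D.stronglyMeasurable_tensorField w u hE).enorm.pow_const 2
  have hwu := lintegral_tensor_sq w u
  rw [Measure.volume_eq_prod (Fin r → ℝ), lintegral_prod _ hm.aemeasurable]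
  have h1 : ∀ l, ∫⁻ q : (Fin d → ℝ) × (Fin d → ℝ), ‖D.tensorField E w u (l, q)‖ₑ ^ 2 =
      E.indicator (fun l => ENNReal.ofReal |(D.B l).det| * (‖w‖ₑ ^ 2 * ‖u‖ₑ ^ 2)) l := by
    intro l
    by_cases hl : (D.B l).det = 0
    · simp [tensorField, hl, Set.indicator]
    · rw [lintegral_change hl]
      simp only [D.tensorField_change w u hl]
      by_cases h : l ∈ E
      · simp only [Set.indicator_of_mem h, hwu]
      · simp [Set.indicator_of_notMem h]
  simp only [h1]
  rw [lintegral_indicator hE, lintegral_mul_const _ D.measurable_abs_det,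
    ← Measure.restrict_apply_univ E, D.restrict_plancherelMeasure hE hEs,
    withDensity_apply _ MeasurableSet.univ, Measure.restrict_univ]

theorem memLp_tensorField (hE : MeasurableSet E) (hEs : E ⊆ D.crossSection)
    (hEf : D.plancherelMeasure E < ∞) : MemLp (D.tensorField E w u) 2 volume := by
  refine memLp_two_of_lintegral_lt_top
    (D.stronglyMeasurable_tensorField w u hE).aestronglyMeasurable ?_
  rw [D.lintegral_tensorField_sq w u hE hEs]
  exact ENNReal.mul_lt_top hEf (ENNReal.mul_lt_top (by simp) (by simp))

theorem memLp_tensor : MemLp (fun q : (Fin d → ℝ) × (Fin d → ℝ) =>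
    w q.1 * starRingEnd ℂ (u (q.1 - q.2))) 2 volume := by
  refine memLp_two_of_lintegral_lt_top ?_ ?_
  · exact Measurable.aestronglyMeasurable (((Lp.stronglyMeasurable w).measurable.comp
      measurable_fst).mul (Complex.continuous_conj.measurable.comp
        ((Lp.stronglyMeasurable u).measurable.comp (by fun_prop))))
  · rw [lintegral_tensor_sq]
    exact ENNReal.mul_lt_top (by simp) (by simp)

/-- The `L²` pairing of kernels is the Hilbert–Schmidt pairing of operators, and pairing `T` with
the rank-one operator `w ⊗ u` evaluates `T` at `u`. -/
theorem _root_.HasKernel.integral_star_mul {T : L2R d → L2R d}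
    {K : (Fin d → ℝ) × (Fin d → ℝ) → ℂ}
    (h : HasKernel T K) (hK : StronglyMeasurable K) (hK2 : ∫⁻ q, ‖K q‖ₑ ^ 2 < ∞) :
    ∫ q, starRingEnd ℂ (K q) * (w q.1 * starRingEnd ℂ (u (q.1 - q.2))) = inner ℂ (T u) w := by
  have h2 : MemLp (fun q => starRingEnd ℂ (K q)) 2 volume :=
    (memLp_two_of_lintegral_lt_top hK.aestronglyMeasurable hK2).star
  have h3 := integral_prod _ (h2.integrable_mul (memLp_tensor w u))
  rw [← Measure.volume_eq_prod] at h3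
  refine h3.trans ?_
  rw [L2.inner_def]
  refine integral_congr_ae ?_
  filter_upwards [h u] with s hs
  rw [hs, RCLike.inner_apply, ← integral_conj, ← integral_const_mul]
  refine integral_congr_ae (Eventually.of_forall fun x => ?_)
  simp only [map_mul, Pi.mul_apply]
  ring

theorem integral_restrict_plancherelMeasure (hE : MeasurableSet E) (hEs : E ⊆ D.crossSection)
    (h : (Fin r → ℝ) → ℂ) :
    ∫ l in E, h l ∂D.plancherelMeasure = ∫ l in E, |(D.B l).det| • h l := by
  rw [D.restrict_plancherelMeasure hE hEs]
  have := integral_withDensity_eq_integral_smul (μ := volume.restrict E)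
    (f := fun l => Real.toNNReal |(D.B l).det|)
    D.continuous_B.matrix_det.abs.measurable.real_toNNReal h
  refine this.trans (integral_congr_ae (Eventually.of_forall fun l => ?_))
  simp only [NNReal.smul_def, Real.coe_toNNReal _ (abs_nonneg _)]

/-- `HasKernel.integral_star_mul` on each fibre; the Jacobian of the change of variables turns `dλ`
into `dμ(λ)`. -/
theorem integral_star_mul_tensorField (hE : MeasurableSet E) (hEs : E ⊆ D.crossSection)
    (hEf : D.plancherelMeasure E < ∞) {f : Lp ℂ 2 (NilGroup.haar D)}
    (hf : Integrable f (NilGroup.haar D)) :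
    ∫ p, starRingEnd ℂ (partialFourier (f ∘ (NilGroup.coordsMeas D).symm) p) *
      D.tensorField E w u p =
      ∫ l in E, inner ℂ (D.groupFourier f l u) w ∂D.plancherelMeasure := by
  have hPm : StronglyMeasurable (partialFourier (f ∘ (NilGroup.coordsMeas D).symm)) :=
    stronglyMeasurable_partialFourier (D.stronglyMeasurable_inCoords f)
  have hP2 := D.memLp_partialFourier_inCoords hf
  have hker := D.hasKernel_groupFourier hf (Lp.stronglyMeasurable f)
  set P := partialFourier (f ∘ (NilGroup.coordsMeas D).symm) with hP
  have h1 := integral_prod _ (hP2.star.integrable_mul (D.memLp_tensorField w u hE hEs hEf))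
  rw [← Measure.volume_eq_prod] at h1
  refine h1.trans ?_
  rw [D.integral_restrict_plancherelMeasure hE hEs, ← integral_indicator hE]
  refine integral_congr_ae ?_
  have hfin : ∀ᵐ l : Fin r → ℝ, ∫⁻ q : (Fin d → ℝ) × (Fin d → ℝ), ‖P (l, q)‖ₑ ^ 2 < ∞ := by
    have hm' : Measurable fun p => ‖P p‖ₑ ^ 2 := hPm.enorm.pow_const 2
    refine ae_lt_top (Measurable.lintegral_prod_right' hm') ?_
    rw [← lintegral_prod _ hm'.aemeasurable]
    exact hP2.lintegral_sq_lt_top.ne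
  filter_upwards [hfin] with l hl
  by_cases hdet : (D.B l).det = 0
  · simp [tensorField, hdet, Set.indicator]
  by_cases hlE : l ∈ E
  · rw [Set.indicator_of_mem hlE, integral_change hdet]
    congr 1
    have ht := fun q => D.tensorField_change (E := E) w u hdet q
    rw [lintegral_change hdet] at hl
    have hl2 : ∫⁻ q : (Fin d → ℝ) × (Fin d → ℝ), ‖P (l, (D.B l)ᵀ *ᵥ q.1, q.2)‖ₑ ^ 2 < ∞ := by
      refine lt_top_iff_ne_top.2 fun htop => ?_
      rw [htop, ENNReal.mul_top (by simpa using hdet)] at hl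
      exact lt_irrefl _ hl
    rw [← (hker l).integral_star_mul w u (D.stronglyMeasurable_slice hPm l) hl2]
    refine integral_congr_ae (Eventually.of_forall fun q => ?_)
    simp only [Pi.mul_apply, ht, Set.indicator_of_mem hlE]
    rfl
  · simp [tensorField, hlE, Set.indicator]

/-- The inverse Plancherel transform of `1_E w ⊗ u`. -/
theorem exists_plancherel_tensor (hE : MeasurableSet E) (hEs : E ⊆ D.crossSection)
    (hEf : D.plancherelMeasure E < ∞) : ∃ ψ : Lp ℂ 2 (NilGroup.haar D),
      ‖ψ‖ₑ ^ 2 = D.plancherelMeasure E * (‖w‖ₑ ^ 2 * ‖u‖ₑ ^ 2) ∧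
      (∀ f : Lp ℂ 2 (NilGroup.haar D), Integrable f (NilGroup.haar D) →
        inner ℂ f ψ = ∫ l in E, inner ℂ (D.groupFourier f l u) w ∂D.plancherelMeasure) ∧
      D.IsPlancherelTransform ψ (E.indicator fun _ => tensor w u) := by
  have hG := D.memLp_tensorField w u hE hEs hEf
  have hGm := D.stronglyMeasurable_tensorField w u hE
  -- `ψ` is the adjoint of the partial Fourier transform applied to the kernel field of `1_E w ⊗ u`.
  obtain ⟨ψ₀, hψ1, hψ2⟩ := exists_adjoint_partialFourier hG.toLp
  have key : ∀ f : Lp ℂ 2 (NilGroup.haar D), ∀ hf : Integrable f (NilGroup.haar D),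
      ∫ p, starRingEnd ℂ (partialFourier (f ∘ (NilGroup.coordsMeas D).symm) p) *
        D.tensorField E w u p = inner ℂ f (D.ofCoords ψ₀) := fun f hf => by
    conv_rhs => rw [← D.ofCoords_inCoords f, LinearIsometry.inner_map_map]
    rw [← hψ2 _ (D.stronglyMeasurable_inCoords f) (D.integrable_inCoords hf)]
    refine integral_congr_ae ?_
    filter_upwards [hG.coeFn_toLp] with p hp
    rw [hp]
  refine ⟨D.ofCoords ψ₀, ?_, fun f hf => ?_, fun v w' => ?_, ?_⟩
  · rw [← ofReal_norm, LinearIsometry.norm_map, hψ1, ofReal_norm, Lp.enorm_toLp, eLpNorm_two_sq,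
      D.lintegral_tensorField_sq w u hE hEs]
  · rw [← key f hf, D.integral_star_mul_tensorField w u hE hEs hEf hf]
  · have : (fun l => inner ℂ w' (E.indicator (fun _ => tensor w u) l v)) =
        E.indicator fun _ => inner ℂ w' (tensor w u v) := by
      funext l
      by_cases h : l ∈ E <;> simp [h]
    rw [this]
    exact (measurable_const.indicator hE).aemeasurable
  · obtain ⟨fs, hfs, hft⟩ := exists_seq_integrable_tendsto (D.ofCoords ψ₀)
    refine ⟨fs, hfs, hft, ?_⟩
    have hb : ∀ m, ∫⁻ l, hsNormSq (fun v => D.groupFourier (fs m) l v -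
        E.indicator (fun _ => tensor w u) l v) ∂D.plancherelMeasure ≤
        ‖fs m - D.ofCoords ψ₀‖ₑ ^ 2 := fun m => by
      refine (D.lintegral_hsNormSq_sub_le (hfs m) hGm hG
        (T := fun l => ⇑(E.indicator (fun _ => tensor w u) l)) ?_).trans (le_of_eq ?_)
      · filter_upwards [D.ae_det_ne_zero] with l hl
        exact D.hasKernel_tensorField w u hl
      · rw [← ofReal_norm, ← ofReal_norm (fs m - _)]
        congr 2
        -- The transform of `fs m` and the field `G` have the same norms and the same inner product
        -- as `fs m` and `ψ`, hence the same distance; so `fs m → ψ` forces convergence of the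
        -- transforms.
        have hin : inner ℂ (D.memLp_partialFourier_inCoords (hfs m)).toLp hG.toLp =
            inner ℂ (fs m) (D.ofCoords ψ₀) := by
          rw [← key _ (hfs m), L2.inner_def]
          refine integral_congr_ae ?_
          filter_upwards [hG.coeFn_toLp, (D.memLp_partialFourier_inCoords (hfs m)).coeFn_toLp]
            with p h1 h2
          rw [h1, h2, RCLike.inner_apply, mul_comm]
        refine (sq_eq_sq₀ (norm_nonneg _) (norm_nonneg _)).1 ?_
        rw [@norm_sub_sq ℂ, @norm_sub_sq ℂ, hin, D.norm_partialFourier_inCoords (hfs m),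
          LinearIsometry.norm_map, hψ1]
    have h0 : Tendsto (fun m => ‖fs m - D.ofCoords ψ₀‖ₑ ^ 2) atTop (𝓝 0) := by
      have h1 := tendsto_iff_edist_tendsto_0.1 hft
      simp only [edist_eq_enorm_sub] at h1
      have h2 := (ENNReal.continuous_pow 2).continuousAt.tendsto.comp h1
      rw [zero_pow two_ne_zero] at h2
      exact h2
    exact tendsto_of_tendsto_of_tendsto_of_le_of_le tendsto_const_nhds h0
      (fun _ => bot_le) hb

end AdmissibleBasis

end

/-! ### Uniqueness of the Plancherel transform and its behaviour under left translation -/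

section

theorem hsNormSq_sub_comm {E : Type*} [NormedAddCommGroup E] [InnerProductSpace ℂ E]
    [CompleteSpace E] (A B : E → E) :
    hsNormSq (fun v => A v - B v) = hsNormSq (fun v => B v - A v) := by
  simp only [hsNormSq]
  refine tsum_congr fun e => ?_
  rw [← enorm_neg, neg_sub]

namespace AdmissibleBasis

variable {d : ℕ} {𝔫 : Type*} [LieRing 𝔫] [LieAlgebra ℝ 𝔫] {r : ℕ} (D : AdmissibleBasis 𝔫 r d)

theorem groupFourier_sub {f g : Lp ℂ 2 (NilGroup.haar D)} (hf : Integrable f (NilGroup.haar D))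
    (hg : Integrable g (NilGroup.haar D)) (l : Fin r → ℝ) (v : L2R d) :
    D.groupFourier (f - g : Lp ℂ 2 (NilGroup.haar D)) l v =
      D.groupFourier f l v - D.groupFourier g l v := by
  simp only [groupFourier]
  rw [← integral_sub (D.integrable_smul_rep hf l v) (D.integrable_smul_rep hg l v)]
  refine integral_congr_ae ?_
  filter_upwards [Lp.coeFn_sub f g] with n hn
  rw [hn, Pi.sub_apply, sub_smul]

variable {D}

theorem aemeasurable_hsNormSq_groupFourier_sub {T : (Fin r → ℝ) → (L2R d →L[ℂ] L2R d)}
    (hT : ∀ v w : L2R d, AEMeasurable (fun l => inner ℂ w (T l v)) D.plancherelMeasure)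
    (f : Lp ℂ 2 (NilGroup.haar D)) :
    AEMeasurable (fun l => hsNormSq fun v => D.groupFourier f l v - T l v)
      D.plancherelMeasure := by
  refine aemeasurable_hsNormSq fun v w => ?_
  simp only [inner_sub_right]
  exact (D.aemeasurable_inner_groupFourier (Lp.stronglyMeasurable f) v w _).sub (hT v w)

theorem aestronglyMeasurable_groupFourier (f : Lp ℂ 2 (NilGroup.haar D)) (v : L2R d) :
    AEStronglyMeasurable (fun l => D.groupFourier f l v) D.plancherelMeasure :=
  aestronglyMeasurable_of_forall_inner fun w =>
    D.aemeasurable_inner_groupFourier (Lp.stronglyMeasurable f) v w _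

/-- Two sequences approximating `φ` differ by a null sequence in `L²(N)`, whose Fourier transforms
tend to zero by `lintegral_hsNormSq_groupFourier_le`; the Hilbert–Schmidt distance of `T` and `T'`
is then zero. -/
theorem IsPlancherelTransform.ae_eq {φ : Lp ℂ 2 (NilGroup.haar D)}
    {T T' : (Fin r → ℝ) → (L2R d →L[ℂ] L2R d)}
    (h : D.IsPlancherelTransform φ T) (h' : D.IsPlancherelTransform φ T') :
    ∀ᵐ l ∂D.plancherelMeasure, T l = T' l := by
  obtain ⟨hm, fs, hfs, hft, hlim⟩ := h
  obtain ⟨hm', fs', hfs', hft', hlim'⟩ := h'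
  have hd : Tendsto (fun m => ‖fs m - fs' m‖ₑ ^ 2) atTop (𝓝 0) := by
    have h1 := continuous_enorm.continuousAt.tendsto.comp (hft.sub hft')
    have h2 := (ENNReal.continuous_pow 2).continuousAt.tendsto.comp h1
    rw [sub_self, enorm_zero, zero_pow two_ne_zero] at h2
    exact h2
  have hsub : ∀ m, Integrable (fs m - fs' m : Lp ℂ 2 (NilGroup.haar D)) (NilGroup.haar D) :=
    fun m => ((hfs m).sub (hfs' m)).congr (Lp.coeFn_sub _ _).symm
  have hb : ∀ m, ∫⁻ l, hsNormSq (fun v => T l v - T' l v) ∂D.plancherelMeasure ≤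
      4 * (∫⁻ l, hsNormSq (fun v => D.groupFourier (fs m) l v - T l v) ∂D.plancherelMeasure +
        4 * (‖fs m - fs' m‖ₑ ^ 2 +
          ∫⁻ l, hsNormSq (fun v => D.groupFourier (fs' m) l v - T' l v)
            ∂D.plancherelMeasure)) := fun m => by
    have hp : ∀ l, hsNormSq (fun v => T l v - T' l v) ≤
        4 * (hsNormSq (fun v => D.groupFourier (fs m) l v - T l v) +
        4 * (hsNormSq (D.groupFourier (fs m - fs' m : Lp ℂ 2 (NilGroup.haar D)) l) +
          hsNormSq (fun v => D.groupFourier (fs' m) l v - T' l v))) := fun l => by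
      have e : (fun v => T l v - T' l v) = fun v => (T l v - D.groupFourier (fs m) l v) +
          (D.groupFourier (fs m - fs' m : Lp ℂ 2 (NilGroup.haar D)) l v +
            (D.groupFourier (fs' m) l v - T' l v)) := by
        funext v
        rw [D.groupFourier_sub (hfs m) (hfs' m)]
        abel
      rw [e, hsNormSq_sub_comm (D.groupFourier (fs m) l)]
      refine (hsNormSq_add_le _ _).trans ?_
      gcongr
      exact hsNormSq_add_le _ _
    refine (lintegral_mono hp).trans ?_
    rw [lintegral_const_mul' _ _ (by norm_num),
      lintegral_add_left' (aemeasurable_hsNormSq_groupFourier_sub hm (fs m)),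
      lintegral_const_mul' _ _ (by norm_num),
      lintegral_add_right' _ (aemeasurable_hsNormSq_groupFourier_sub hm' (fs' m))]
    gcongr
    exact D.lintegral_hsNormSq_groupFourier_le (hsub m)
  have h0 : ∫⁻ l, hsNormSq (fun v => T l v - T' l v) ∂D.plancherelMeasure = 0 := by
    have h4 : (4 : ℝ≥0∞) ≠ ∞ := by norm_num
    have h5 := ENNReal.Tendsto.const_mul (hlim.add (ENNReal.Tendsto.const_mul (hd.add hlim')
      (Or.inr h4))) (Or.inr h4)
    rw [add_zero, mul_zero, add_zero, mul_zero] at h5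
    exact le_antisymm (ge_of_tendsto' h5 hb) bot_le
  rw [lintegral_eq_zero_iff'] at h0
  · filter_upwards [h0] with l hl
    ext1 v
    have h1 := enorm_apply_sq_le_hsNormSq (T l - T' l) v
    have h2 : hsNormSq ⇑(T l - T' l) = 0 := hl
    rw [h2, zero_mul, nonpos_iff_eq_zero] at h1
    simpa [sub_eq_zero] using h1
  · refine aemeasurable_hsNormSq fun v w => ?_
    simp only [inner_sub_right]
    exact (hm v w).sub (hm' v w)

theorem IsPlancherelTransform.lintegral_hsNormSq_lt_top {φ : Lp ℂ 2 (NilGroup.haar D)}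
    {T : (Fin r → ℝ) → (L2R d →L[ℂ] L2R d)} (h : D.IsPlancherelTransform φ T) :
    ∫⁻ l, hsNormSq (T l) ∂D.plancherelMeasure < ∞ := by
  obtain ⟨hm, fs, hfs, hft, hlim⟩ := h
  obtain ⟨m, hfin⟩ := (hlim.eventually_lt_const ENNReal.zero_lt_top).exists
  have hp : ∀ l, hsNormSq (T l) ≤ 4 * (hsNormSq (fun v => D.groupFourier (fs m) l v - T l v) +
      hsNormSq (D.groupFourier (fs m) l)) := fun l => by
    have e : ⇑(T l) = fun v => (T l v - D.groupFourier (fs m) l v) +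
        D.groupFourier (fs m) l v := by
      funext v
      abel
    rw [hsNormSq_sub_comm (D.groupFourier (fs m) l)]
    conv_lhs => rw [e]
    exact hsNormSq_add_le _ _
  refine (lintegral_mono hp).trans_lt ?_
  rw [lintegral_const_mul' _ _ (by norm_num),
    lintegral_add_left' (aemeasurable_hsNormSq_groupFourier_sub hm (fs m))]
  refine ENNReal.mul_lt_top (by norm_num) (ENNReal.add_lt_top.2 ⟨hfin, ?_⟩)
  exact (D.lintegral_hsNormSq_groupFourier_le (hfs m)).trans_lt (by simp)

/-! ### Left translations -/

theorem measurableEmbedding_mul_left (γ : NilGroup D) :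
    MeasurableEmbedding fun n : NilGroup D => γ * n := by
  refine MeasurableEquiv.measurableEmbedding
    { toEquiv := Equiv.mulLeft γ
      measurable_toFun := (NilGroup.measurePreserving_mul_left γ).measurable
      measurable_invFun := (NilGroup.measurePreserving_mul_left γ⁻¹).measurable }

theorem coeFn_leftRegular (γ : NilGroup D) (f : Lp ℂ 2 (NilGroup.haar D)) :
    NilGroup.leftRegular γ f =ᵐ[NilGroup.haar D] fun n => f (γ⁻¹ * n) :=
  Lp.coeFn_compMeasurePreserving f (NilGroup.measurePreserving_mul_left γ⁻¹)

theorem integrable_leftRegular (γ : NilGroup D) {f : Lp ℂ 2 (NilGroup.haar D)}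
    (hf : Integrable f (NilGroup.haar D)) :
    Integrable (NilGroup.leftRegular γ f) (NilGroup.haar D) :=
  ((NilGroup.measurePreserving_mul_left γ⁻¹).integrable_comp_of_integrable hf).congr
    (coeFn_leftRegular γ f).symm

/-- Left invariance of the Haar measure together with `rep_mul`: the transform intertwines `L(γ)`
with `π_λ(γ)`. -/
theorem groupFourier_leftRegular (γ : NilGroup D) {f : Lp ℂ 2 (NilGroup.haar D)}
    (hf : Integrable f (NilGroup.haar D)) (l : Fin r → ℝ) (v : L2R d) :
    D.groupFourier (NilGroup.leftRegular γ f) l v = D.rep l γ (D.groupFourier f l v) := by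
  have h1 : D.groupFourier (NilGroup.leftRegular γ f) l v =
      ∫ n, f (γ⁻¹ * n) • D.rep l (γ * (γ⁻¹ * n)) v ∂(NilGroup.haar D) := by
    refine integral_congr_ae ?_
    filter_upwards [coeFn_leftRegular γ f] with n hn
    rw [hn, mul_inv_cancel_left]
  rw [h1, (NilGroup.measurePreserving_mul_left γ⁻¹).integral_comp
    (measurableEmbedding_mul_left γ⁻¹) (fun n => f n • D.rep l (γ * n) v), groupFourier,
    ← ContinuousLinearMap.integral_comp_comm _ (D.integrable_smul_rep hf l v)]
  refine integral_congr_ae (Eventually.of_forall fun n => ?_)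
  simp only [rep_mul, ContinuousLinearMap.comp_apply, map_smul]

theorem aestronglyMeasurable_rep_apply {μ : Measure (Fin r → ℝ)} {A : (Fin r → ℝ) → L2R d}
    (hA : AEStronglyMeasurable A μ) (γ : NilGroup D) :
    AEStronglyMeasurable (fun l => D.rep l γ (A l)) μ := by
  have hc := D.continuous_rep (W := (Fin r → ℝ) × L2R d) (l := Prod.fst)
    (p := fun _ => NilGroup.coordsMeas D γ) (v := Prod.snd) continuous_fst continuous_const
    continuous_snd
  have h := hc.comp_aestronglyMeasurable (aestronglyMeasurable_id.prodMk hA)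
  refine h.congr (Eventually.of_forall fun l => ?_)
  simp

/-- Cauchy–Schwarz on `E`, with `π_λ(γ)` isometric. It converts convergence in the Hilbert–Schmidt
direct integral into `L¹` convergence of coefficients over `E`. -/
theorem lintegral_inner_rep_le {E : Set (Fin r → ℝ)} {A : (Fin r → ℝ) → L2R d}
    (hA : AEStronglyMeasurable A (D.plancherelMeasure.restrict E)) (γ : NilGroup D) (w : L2R d) :
    ∫⁻ l in E, ‖inner ℂ (D.rep l γ (A l)) w‖ₑ ∂D.plancherelMeasure ≤
      ‖w‖ₑ * ((∫⁻ l in E, ‖A l‖ₑ ^ 2 ∂D.plancherelMeasure) ^ (1 / 2 : ℝ) *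
        D.plancherelMeasure E ^ (1 / 2 : ℝ)) := by
  have h1 : ∀ l, ‖inner ℂ (D.rep l γ (A l)) w‖ₑ ≤ ‖w‖ₑ * ‖A l‖ₑ := fun l => by
    have := norm_inner_le_norm (𝕜 := ℂ) (D.rep l γ (A l)) w
    rw [norm_rep, mul_comm] at this
    rw [← ofReal_norm, ← ofReal_norm, ← ofReal_norm, ← ENNReal.ofReal_mul (norm_nonneg _)]
    exact ENNReal.ofReal_le_ofReal this
  refine (lintegral_mono h1).trans ?_
  rw [lintegral_const_mul' _ _ (by simp)]
  gcongr
  have h2 := eLpNorm_le_eLpNorm_mul_rpow_measure_univ (p := 1) (q := 2) (by norm_num) hA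
  rw [eLpNorm_one_eq_lintegral_enorm, Measure.restrict_apply_univ] at h2
  refine h2.trans (le_of_eq ?_)
  rw [← eLpNorm_two_sq, ← ENNReal.rpow_natCast, ← ENNReal.rpow_mul]
  norm_num

/-- For integrable functions this is `hψ` combined with the intertwining property; both sides pass
to the limit along a sequence defining the transform of `φ`. -/
theorem IsPlancherelTransform.inner_leftRegular {φ ψ : Lp ℂ 2 (NilGroup.haar D)}
    {T : (Fin r → ℝ) → (L2R d →L[ℂ] L2R d)} (h : D.IsPlancherelTransform φ T)
    {E : Set (Fin r → ℝ)} (hEf : D.plancherelMeasure E < ∞) {w u : L2R d}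
    (hψ : ∀ f : Lp ℂ 2 (NilGroup.haar D), Integrable f (NilGroup.haar D) →
        inner ℂ f ψ = ∫ l in E, inner ℂ (D.groupFourier f l u) w ∂D.plancherelMeasure)
    (γ : NilGroup D) :
    inner ℂ (NilGroup.leftRegular γ φ) ψ =
      ∫ l in E, inner ℂ (D.rep l γ (T l u)) w ∂D.plancherelMeasure := by
  have hfinT := h.lintegral_hsNormSq_lt_top
  obtain ⟨hm, fs, hfs, hft, hlim⟩ := h
  have hTm : AEStronglyMeasurable (fun l => T l u) (D.plancherelMeasure.restrict E) :=
    (aestronglyMeasurable_of_forall_inner fun w => hm u w).restrict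
  have hFm : ∀ m, AEStronglyMeasurable (fun l => D.groupFourier (fs m) l u)
      (D.plancherelMeasure.restrict E) := fun m =>
    (aestronglyMeasurable_groupFourier (fs m) u).restrict
  have hint : ∀ {A : (Fin r → ℝ) → L2R d},
      AEStronglyMeasurable A (D.plancherelMeasure.restrict E) →
      ∫⁻ l in E, ‖A l‖ₑ ^ 2 ∂D.plancherelMeasure < ∞ →
      Integrable (fun l => inner ℂ (D.rep l γ (A l)) w) (D.plancherelMeasure.restrict E) := by
    intro A hA hA2
    refine ⟨(aestronglyMeasurable_rep_apply hA γ).inner aestronglyMeasurable_const, ?_⟩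
    refine (lintegral_inner_rep_le hA γ w).trans_lt ?_
    exact ENNReal.mul_lt_top (by simp) (ENNReal.mul_lt_top
      (ENNReal.rpow_lt_top_of_nonneg (by norm_num) hA2.ne)
      (ENNReal.rpow_lt_top_of_nonneg (by norm_num) hEf.ne))
  have hle : ∀ S : (Fin r → ℝ) → (L2R d →L[ℂ] L2R d),
      ∫⁻ l in E, ‖S l u‖ₑ ^ 2 ∂D.plancherelMeasure ≤
        ‖u‖ₑ ^ 2 * ∫⁻ l, hsNormSq (S l) ∂D.plancherelMeasure := fun S => by
    rw [← lintegral_const_mul' _ _ (by simp)]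
    refine (setLIntegral_le_lintegral _ _).trans (lintegral_mono fun l => ?_)
    rw [mul_comm]
    exact enorm_apply_sq_le_hsNormSq (S l) u
  have h1 : Tendsto (fun m => inner ℂ (NilGroup.leftRegular γ (fs m)) ψ) atTop
      (𝓝 (inner ℂ (NilGroup.leftRegular γ φ) ψ)) :=
    (((NilGroup.leftRegular γ).continuous.tendsto φ).comp hft).inner tendsto_const_nhds
  refine tendsto_nhds_unique h1 ?_
  have h2 : ∀ m, inner ℂ (NilGroup.leftRegular γ (fs m)) ψ =
      ∫ l in E, inner ℂ (D.rep l γ (D.groupFourier (fs m) l u)) w ∂D.plancherelMeasure :=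
    fun m => by
      rw [hψ _ (integrable_leftRegular γ (hfs m))]
      simp only [groupFourier_leftRegular γ (hfs m)]
  simp only [h2]
  refine tendsto_integral_of_L1 _ (hint hTm ?_).1 (Eventually.of_forall fun m => hint (hFm m) ?_) ?_
  · exact (hle T).trans_lt (ENNReal.mul_lt_top (by simp) hfinT)
  · exact (hle fun l => D.groupFourierL (hfs m) l).trans_lt (ENNReal.mul_lt_top (by simp)
      ((D.lintegral_hsNormSq_groupFourier_le (hfs m)).trans_lt (by simp)))
  · have hb : ∀ m, ∫⁻ l in E, ‖inner ℂ (D.rep l γ (D.groupFourier (fs m) l u)) w -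
        inner ℂ (D.rep l γ (T l u)) w‖ₑ ∂D.plancherelMeasure ≤
        ‖w‖ₑ * ((‖u‖ₑ ^ 2 * ∫⁻ l, hsNormSq (fun v => D.groupFourier (fs m) l v - T l v)
          ∂D.plancherelMeasure) ^ (1 / 2 : ℝ) * D.plancherelMeasure E ^ (1 / 2 : ℝ)) := fun m => by
      simp only [← inner_sub_left, ← map_sub]
      refine (lintegral_inner_rep_le ((hFm m).sub hTm) γ w).trans ?_
      gcongr
      exact hle fun l => D.groupFourierL (hfs m) l - T l
    refine tendsto_of_tendsto_of_tendsto_of_le_of_le tendsto_const_nhds ?_ (fun _ => bot_le) hb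
    have h3 := ENNReal.Tendsto.const_mul hlim (Or.inr (by simp : ‖u‖ₑ ^ 2 ≠ ∞))
    have h4 := (ENNReal.continuous_rpow_const (y := 1 / 2)).continuousAt.tendsto.comp h3
    have h5 := ENNReal.Tendsto.mul_const h4 (Or.inr
      (ENNReal.rpow_lt_top_of_nonneg (by norm_num) hEf.ne :
        D.plancherelMeasure E ^ (1 / 2 : ℝ) < ∞).ne)
    have h6 := ENNReal.Tendsto.const_mul h5 (Or.inr (enorm_ne_top : ‖w‖ₑ ≠ ∞))
    simpa using h6

end AdmissibleBasis

end

/-! ### Parseval for exponentials on a parallelepiped -/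

section

attribute [local instance] instMeasureSpaceUnitAddCircle

theorem mFourier_coe {n : ℕ} (k : Fin n → ℤ) (x : Fin n → ℝ) :
    UnitAddTorus.mFourier k (fun i => (x i : UnitAddCircle)) =
      Complex.exp (2 * Real.pi * Complex.I * (x ⬝ᵥ (fun i => (k i : ℝ)) : ℝ)) := by
  simp only [UnitAddTorus.mFourier, ContinuousMap.coe_mk, fourier_coe_apply, ← Complex.exp_sum,
    dotProduct]
  congr 1
  push_cast
  rw [Finset.mul_sum]
  exact Finset.sum_congr rfl fun i _ => by ring

/-- A function supported in a half-open unit box is a function on the torus, and the integrals are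
its Fourier coefficients. -/
theorem tsum_enorm_integral_expChar_mul_of_Ioc {n : ℕ} {h : (Fin n → ℝ) → ℂ} (hm : Measurable h)
    (hL : ∫⁻ t, ‖h t‖ₑ ^ 2 < ∞) (c : Fin n → ℝ)
    (hs : ∀ t, h t ≠ 0 → ∀ i, t i ∈ Set.Ioc (c i) (c i + 1)) :
    ∑' k : Fin n → ℤ, ‖∫ t, Complex.exp (2 * Real.pi * Complex.I *
      (t ⬝ᵥ (fun i => (k i : ℝ)) : ℝ)) * h t‖ₑ ^ 2 = ∫⁻ t, ‖h t‖ₑ ^ 2 := by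
  set box : Set (Fin n → ℝ) := {x | ∀ i, x i ∈ Set.Ioc (c i) (c i + 1)} with hbox
  have hboxm : MeasurableSet box := by
    have : box = Set.pi Set.univ fun i => Set.Ioc (c i) (c i + 1) := by ext; simp [hbox]
    rw [this]
    exact MeasurableSet.univ_pi fun i => measurableSet_Ioc
  set f : UnitAddTorus (Fin n) → ℂ := fun x => h (UnitAddTorus.measurableEquivPiIoc c x).1 with hf
  have hfm : Measurable f :=
    hm.comp (measurable_subtype_coe.comp (UnitAddTorus.measurableEquivPiIoc c).measurable)
  have hfx : ∀ x ∈ box, f (fun i => (x i : UnitAddCircle)) = h x := fun x hx => by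
    have := (UnitAddTorus.measurableEquivPiIoc c).apply_symm_apply ⟨x, hx⟩
    rw [UnitAddTorus.coe_symm_measurableEquivPiIoc_apply] at this
    rw [hf]
    exact congrArg (fun y => h (Subtype.val y)) this
  have hnorm : ∫⁻ x, ‖f x‖ₑ ^ 2 = ∫⁻ t, ‖h t‖ₑ ^ 2 := by
    rw [UnitAddTorus.lintegral_preimage _ c]
    change ∫⁻ x in box, _ = _
    rw [setLIntegral_congr_fun hboxm fun x hx => by rw [hfx x hx]]
    refine setLIntegral_eq_of_support_subset fun t ht => hs t ?_
    rintro h0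
    simp [h0] at ht
  have hf2 : MemLp f 2 volume :=
    memLp_two_of_lintegral_lt_top hfm.aestronglyMeasurable (by rw [hnorm]; exact hL)
  have h1 := HilbertBasis.tsum_enorm_inner_sq UnitAddTorus.mFourierBasis (hf2.toLp f)
  rw [enorm_Lp_two_sq, lintegral_congr_ae (by
    filter_upwards [hf2.coeFn_toLp] with x hx using by rw [hx]), hnorm] at h1
  -- Fourier coefficients carry the exponent `-k`; the sum is over all of `ℤ^n`, so the sign is
  -- reindexed away.
  rw [← h1, ← (Equiv.neg (Fin n → ℤ)).tsum_eq]
  refine tsum_congr fun k => ?_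
  rw [← HilbertBasis.repr_apply_apply, UnitAddTorus.mFourierBasis_repr,
    UnitAddTorus.mFourierCoeff]
  have hae : ∫ x, UnitAddTorus.mFourier (-k) x • hf2.toLp f x =
      ∫ x, UnitAddTorus.mFourier (-k) x • f x := by
    refine integral_congr_ae ?_
    filter_upwards [hf2.coeFn_toLp] with x hx
    rw [hx]
  rw [hae, UnitAddTorus.integral_preimage _ c]
  change _ = ‖∫ x in box, _‖ₑ ^ 2
  rw [setIntegral_congr_fun (g := fun x => Complex.exp (2 * Real.pi * Complex.I *
      (x ⬝ᵥ (fun i => (((-k) i : ℤ) : ℝ)) : ℝ)) * h x) hboxm fun x hx => by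
      simp only [hfx x hx, mFourier_coe, smul_eq_mul],
    setIntegral_eq_integral_of_forall_compl_eq_zero fun x hx => ?_]
  · rfl
  by_contra h0
  exact hx (hs x fun h1 => h0 (by rw [h1, mul_zero]))

/-- Passing to the closed box changes only a null set; the closed form is the one that fits `0 ≤ λ_k
≤ a_k`. -/
theorem tsum_enorm_integral_expChar_mul_of_Icc {n : ℕ} {h : (Fin n → ℝ) → ℂ}
    (hm : AEStronglyMeasurable h volume)
    (hL : ∫⁻ t, ‖h t‖ₑ ^ 2 < ∞) (c : Fin n → ℝ)
    (hs : ∀ t, h t ≠ 0 → ∀ i, t i ∈ Set.Icc (c i) (c i + 1)) :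
    ∑' k : Fin n → ℤ, ‖∫ t, Complex.exp (2 * Real.pi * Complex.I *
      (t ⬝ᵥ (fun i => (k i : ℝ)) : ℝ)) * h t‖ₑ ^ 2 = ∫⁻ t, ‖h t‖ₑ ^ 2 := by
  set box : Set (Fin n → ℝ) := Set.pi Set.univ fun i => Set.Ioc (c i) (c i + 1) with hbox
  have hboxm : MeasurableSet box := MeasurableSet.univ_pi fun i => measurableSet_Ioc
  set g : (Fin n → ℝ) → ℂ := box.indicator (hm.mk h) with hg
  have hgh : h =ᵐ[volume] g := by
    have h1 : box =ᵐ[volume] Set.Icc c (c + 1) :=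
      Measure.univ_pi_Ioc_ae_eq_Icc (μ := fun _ : Fin n => (volume : Measure ℝ))
    filter_upwards [h1.mem_iff, hm.ae_eq_mk] with t ht ht'
    by_cases h2 : t ∈ box
    · rw [hg, Set.indicator_of_mem h2, ht']
    · rw [hg, Set.indicator_of_notMem h2]
      by_contra h0
      exact h2 (ht.2 ⟨fun i => (hs t h0 i).1, fun i => (hs t h0 i).2⟩)
  have hgn : ∫⁻ t, ‖h t‖ₑ ^ 2 = ∫⁻ t, ‖g t‖ₑ ^ 2 :=
    lintegral_congr_ae (hgh.fun_comp fun z => ‖z‖ₑ ^ 2)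
  rw [hgn] at hL ⊢
  rw [← tsum_enorm_integral_expChar_mul_of_Ioc
    (hm.stronglyMeasurable_mk.measurable.indicator hboxm) hL c fun t ht i => ?_]
  · refine tsum_congr fun k => ?_
    congr 2
    refine integral_congr_ae (hgh.mono fun t ht => ?_)
    simp only [ht, hg]
  · exact Set.mem_of_indicator_ne_zero ht i (Set.mem_univ i)

theorem map_mulVec_volume {n : ℕ} {P : Matrix (Fin n) (Fin n) ℝ} (hP : P.det ≠ 0) :
    Measure.map (fun s : Fin n → ℝ => P *ᵥ s) volume = ENNReal.ofReal |P.det⁻¹| • volume :=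
  Real.map_matrix_volume_pi_eq_smul_volume_pi hP

theorem measurableEmbedding_mulVec {n : ℕ} {P : Matrix (Fin n) (Fin n) ℝ} (hP : P.det ≠ 0) :
    MeasurableEmbedding (fun s : Fin n → ℝ => P *ᵥ s) := by
  have hPu : IsUnit P.det := isUnit_iff_ne_zero.2 hP
  refine MeasurableEquiv.measurableEmbedding (e := ⟨⟨fun s => P *ᵥ s, fun s => P⁻¹ *ᵥ s,
    fun s => ?_, fun s => ?_⟩, ?_, ?_⟩)
  · simp [Matrix.nonsing_inv_mul _ hPu]
  · simp [Matrix.mul_nonsing_inv _ hPu]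
  · exact (continuous_const.matrix_mulVec continuous_id).measurable
  · exact (continuous_const.matrix_mulVec continuous_id).measurable

theorem integral_comp_mulVec {n : ℕ} {P : Matrix (Fin n) (Fin n) ℝ} (hP : P.det ≠ 0)
    (G : (Fin n → ℝ) → ℂ) : ∫ t, G (P *ᵥ t) = |P.det⁻¹| • ∫ t, G t := by
  rw [← (measurableEmbedding_mulVec hP).integral_map G, map_mulVec_volume hP, integral_smul_measure,
    ENNReal.toReal_ofReal (abs_nonneg _)]

theorem lintegral_comp_mulVec {n : ℕ} {P : Matrix (Fin n) (Fin n) ℝ} (hP : P.det ≠ 0)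
    (G : (Fin n → ℝ) → ℝ≥0∞) :
    ∫⁻ t, G (P *ᵥ t) = ENNReal.ofReal |P.det⁻¹| * ∫⁻ t, G t := by
  rw [← (measurableEmbedding_mulVec hP).lintegral_map G, map_mulVec_volume hP,
    lintegral_smul_measure, smul_eq_mul]

/-- Substitution `t ↦ P t`: the squared integrals contribute `|det P|⁻²` and the norm gives back one
`|det P|`. It is used with `P = diag(1/a_k)` for the centre and with `P = Cᵀ` for Gabor modulations.
-/
theorem tsum_enorm_integral_expChar_mul {n : ℕ} {P : Matrix (Fin n) (Fin n) ℝ} (hP : P.det ≠ 0)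
    {h : (Fin n → ℝ) → ℂ} (hm : AEStronglyMeasurable h volume)
    (hL : ∫⁻ t, ‖h t‖ₑ ^ 2 < ∞) (c : Fin n → ℝ)
    (hs : ∀ t, h t ≠ 0 → ∀ i, (P *ᵥ t) i ∈ Set.Icc (c i) (c i + 1)) :
    ∑' k : Fin n → ℤ, ‖∫ t, Complex.exp (2 * Real.pi * Complex.I *
      (P *ᵥ t ⬝ᵥ (fun i => (k i : ℝ)) : ℝ)) * h t‖ₑ ^ 2 =
      ENNReal.ofReal |P.det⁻¹| * ∫⁻ t, ‖h t‖ₑ ^ 2 := by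
  have hPu : IsUnit P.det := isUnit_iff_ne_zero.2 hP
  have hPi : P⁻¹.det ≠ 0 := by
    rw [Matrix.det_nonsing_inv, Ring.inverse_eq_inv']; exact inv_ne_zero hP
  set g : (Fin n → ℝ) → ℂ := fun t => h (P⁻¹ *ᵥ t) with hg
  have hgP : ∀ t, g (P *ᵥ t) = h t := fun t => by
    rw [hg]; simp [Matrix.nonsing_inv_mul _ hPu]
  have hq : Measure.QuasiMeasurePreserving (fun s : Fin n → ℝ => P⁻¹ *ᵥ s) volume volume :=
    ⟨(measurableEmbedding_mulVec hPi).measurable, by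
      rw [map_mulVec_volume hPi]; exact Measure.smul_absolutelyContinuous⟩
  have hgm : AEStronglyMeasurable g volume := hm.comp_quasiMeasurePreserving hq
  have hn : ∫⁻ t, ‖h t‖ₑ ^ 2 = ENNReal.ofReal |P.det⁻¹| * ∫⁻ t, ‖g t‖ₑ ^ 2 := by
    rw [← lintegral_comp_mulVec hP]
    simp only [hgP]
  have hgL : ∫⁻ t, ‖g t‖ₑ ^ 2 < ∞ := by
    rw [hg, lintegral_comp_mulVec hPi (fun t => ‖h t‖ₑ ^ 2)]
    exact ENNReal.mul_lt_top ENNReal.ofReal_lt_top hL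
  rw [hn, ← tsum_enorm_integral_expChar_mul_of_Icc hgm hgL c fun t ht i => ?_,
    ← ENNReal.tsum_mul_left, ← ENNReal.tsum_mul_left]
  · refine tsum_congr fun k => ?_
    have h1 := integral_comp_mulVec hP (fun t => Complex.exp (2 * Real.pi * Complex.I *
      (t ⬝ᵥ (fun i => (k i : ℝ)) : ℝ)) * g t)
    simp only [hgP] at h1
    rw [h1, enorm_smul, mul_pow, Real.enorm_eq_ofReal (abs_nonneg _), sq, mul_assoc]
  · have := hs _ ht i
    rwa [Matrix.mulVec_mulVec, Matrix.mul_nonsing_inv _ hPu, Matrix.one_mulVec] at this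

end

/-! ### The determinant bound for Gabor Parseval frames -/

section

theorem tsum_setLIntegral_fiber {X ι : Type*} [MeasurableSpace X] [Countable ι] {μ : Measure X}
    {N : X → ι} (hN : ∀ j, MeasurableSet {x | N x = j}) (f : X → ℝ≥0∞) :
    ∑' j, ∫⁻ x in {x | N x = j}, f x ∂μ = ∫⁻ x, f x ∂μ := by
  rw [← lintegral_iUnion hN]
  · rw [Set.iUnion_eq_univ_iff.2 fun x => ⟨N x, rfl⟩, setLIntegral_univ]
  · intro i j hij
    refine Set.disjoint_left.2 fun x hx hx' => hij ?_
    exact hx.symm.trans hx'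

theorem measurableSet_floor_mulVec {d : ℕ} (P : Matrix (Fin d) (Fin d) ℝ) (j : Fin d → ℤ) :
    MeasurableSet {s : Fin d → ℝ | (fun i => ⌊(P *ᵥ s) i⌋) = j} := by
  have hm : Measurable fun (s : Fin d → ℝ) (i : Fin d) => ⌊(P *ᵥ s) i⌋ :=
    measurable_pi_lambda _ fun i => Int.measurable_floor.comp
      ((measurable_pi_apply i).comp (continuous_const.matrix_mulVec continuous_id).measurable)
  exact hm (measurableSet_singleton j)

theorem diagInv_mulVec {d : ℕ} (b v : Fin d → ℝ) : diagInv b *ᵥ v = fun i => v i / b i := by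
  ext i
  rw [diagInv, Matrix.mulVec_diagonal, one_div, inv_mul_eq_div]

/-- The fundamental domain `∏ [0, 1 / b_i)` of the lattice `∏ b_i⁻¹ ℤ`. -/
def latticeCell {d : ℕ} (b : Fin d → ℝ) : Set (Fin d → ℝ) := {s | (fun i => ⌊b i * s i⌋) = 0}

theorem latticeCell_eq {d : ℕ} {b : Fin d → ℝ} (hb : ∀ j, 0 < b j) :
    latticeCell b = Set.univ.pi fun i => Set.Ico 0 (1 / b i) := by
  ext s
  simp only [latticeCell, Set.mem_ofPred_eq, funext_iff, Pi.zero_apply, Int.floor_eq_zero_iff,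
    Set.mem_pi, Set.mem_univ, true_imp_iff, Set.mem_Ico]
  refine forall_congr' fun i => ?_
  rw [lt_div_iff₀' (hb i), mul_nonneg_iff_of_pos_left (hb i)]

theorem measurableSet_latticeCell {d : ℕ} {b : Fin d → ℝ} (hb : ∀ j, 0 < b j) :
    MeasurableSet (latticeCell b) := by
  rw [latticeCell_eq hb]
  exact MeasurableSet.univ_pi fun i => measurableSet_Ico

theorem volume_latticeCell {d : ℕ} {b : Fin d → ℝ} (hb : ∀ j, 0 < b j) :
    volume (latticeCell b) = ENNReal.ofReal (diagInv b).det := by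
  rw [latticeCell_eq hb, Real.volume_pi_Ico, diagInv, Matrix.det_diagonal,
    ENNReal.ofReal_prod_of_nonneg fun i _ => (one_div_pos.2 (hb i)).le]
  simp

/-- The translates of `latticeCell b` by `∏ b_i⁻¹ ℤ` tile the space; the tile containing `s` is read
off from the integers `⌊b i * s i⌋`. -/
theorem tsum_setLIntegral_translate {d : ℕ} {b : Fin d → ℝ} (hb : ∀ j, 0 < b j)
    (G : (Fin d → ℝ) → ℝ≥0∞) :
    ∑' n : Fin d → ℤ, ∫⁻ s in latticeCell b, G (s - diagInv b *ᵥ fun j => (n j : ℝ)) =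
      ∫⁻ s, G s := by
  have hN : ∀ j, MeasurableSet {s : Fin d → ℝ | (fun i => ⌊b i * s i⌋) = j} := fun j => by
    have := measurableSet_floor_mulVec (Matrix.diagonal b) j
    simpa only [Matrix.mulVec_diagonal] using this
  rw [← tsum_setLIntegral_fiber hN, ← (Equiv.neg (Fin d → ℤ)).tsum_eq]
  refine tsum_congr fun n => ?_
  rw [← lintegral_indicator (measurableSet_latticeCell hb), ← lintegral_indicator (hN n),
    ← lintegral_sub_right_eq_self ({s | (fun i => ⌊b i * s i⌋) = n}.indicator G)
      (diagInv b *ᵥ fun j => (((-n) j : ℤ) : ℝ))]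
  refine lintegral_congr fun s => ?_
  have key : s ∈ latticeCell b ↔
      s - (diagInv b *ᵥ fun j => (((-n) j : ℤ) : ℝ)) ∈ {s | (fun i => ⌊b i * s i⌋) = n} := by
    simp only [latticeCell, Set.mem_ofPred_eq, funext_iff, diagInv_mulVec]
    refine forall_congr' fun i => ?_
    rw [Pi.sub_apply, mul_sub, mul_div_cancel₀ _ (hb i).ne', Int.floor_sub_intCast]
    simp
  by_cases h : s ∈ latticeCell b
  · rw [Set.indicator_of_mem h, Set.indicator_of_mem (key.1 h)]; rfl
  · rw [Set.indicator_of_notMem h, Set.indicator_of_notMem (mt key.2 h)]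

theorem inner_modulation_indicator {d : ℕ} {C : Matrix (Fin d) (Fin d) ℝ} {K : Set (Fin d → ℝ)}
    (hK : MeasurableSet K) (hK' : volume K ≠ ∞) (g : L2R d) (t ξ : Fin d → ℝ) :
    inner ℂ (modulation (C *ᵥ ξ) (translation t g)) (indicatorConstLp 2 hK hK' (1 : ℂ)) =
      ∫ s, Complex.exp (2 * Real.pi * Complex.I * (Cᵀ *ᵥ s ⬝ᵥ (-ξ) : ℝ)) *
        K.indicator (fun s => starRingEnd ℂ (g (s - t))) s := by
  rw [L2.inner_def]
  refine integral_congr_ae ?_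
  filter_upwards [coeFn_modulation (C *ᵥ ξ) (translation t g), coeFn_translation t g,
    indicatorConstLp_coeFn (p := 2) (hs := hK) (hμs := hK') (c := (1 : ℂ))] with s h1 h2 h3
  have e : Cᵀ *ᵥ s ⬝ᵥ (-ξ) = -(s ⬝ᵥ (C *ᵥ ξ)) := by
    rw [Matrix.mulVec_transpose, dotProduct_neg, Matrix.dotProduct_mulVec]
  rw [h1, h2, h3, RCLike.inner_apply, map_mul, star_expChar, e]
  by_cases hs : s ∈ K
  · simp [hs]
  · simp [hs]

/-- The set `Cᵀ K` lies in one unit cube, so the modulations by `C ℤ^d` act on `K` as exponentials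
of a single period cell and Parseval applies to `conj g(· - t)` on `K`. -/
theorem tsum_enorm_inner_modulation_indicator {d : ℕ} {C : Matrix (Fin d) (Fin d) ℝ}
    (hC : C.det ≠ 0) {K : Set (Fin d → ℝ)} (hK : MeasurableSet K) (hK' : volume K ≠ ∞)
    (c : Fin d → ℤ) (hKc : ∀ s ∈ K, (fun i => ⌊(Cᵀ *ᵥ s) i⌋) = c) (g : L2R d) (t : Fin d → ℝ) :
    ∑' k : Fin d → ℤ, ‖inner ℂ (modulation (C *ᵥ fun j => (k j : ℝ)) (translation t g))
      (indicatorConstLp 2 hK hK' (1 : ℂ))‖ₑ ^ 2 =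
      ENNReal.ofReal |C.det⁻¹| * ∫⁻ s in K, ‖g (s - t)‖ₑ ^ 2 := by
  have hgt : AEStronglyMeasurable (fun s => g (s - t)) volume :=
    (Lp.aestronglyMeasurable g).comp_measurePreserving (measurePreserving_sub_right volume t)
  have hm : AEStronglyMeasurable (K.indicator fun s => starRingEnd ℂ (g (s - t))) volume :=
    (RCLike.continuous_conj.comp_aestronglyMeasurable hgt).indicator hK
  have hn : ∀ s, ‖K.indicator (fun s => starRingEnd ℂ (g (s - t))) s‖ₑ ^ 2 =
      K.indicator (fun s => ‖g (s - t)‖ₑ ^ 2) s := fun s => by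
    by_cases hs : s ∈ K <;> simp [hs]
  have hL : ∫⁻ s, ‖K.indicator (fun s => starRingEnd ℂ (g (s - t))) s‖ₑ ^ 2 =
      ∫⁻ s in K, ‖g (s - t)‖ₑ ^ 2 := by
    simp only [hn]
    rw [lintegral_indicator hK]
  have hfin : ∫⁻ s in K, ‖g (s - t)‖ₑ ^ 2 < ∞ := by
    refine (setLIntegral_le_lintegral _ _).trans_lt ?_
    rw [lintegral_sub_right_eq_self (fun s => ‖g s‖ₑ ^ 2)]
    exact (Lp.memLp g).lintegral_sq_lt_top
  have h := tsum_enorm_integral_expChar_mul (P := Cᵀ) (by rwa [Matrix.det_transpose]) hm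
    (by rwa [hL]) (fun i => (c i : ℝ)) fun s hs i => by
      have hsK : s ∈ K := Set.mem_of_indicator_ne_zero hs
      have := Int.floor_eq_iff.1 (congrFun (hKc s hsK) i)
      exact ⟨this.1, this.2.le⟩
  rw [hL, Matrix.det_transpose] at h
  rw [← h, ← (Equiv.neg (Fin d → ℤ)).tsum_eq]
  refine tsum_congr fun k => ?_
  rw [inner_modulation_indicator]
  have e : -(fun j => (((Equiv.neg (Fin d → ℤ)) k j : ℤ) : ℝ)) = fun j => (k j : ℝ) := by
    ext j; simp
  rw [e]

/-- The space is cut into sets `Q j` that `Cᵀ` sends into unit cubes. The frame identity on the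
indicator of `Q j ∩ latticeCell b` expresses its volume as `|det C|⁻¹ ∑_n ∫ |g(s - A n)|²`; summing
over `j` fills the cell, and the translates over `n` then reassemble `‖g‖²`. -/
theorem enorm_sq_eq_of_gabor {d : ℕ} {b : Fin d → ℝ} (hb : ∀ j, 0 < b j)
    {C : Matrix (Fin d) (Fin d) ℝ} (hC : C.det ≠ 0) (g : L2R d)
    (hg : ∀ ψ : L2R d, ∑' (n : Fin d → ℤ) (k : Fin d → ℤ),
      ‖inner ℂ (modulation (C *ᵥ fun j => (k j : ℝ))
        (translation (diagInv b *ᵥ fun j => (n j : ℝ)) g)) ψ‖ₑ ^ 2 = ‖ψ‖ₑ ^ 2) :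
    ‖g‖ₑ ^ 2 = ENNReal.ofReal |C.det| * ENNReal.ofReal (diagInv b).det := by
  have hcell := measurableSet_latticeCell hb
  have hvol : volume (latticeCell b) ≠ ∞ := by
    rw [volume_latticeCell hb]; exact ENNReal.ofReal_ne_top
  set Q : (Fin d → ℤ) → Set (Fin d → ℝ) := fun j => {s | (fun i => ⌊(Cᵀ *ᵥ s) i⌋) = j} with hQ
  have hQm : ∀ j, MeasurableSet (Q j) := measurableSet_floor_mulVec Cᵀ
  have hK : ∀ j, MeasurableSet (Q j ∩ latticeCell b) := fun j => (hQm j).inter hcell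
  have hK' : ∀ j, volume (Q j ∩ latticeCell b) ≠ ∞ := fun j =>
    measure_ne_top_of_subset Set.inter_subset_right hvol
  have h1 : ∀ j, ∑' n : Fin d → ℤ, ENNReal.ofReal |C.det⁻¹| *
      ∫⁻ s in Q j ∩ latticeCell b, ‖g (s - diagInv b *ᵥ fun j => (n j : ℝ))‖ₑ ^ 2 =
      volume (Q j ∩ latticeCell b) := fun j => by
    have h2 := hg (indicatorConstLp 2 (hK j) (hK' j) (1 : ℂ))
    rw [enorm_Lp_two_sq] at h2
    have h3 : ∫⁻ s, ‖indicatorConstLp 2 (hK j) (hK' j) (1 : ℂ) s‖ₑ ^ 2 =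
        volume (Q j ∩ latticeCell b) := by
      rw [← lintegral_indicator_one (hK j)]
      refine lintegral_congr_ae ?_
      filter_upwards [indicatorConstLp_coeFn (p := 2) (hs := hK j) (hμs := hK' j) (c := (1 : ℂ))]
        with s hs
      rw [hs]
      by_cases h : s ∈ Q j ∩ latticeCell b
      · simp only [Set.indicator_of_mem h, enorm_one, one_pow, Pi.one_apply]
      · simp only [Set.indicator_of_notMem h, enorm_zero, ne_eq, OfNat.ofNat_ne_zero,
          not_false_eq_true, zero_pow]
    rw [h3] at h2
    rw [← h2]
    refine tsum_congr fun n => ?_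
    rw [tsum_enorm_inner_modulation_indicator hC (hK j) (hK' j) j fun s hs => hs.1]
  have h4 : ∀ f : (Fin d → ℝ) → ℝ≥0∞,
      ∑' j, ∫⁻ s in Q j ∩ latticeCell b, f s = ∫⁻ s in latticeCell b, f s := fun f => by
    rw [← tsum_setLIntegral_fiber hQm]
    refine tsum_congr fun j => ?_
    rw [Measure.restrict_restrict (hQm j)]
  have h5 : ENNReal.ofReal |C.det⁻¹| * ‖g‖ₑ ^ 2 = ENNReal.ofReal (diagInv b).det := by
    rw [← volume_latticeCell hb, ← setLIntegral_one, ← h4, enorm_Lp_two_sq,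
      ← tsum_setLIntegral_translate hb]
    simp only [setLIntegral_one, ← h1]
    rw [ENNReal.tsum_comm, ← ENNReal.tsum_mul_left]
    refine tsum_congr fun n => ?_
    rw [ENNReal.tsum_mul_left, h4]
  rw [← h5, ← mul_assoc, ← ENNReal.ofReal_mul (abs_nonneg _), ← abs_mul, mul_inv_cancel₀ hC,
    abs_one, ENNReal.ofReal_one, one_mul]

theorem modulation_zero {d : ℕ} (g : L2R d) : modulation 0 g = g := by
  refine Lp.ext ?_
  filter_upwards [coeFn_modulation 0 g] with s hs
  rw [hs]; simp

theorem translation_zero {d : ℕ} (g : L2R d) : translation 0 g = g := by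
  refine Lp.ext ?_
  filter_upwards [coeFn_translation 0 g] with s hs
  rw [hs]; simp

/-- A member of a Parseval frame has norm at most `1`, and the squared norm of the window is the
determinant. -/
theorem abs_det_mul_le_one_of_gabor {d : ℕ} {b : Fin d → ℝ} (hb : ∀ j, 0 < b j)
    {C : Matrix (Fin d) (Fin d) ℝ} (hC : C.det ≠ 0) (g : L2R d)
    (hg : ∀ ψ : L2R d, ∑' (n : Fin d → ℤ) (k : Fin d → ℤ),
      ‖inner ℂ (modulation (C *ᵥ fun j => (k j : ℝ))
        (translation (diagInv b *ᵥ fun j => (n j : ℝ)) g)) ψ‖ₑ ^ 2 = ‖ψ‖ₑ ^ 2) :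
    |(diagInv b * C).det| ≤ 1 := by
  have h1 := enorm_sq_eq_of_gabor hb hC g hg
  have hdet : 0 < (diagInv b).det := by
    rw [diagInv, Matrix.det_diagonal]
    exact Finset.prod_pos fun i _ => one_div_pos.2 (hb i)
  have h2 : ‖inner ℂ g g‖ₑ ^ 2 ≤ ‖g‖ₑ ^ 2 := by
    rw [← hg g]
    -- Only the term `n = k = 0`, which is `g` itself, is kept.
    refine le_trans ?_ (ENNReal.le_tsum 0)
    refine le_trans (le_of_eq ?_) (ENNReal.le_tsum 0)
    simp [← Pi.zero_def, Matrix.mulVec_zero, modulation_zero, translation_zero]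
  have h3 : ‖inner ℂ g g‖ = ‖g‖ ^ 2 := by
    rw [inner_self_eq_norm_sq_to_K]; simp
  have h4 : ‖g‖ ^ 2 = |(diagInv b * C).det| := by
    rw [← ofReal_norm, ← ENNReal.ofReal_pow (norm_nonneg _), ← ENNReal.ofReal_mul (abs_nonneg _),
      ENNReal.ofReal_eq_ofReal_iff (by positivity) (by positivity)] at h1
    rw [h1, Matrix.det_mul, abs_mul, abs_of_pos hdet, mul_comm]
  rw [← ofReal_norm, ← ofReal_norm, ← ENNReal.ofReal_pow (norm_nonneg _),
    ← ENNReal.ofReal_pow (norm_nonneg _), ENNReal.ofReal_le_ofReal_iff (by positivity), h3] at h2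
  rw [← h4]
  -- With `x = ‖g‖²`, the inequality `x² ≤ x` gives `x ≤ 1`.
  nlinarith [sq_nonneg (‖g‖ ^ 2), sq_nonneg ‖g‖]

end

/-! ### Parametrization of the quasi-lattices and summation over the centre -/

section

/-- The upper bound is a closed condition for each finite partial sum. The lower bound needs it
first: applied to `v n - w`, it makes the error in Minkowski's inequality in `ℓ²` tend to zero. -/
theorem tsum_enorm_inner_sq_of_dense {ι E : Type*} [NormedAddCommGroup E] [InnerProductSpace ℂ E]
    {f : ι → E} {W : Set E} (hW : Dense W)
    (h : ∀ w ∈ W, ∑' i, ‖inner ℂ (f i) w‖ₑ ^ 2 = ‖w‖ₑ ^ 2) (w : E) :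
    ∑' i, ‖inner ℂ (f i) w‖ₑ ^ 2 = ‖w‖ₑ ^ 2 := by
  have hle : ∀ w, ∑' i, ‖inner ℂ (f i) w‖ₑ ^ 2 ≤ ‖w‖ₑ ^ 2 := fun w => by
    rw [ENNReal.tsum_eq_iSup_sum]
    refine iSup_le fun s => ?_
    have hcl : IsClosed {w : E | ∑ i ∈ s, ‖inner ℂ (f i) w‖ₑ ^ 2 ≤ ‖w‖ₑ ^ 2} := by
      refine isClosed_le (continuous_finsetSum _ fun i _ => ?_) ?_
      · exact (ENNReal.continuous_pow 2).comp
          (continuous_enorm.comp (continuous_const.inner continuous_id))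
      · exact (ENNReal.continuous_pow 2).comp continuous_enorm
    exact closure_minimal (fun w hw => (ENNReal.sum_le_tsum s).trans (h w hw).le) hcl (hW w)
  refine le_antisymm (hle w) ?_
  -- With the counting measure, the `ℓ²` norm becomes an `eLpNorm`, and Minkowski is
  -- `eLpNorm_add_le`.
  let _ : MeasurableSpace ι := ⊤
  have hm : ∀ w : E, AEStronglyMeasurable (fun i => inner ℂ (f i) w) (Measure.count : Measure ι) :=
    fun w => (measurable_from_top (f := fun i => inner ℂ (f i) w)).aestronglyMeasurable
  have hN : ∀ w : E, eLpNorm (fun i => inner ℂ (f i) w) 2 (Measure.count : Measure ι) ^ 2 =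
      ∑' i, ‖inner ℂ (f i) w‖ₑ ^ 2 := fun w => by
    rw [eLpNorm_two_sq, lintegral_count]
  have hpow : ∀ x y : ℝ≥0∞, x ^ 2 ≤ y ^ 2 → x ≤ y := fun x y hxy =>
    (ENNReal.pow_le_pow_left_iff two_ne_zero).1 hxy
  obtain ⟨v, hvW, hv⟩ := mem_closure_iff_seq_limit.1 (hW w)
  rw [← hN]
  gcongr
  have hb : ∀ n, ‖v n‖ₑ ≤ eLpNorm (fun i => inner ℂ (f i) w) 2 (Measure.count : Measure ι) +
      ‖v n - w‖ₑ := fun n => by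
    have h1 : ‖v n‖ₑ ≤ eLpNorm (fun i => inner ℂ (f i) (v n)) 2 (Measure.count : Measure ι) :=
      hpow _ _ (by rw [hN, h _ (hvW n)])
    have h2 : eLpNorm (fun i => inner ℂ (f i) (v n - w)) 2 (Measure.count : Measure ι) ≤
        ‖v n - w‖ₑ := hpow _ _ (by rw [hN]; exact hle _)
    refine h1.trans (le_trans ?_ (add_le_add_right h2 _))
    refine le_trans (le_of_eq ?_) (eLpNorm_add_le (hm w) (hm (v n - w)) one_le_two)
    congr 1
    funext i
    rw [Pi.add_apply, ← inner_add_right, add_sub_cancel]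
  have h3 : Tendsto (fun n => eLpNorm (fun i => inner ℂ (f i) w) 2 (Measure.count : Measure ι) +
      ‖v n - w‖ₑ) atTop
      (𝓝 (eLpNorm (fun i => inner ℂ (f i) w) 2 (Measure.count : Measure ι) + 0)) := by
    refine tendsto_const_nhds.add ?_
    have := (continuous_enorm (E := E)).continuousAt.tendsto.comp (hv.sub_const w)
    rw [sub_self, enorm_zero] at this
    exact this
  rw [add_zero] at h3
  exact le_of_tendsto_of_tendsto' (continuous_enorm.continuousAt.tendsto.comp hv) h3 hb

namespace AdmissibleBasis

variable {𝔫 : Type*} [LieRing 𝔫] [LieAlgebra ℝ 𝔫] {r d : ℕ}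

theorem eq_of_intCast_div_eq {n : ℕ} {c : Fin n → ℝ} {k k' : Fin n → ℤ} (hc : ∀ j, 0 < c j)
    (h : (fun j => (k j : ℝ) / c j) = fun j => (k' j : ℝ) / c j) : k = k' := by
  ext j
  have h1 : (k j : ℝ) / c j = k' j / c j := congrFun h j
  rw [div_left_inj' (hc j).ne'] at h1
  exact_mod_cast h1

/-- The parametrization of the quasi-lattice by `ℤ^r × ℤ^d × ℤ^d`. -/
def quasiLatticeEquiv (D : AdmissibleBasis 𝔫 r d) {a : Fin r → ℝ} {q b : Fin d → ℝ}
    (ha : ∀ k, 0 < a k) (hq : ∀ j, 0 < q j) (hb : ∀ j, 0 < b j) :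
    (Fin r → ℤ) × (Fin d → ℤ) × (Fin d → ℤ) ≃ D.quasiLattice a q b :=
  Equiv.ofBijective (fun p => ⟨NilGroup.point D (fun j => p.1 j / a j, fun j => p.2.1 j / q j,
    fun j => p.2.2 j / b j), p.1, p.2.1, p.2.2, rfl⟩) <| by
    refine ⟨fun p p' h => ?_, ?_⟩
    · have h1 := (NilGroup.coords D).symm.injective (Subtype.ext_iff.1 h)
      simp only [Prod.mk.injEq] at h1
      exact Prod.ext (eq_of_intCast_div_eq ha h1.1)
        (Prod.ext (eq_of_intCast_div_eq hq h1.2.1) (eq_of_intCast_div_eq hb h1.2.2))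
    · rintro ⟨g, m, k, n, rfl⟩
      exact ⟨(m, k, n), rfl⟩

/-- The point of the reduced quasi-lattice with the given indices. -/
def reducedPoint (D : AdmissibleBasis 𝔫 r d) (q b : Fin d → ℝ)
    (p : (Fin d → ℤ) × (Fin d → ℤ)) : NilGroup D :=
  NilGroup.point D (0, fun j => p.1 j / q j, fun j => p.2 j / b j)

theorem reducedPoint_eq (D : AdmissibleBasis 𝔫 r d) (q b : Fin d → ℝ)
    (p : (Fin d → ℤ) × (Fin d → ℤ)) : D.reducedPoint q b p =
      NilGroup.exp (D.vY fun j => p.1 j / q j) * NilGroup.exp (D.vX fun j => p.2 j / b j) := by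
  have h : (NilGroup.exp (D.vZ 0) : NilGroup D) = 1 := by
    ext; simp
  rw [reducedPoint, NilGroup.point, h, one_mul]

/-- The parametrization of the reduced quasi-lattice by `ℤ^d × ℤ^d`. -/
def reducedQuasiLatticeEquiv (D : AdmissibleBasis 𝔫 r d) {q b : Fin d → ℝ}
    (hq : ∀ j, 0 < q j) (hb : ∀ j, 0 < b j) :
    (Fin d → ℤ) × (Fin d → ℤ) ≃ D.reducedQuasiLattice q b :=
  Equiv.ofBijective (fun p => ⟨D.reducedPoint q b p, p.1, p.2, D.reducedPoint_eq q b p⟩) <| by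
    refine ⟨fun p p' h => ?_, ?_⟩
    · have h1 := (NilGroup.coords D).symm.injective (Subtype.ext_iff.1 h)
      simp only [Prod.mk.injEq] at h1
      exact Prod.ext (eq_of_intCast_div_eq hq h1.2.1) (eq_of_intCast_div_eq hb h1.2.2)
    · rintro ⟨g, k, n, rfl⟩
      exact ⟨(k, n), Subtype.ext (D.reducedPoint_eq q b (k, n))⟩

theorem rep_point (D : AdmissibleBasis 𝔫 r d) (l : Fin r → ℝ)
    (p : (Fin r → ℝ) × (Fin d → ℝ) × (Fin d → ℝ)) (v : L2R d) :
    D.rep l (NilGroup.point D p) v = Complex.exp (2 * Real.pi * Complex.I * (l ⬝ᵥ p.1 : ℝ)) •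
      modulation (D.B l *ᵥ p.2.1) (translation p.2.2 v) :=
  D.rep_coordsMeas_symm l p v

theorem rep_reducedPoint (D : AdmissibleBasis 𝔫 r d) (l : Fin r → ℝ) (q b : Fin d → ℝ)
    (p : (Fin d → ℤ) × (Fin d → ℤ)) (v : L2R d) :
    D.rep l (D.reducedPoint q b p) v =
      modulation ((D.B l * diagInv q) *ᵥ fun j => (p.1 j : ℝ))
        (translation (diagInv b *ᵥ fun j => (p.2 j : ℝ)) v) := by
  rw [reducedPoint, rep_point, dotProduct_zero, ← Matrix.mulVec_mulVec, diagInv_mulVec,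
    diagInv_mulVec]
  simp

/-- The centre acts by scalars, in the form of the exponentials of `tsum_enorm_integral_expChar_mul`
with `P = diagInv a`. -/
theorem rep_quasiLatticeEquiv (D : AdmissibleBasis 𝔫 r d) {a : Fin r → ℝ} {q b : Fin d → ℝ}
    (ha : ∀ k, 0 < a k) (hq : ∀ j, 0 < q j) (hb : ∀ j, 0 < b j) (l : Fin r → ℝ)
    (p : (Fin r → ℤ) × (Fin d → ℤ) × (Fin d → ℤ)) (v : L2R d) :
    D.rep l (D.quasiLatticeEquiv ha hq hb p) v =
      Complex.exp (2 * Real.pi * Complex.I * (diagInv a *ᵥ l ⬝ᵥ (fun j => (p.1 j : ℝ)) : ℝ)) •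
        D.rep l (D.reducedPoint q b p.2) v := by
  have h1 : diagInv a *ᵥ l ⬝ᵥ (fun j => (p.1 j : ℝ)) = l ⬝ᵥ fun j => (p.1 j : ℝ) / a j := by
    rw [diagInv_mulVec]
    exact Finset.sum_congr rfl fun j _ => by ring
  have h2 : (D.quasiLatticeEquiv ha hq hb p : NilGroup D) = NilGroup.point D
    (fun j => p.1 j / a j, fun j => p.2.1 j / q j, fun j => p.2.2 j / b j) := rfl
  rw [h1, h2, reducedPoint, rep_point, rep_point, dotProduct_zero]
  simp

variable {D : AdmissibleBasis 𝔫 r d} {a : Fin r → ℝ} {E : Set (Fin r → ℝ)}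

theorem exists_bound_det (D : AdmissibleBasis 𝔫 r d) (a : Fin r → ℝ) :
    ∃ M : ℝ, ∀ l ∈ Set.Icc 0 a, |(D.B l).det| ≤ M := by
  obtain ⟨M, hM⟩ := (isCompact_Icc (a := 0) (b := a)).exists_bound_of_continuousOn
    D.continuous_B.matrix_det.continuousOn
  exact ⟨M, hM⟩

theorem plancherelMeasure_lt_top (hE : MeasurableSet E) (hEs : E ⊆ D.crossSection)
    (hEa : E ⊆ Set.Icc 0 a) : D.plancherelMeasure E < ∞ := by
  obtain ⟨M, hM⟩ := D.exists_bound_det a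
  rw [← Measure.restrict_apply_univ, D.restrict_plancherelMeasure hE hEs,
    withDensity_apply _ MeasurableSet.univ, Measure.restrict_univ]
  refine (setLIntegral_mono' (g := fun _ => ENNReal.ofReal M) hE fun l hl =>
    ENNReal.ofReal_le_ofReal (hM l (hEa hl))).trans_lt ?_
  rw [setLIntegral_const]
  exact ENNReal.mul_lt_top ENNReal.ofReal_lt_top
    ((measure_mono hEa).trans_lt isCompact_Icc.measure_lt_top)

/-- Parseval on the box `∏ [0, a_k]` applied to `|det B| G`: the density of `μ` is squared, one
factor goes back into `dμ` and one stays in the integrand. The constant `∏ a_k` is the volume of the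
box. -/
theorem tsum_enorm_integral_plancherelMeasure (ha : ∀ k, 0 < a k) (hE : MeasurableSet E)
    (hEs : E ⊆ D.crossSection) (hEa : E ⊆ Set.Icc 0 a) {G : (Fin r → ℝ) → ℂ}
    (hG : AEStronglyMeasurable G (D.plancherelMeasure.restrict E))
    (hG2 : ∫⁻ l in E, ‖G l‖ₑ ^ 2 ∂D.plancherelMeasure < ∞) :
    ∑' m : Fin r → ℤ, ‖∫ l in E, Complex.exp (2 * Real.pi * Complex.I *
      (diagInv a *ᵥ l ⬝ᵥ (fun j => (m j : ℝ)) : ℝ)) * G l ∂D.plancherelMeasure‖ₑ ^ 2 =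
    ENNReal.ofReal (∏ k, a k) *
      ∫⁻ l in E, ENNReal.ofReal |(D.B l).det| * ‖G l‖ₑ ^ 2 ∂D.plancherelMeasure := by
  set h : (Fin r → ℝ) → ℂ := E.indicator fun l => |(D.B l).det| • G l with hh
  have hdet := D.measurable_abs_det
  have hr := D.restrict_plancherelMeasure hE hEs
  have hcont : Continuous fun l => |(D.B l).det| := D.continuous_B.matrix_det.abs
  have hm : AEStronglyMeasurable h volume := by
    rw [hh, aestronglyMeasurable_indicator_iff hE]
    refine ⟨fun l => |(D.B l).det| • hG.mk G l,
      hcont.stronglyMeasurable.smul hG.stronglyMeasurable_mk, ?_⟩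
    have h1 := hG.ae_eq_mk
    generalize hG.mk G = G' at h1 ⊢
    rw [hr, EventuallyEq, ae_withDensity_iff hdet] at h1
    filter_upwards [h1] with l hl
    -- `G` agrees with its measurable version only `μ`-almost everywhere, which says nothing where
    -- `det B = 0`; there the factor `|det B|` annihilates both.
    by_cases h0 : |(D.B l).det| = 0
    · rw [h0, zero_smul, zero_smul]
    · rw [← hl]
      rw [ne_eq, ENNReal.ofReal_eq_zero, not_le]
      exact lt_of_le_of_ne (abs_nonneg _) (Ne.symm h0)
  have hgm : AEMeasurable (fun l => ENNReal.ofReal |(D.B l).det| * ‖G l‖ₑ ^ 2)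
      (D.plancherelMeasure.restrict E) :=
    hdet.aemeasurable.mul (hG.enorm.pow_const 2)
  have hn : ∫⁻ l, ‖h l‖ₑ ^ 2 =
      ∫⁻ l in E, ENNReal.ofReal |(D.B l).det| * ‖G l‖ₑ ^ 2 ∂D.plancherelMeasure := by
    have e : ∀ l, ‖h l‖ₑ ^ 2 = E.indicator (fun l => ENNReal.ofReal |(D.B l).det| *
        (ENNReal.ofReal |(D.B l).det| * ‖G l‖ₑ ^ 2)) l := fun l => by
      by_cases hl : l ∈ E
      · rw [hh, Set.indicator_of_mem hl, Set.indicator_of_mem hl, enorm_smul, mul_pow,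
          Real.enorm_eq_ofReal (abs_nonneg _), sq (ENNReal.ofReal _), mul_assoc]
      · simp [hh, hl]
    simp only [e]
    rw [hr] at hgm ⊢
    rw [lintegral_indicator hE, lintegral_withDensity_eq_lintegral_mul₀' hdet.aemeasurable hgm]
    rfl
  have hL : ∫⁻ l, ‖h l‖ₑ ^ 2 < ∞ := by
    obtain ⟨M, hM⟩ := D.exists_bound_det a
    rw [hn]
    refine (setLIntegral_mono' (g := fun l => ENNReal.ofReal M * ‖G l‖ₑ ^ 2) hE
      fun l hl => ?_).trans_lt ?_
    · gcongr
      exact hM l (hEa hl)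
    · rw [lintegral_const_mul' _ _ ENNReal.ofReal_ne_top]
      exact ENNReal.mul_lt_top ENNReal.ofReal_lt_top hG2
  have hda : (diagInv a).det = (∏ k, a k)⁻¹ := by
    rw [diagInv, Matrix.det_diagonal]; simp
  have hap : 0 < ∏ k, a k := Finset.prod_pos fun k _ => ha k
  have key := tsum_enorm_integral_expChar_mul (P := diagInv a) (by rw [hda]; positivity) hm hL 0
    fun l hl i => by
      have hlE := hEa (Set.mem_of_indicator_ne_zero hl)
      have h1 := hlE.1 i
      have h2 := hlE.2 i
      rw [diagInv_mulVec]
      refine ⟨div_nonneg h1 (ha i).le, ?_⟩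
      rw [Pi.zero_apply, zero_add]
      exact (div_le_one (ha i)).2 h2
  rw [hn, hda, inv_inv, abs_of_pos hap] at key
  rw [← key]
  refine tsum_congr fun m => ?_
  rw [D.integral_restrict_plancherelMeasure hE hEs, ← integral_indicator hE]
  congr 2
  refine integral_congr_ae (Eventually.of_forall fun l => ?_)
  by_cases hl : l ∈ E
  · simp only [hh, Set.indicator_of_mem hl, mul_smul_comm]
  · simp only [hh, Set.indicator_of_notMem hl, mul_zero]

end AdmissibleBasis

end

/-! ### The frame identity on almost every fibre -/

section

namespace AdmissibleBasis

variable {𝔫 : Type*} [LieRing 𝔫] [LieAlgebra ℝ 𝔫] {r d : ℕ} {D : AdmissibleBasis 𝔫 r d}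
  {a : Fin r → ℝ} {q b : Fin d → ℝ} {E I : Set (Fin r → ℝ)} {u : L2R d}
  {φ : Lp ℂ 2 (NilGroup.haar D)} {T : (Fin r → ℝ) → (L2R d →L[ℂ] L2R d)}

/-- Each lattice point is a central one times a reduced one; for every reduced point, the sum over
the central indices is evaluated by `tsum_enorm_integral_plancherelMeasure`. -/
theorem tsum_enorm_inner_leftRegular (ha : ∀ k, 0 < a k) (hq : ∀ j, 0 < q j) (hb : ∀ j, 0 < b j)
    (hE : MeasurableSet E) (hEs : E ⊆ D.crossSection) (hEa : E ⊆ Set.Icc 0 a)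
    (hT : D.IsPlancherelTransform φ T) {ψ : Lp ℂ 2 (NilGroup.haar D)} {w : L2R d}
    (hψ : ∀ f : Lp ℂ 2 (NilGroup.haar D), Integrable f (NilGroup.haar D) →
      inner ℂ f ψ = ∫ l in E, inner ℂ (D.groupFourier f l u) w ∂D.plancherelMeasure) :
    ∑' γ : D.quasiLattice a q b, ‖inner ℂ (NilGroup.leftRegular (γ : NilGroup D) φ) ψ‖ₑ ^ 2 =
      ∫⁻ l in E, ∑' p : (Fin d → ℤ) × (Fin d → ℤ), ENNReal.ofReal ((∏ k, a k) * |(D.B l).det|) *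
        ‖inner ℂ (D.rep l (D.reducedPoint q b p) (T l u)) w‖ₑ ^ 2 ∂D.plancherelMeasure := by
  have hEf := plancherelMeasure_lt_top hE hEs hEa
  have hTm : AEStronglyMeasurable (fun l => T l u) (D.plancherelMeasure.restrict E) :=
    (aestronglyMeasurable_of_forall_inner fun w => hT.1 u w).restrict
  have hGm : ∀ p, AEStronglyMeasurable
      (fun l => inner ℂ (D.rep l (D.reducedPoint q b p) (T l u)) w)
      (D.plancherelMeasure.restrict E) := fun p =>
    (aestronglyMeasurable_rep_apply hTm _).inner aestronglyMeasurable_const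
  have hG2 : ∀ p, ∫⁻ l in E, ‖inner ℂ (D.rep l (D.reducedPoint q b p) (T l u)) w‖ₑ ^ 2
      ∂D.plancherelMeasure < ∞ := fun p => by
    have hp : ∀ l, ‖inner ℂ (D.rep l (D.reducedPoint q b p) (T l u)) w‖ₑ ^ 2 ≤
        (‖u‖ₑ ^ 2 * ‖w‖ₑ ^ 2) * hsNormSq (T l) := fun l => by
      have h1 : ‖inner ℂ (D.rep l (D.reducedPoint q b p) (T l u)) w‖ₑ ≤ ‖T l u‖ₑ * ‖w‖ₑ := by
        rw [← ofReal_norm, ← ofReal_norm, ← ofReal_norm, ← ENNReal.ofReal_mul (norm_nonneg _)]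
        refine ENNReal.ofReal_le_ofReal ((norm_inner_le_norm _ _).trans (le_of_eq ?_))
        rw [norm_rep]
      calc _ ≤ (‖T l u‖ₑ * ‖w‖ₑ) ^ 2 := by gcongr
        _ = ‖T l u‖ₑ ^ 2 * ‖w‖ₑ ^ 2 := mul_pow _ _ _
        _ ≤ (hsNormSq (T l) * ‖u‖ₑ ^ 2) * ‖w‖ₑ ^ 2 := by
          gcongr
          exact enorm_apply_sq_le_hsNormSq (T l) u
        _ = _ := by ring
    refine ((setLIntegral_le_lintegral _ _).trans (lintegral_mono hp)).trans_lt ?_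
    rw [lintegral_const_mul' _ _ (ENNReal.mul_ne_top (by simp) (by simp))]
    exact ENNReal.mul_lt_top (ENNReal.mul_lt_top (by simp) (by simp)) hT.lintegral_hsNormSq_lt_top
  have hap : 0 ≤ ∏ k, a k := (Finset.prod_pos fun k _ => ha k).le
  rw [lintegral_tsum fun p => ?_, ← (D.quasiLatticeEquiv ha hq hb).tsum_eq, ENNReal.tsum_prod',
    ENNReal.tsum_comm]
  · refine tsum_congr fun p => ?_
    simp only [ENNReal.ofReal_mul hap, mul_assoc]
    -- The inner product is conjugate linear in its first slot, so the central character appears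
    -- inverted; `m ↦ -m` compensates.
    rw [lintegral_const_mul' _ _ ENNReal.ofReal_ne_top,
      ← tsum_enorm_integral_plancherelMeasure ha hE hEs hEa (hGm p) (hG2 p),
      ← (Equiv.neg (Fin r → ℤ)).tsum_eq]
    refine tsum_congr fun m => ?_
    rw [hT.inner_leftRegular hEf hψ]
    congr 2
    refine integral_congr_ae (Eventually.of_forall fun l => ?_)
    have e : (diagInv a *ᵥ l ⬝ᵥ fun j => (((Equiv.neg (Fin r → ℤ)) m j : ℤ) : ℝ)) =
        -(diagInv a *ᵥ l ⬝ᵥ fun j => (m j : ℝ)) := by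
      rw [← dotProduct_neg]
      congr 1
      ext j; simp
    simp only [rep_quasiLatticeEquiv, inner_smul_left, star_expChar, e, neg_neg]
  · exact (ENNReal.measurable_ofReal.comp (measurable_const.mul
      D.continuous_B.matrix_det.abs.measurable)).aemeasurable.mul ((hGm p).enorm.pow_const 2)

/-- The frame identity for the `ψ` with transform `1_{s ∩ I} w ⊗ u` says that both sides have the
same integral over every measurable `s`, hence agree almost everywhere. -/
theorem ae_tsum_enorm_inner_rep (ha : ∀ k, 0 < a k) (hq : ∀ j, 0 < q j) (hb : ∀ j, 0 < b j)
    (hI : MeasurableSet I) (hIs : I ⊆ D.crossSection) (hIa : I ⊆ Set.Icc 0 a) (hu : ‖u‖ = 1)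
    (hframe : IsParsevalFrame (D.multFreeSpace I u)
      (fun γ : D.quasiLattice a q b => NilGroup.leftRegular (γ : NilGroup D) φ))
    (hT : D.IsPlancherelTransform φ T) (w : L2R d) :
    ∀ᵐ l ∂(D.plancherelMeasure.restrict I), ∑' p : (Fin d → ℤ) × (Fin d → ℤ),
      ENNReal.ofReal ((∏ k, a k) * |(D.B l).det|) *
        ‖inner ℂ (D.rep l (D.reducedPoint q b p) (T l u)) w‖ₑ ^ 2 = ‖w‖ₑ ^ 2 := by
  have : IsFiniteMeasure (D.plancherelMeasure.restrict I) :=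
    ⟨by rw [Measure.restrict_apply_univ]; exact plancherelMeasure_lt_top hI hIs hIa⟩
  have hTm : AEStronglyMeasurable (fun l => T l u) (D.plancherelMeasure.restrict I) :=
    (aestronglyMeasurable_of_forall_inner fun w => hT.1 u w).restrict
  refine ae_eq_of_forall_setLIntegral_eq_of_sigmaFinite₀ ?_ aemeasurable_const fun s hs _ => ?_
  · refine AEMeasurable.tsum fun p => ?_
    exact (ENNReal.measurable_ofReal.comp (measurable_const.mul
      D.continuous_B.matrix_det.abs.measurable)).aemeasurable.mul
      (((aestronglyMeasurable_rep_apply hTm _).inner aestronglyMeasurable_const).enorm.pow_const 2)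
  · rw [Measure.restrict_restrict hs]
    have hE : MeasurableSet (s ∩ I) := hs.inter hI
    have hEs : s ∩ I ⊆ D.crossSection := Set.inter_subset_right.trans hIs
    have hEa : s ∩ I ⊆ Set.Icc 0 a := Set.inter_subset_right.trans hIa
    obtain ⟨ψ, hψn, hψ, hψT⟩ := D.exists_plancherel_tensor w u hE hEs
      (plancherelMeasure_lt_top hE hEs hEa)
    have hmem : ψ ∈ D.multFreeSpace I u := by
      refine ⟨_, hψT, Eventually.of_forall fun l => ⟨fun hl => ?_, fun hl => ?_⟩⟩
      · by_cases hls : l ∈ s ∩ I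
        · exact ⟨w, by rw [Set.indicator_of_mem hls]⟩
        -- On `I` outside `s` the field is zero, which is still of the form `v ⊗ u`, with `v = 0`.
        · exact ⟨0, by rw [Set.indicator_of_notMem hls, tensor]; simp⟩
      · exact Set.indicator_of_notMem (fun h => hl h.2) _
    have h1 := (hasSum_sq_iff _ _).1 (hframe.2 ψ hmem)
    rw [tsum_enorm_inner_leftRegular ha hq hb hE hEs hEa hT hψ, hψn] at h1
    have hu' : ‖u‖ₑ = 1 := by rw [← ofReal_norm, hu, ENNReal.ofReal_one]
    rw [h1, hu', setLIntegral_const, one_pow, mul_one, mul_comm]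

/-- The exceptional null set in `ae_tsum_enorm_inner_rep` depends on `w`; a dense sequence of `w`
leaves a single null set, and `tsum_enorm_inner_sq_of_dense` reaches the other vectors. The scalar
is the square root of the weight found there. -/
theorem ae_isParsevalFrame_rep (ha : ∀ k, 0 < a k) (hq : ∀ j, 0 < q j) (hb : ∀ j, 0 < b j)
    (hI : MeasurableSet I) (hIs : I ⊆ D.crossSection) (hIa : I ⊆ Set.Icc 0 a) (hu : ‖u‖ = 1)
    (hframe : IsParsevalFrame (D.multFreeSpace I u)
      (fun γ : D.quasiLattice a q b => NilGroup.leftRegular (γ : NilGroup D) φ))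
    (hT : D.IsPlancherelTransform φ T) :
    ∀ᵐ l ∂(D.plancherelMeasure.restrict I), ∀ w : L2R d, ∑' p : (Fin d → ℤ) × (Fin d → ℤ),
      ‖inner ℂ (D.rep l (D.reducedPoint q b p)
        ((((∏ k, √(a k)) * √|(D.B l).det| : ℝ) : ℂ) • T l u)) w‖ₑ ^ 2 = ‖w‖ₑ ^ 2 := by
  have h1 := ae_all_iff.2 fun n : ℕ => ae_tsum_enorm_inner_rep ha hq hb hI hIs hIa hu hframe hT
    (TopologicalSpace.denseSeq (L2R d) n)
  filter_upwards [h1] with l hl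
  refine tsum_enorm_inner_sq_of_dense (TopologicalSpace.denseRange_denseSeq (L2R d)) ?_
  rintro _ ⟨n, rfl⟩
  rw [← hl n]
  refine tsum_congr fun p => ?_
  have e : ‖(((∏ k, √(a k)) * √|(D.B l).det| : ℝ) : ℂ)‖ₑ ^ 2 =
      ENNReal.ofReal ((∏ k, a k) * |(D.B l).det|) := by
    rw [← ofReal_norm, ← ENNReal.ofReal_pow (norm_nonneg _), Complex.norm_real, Real.norm_eq_abs,
      sq_abs, mul_pow, Real.sq_sqrt (abs_nonneg _), ← Finset.prod_pow,
      Finset.prod_congr rfl fun k _ => Real.sq_sqrt (ha k).le]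
  rw [map_smul, inner_smul_left, enorm_mul, mul_pow, RCLike.enorm_conj, e]

end AdmissibleBasis

end

end

/-! ### The Gabor frame and the determinant bound at almost every `λ` -/

theorem mainTheorem2 {𝔫 : Type*} [LieRing 𝔫] [LieAlgebra ℝ 𝔫] {r d : ℕ} (hd : 1 ≤ d)
    (D : AdmissibleBasis 𝔫 r d)
    (a : Fin r → ℝ) (q b : Fin d → ℝ)
    (ha : ∀ k, 0 < a k) (hq : ∀ j, 0 < q j) (hb : ∀ j, 0 < b j)
    (I : Set (Fin r → ℝ)) (hI_meas : MeasurableSet I)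
    (hI : I ⊆ {l | l ∈ D.crossSection ∧ ∀ k, 0 ≤ l k ∧ l k ≤ a k})
    (u : L2R d) (hu : ‖u‖ = 1)
    (φ : Lp ℂ 2 (NilGroup.haar D)) (hφ : φ ∈ D.multFreeSpace I u)
    (hframe : IsParsevalFrame (D.multFreeSpace I u)
      (fun γ : D.quasiLattice a q b => NilGroup.leftRegular (γ : NilGroup D) φ))
    (φhat : (Fin r → ℝ) → (L2R d →L[ℂ] L2R d)) (hφhat : D.IsPlancherelTransform φ φhat) :
    ∀ᵐ l ∂(D.plancherelMeasure.restrict I),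
      (∃ F : L2R d, φhat l = AdmissibleBasis.tensor F u ∧
        IsParsevalFrame Set.univ (fun γ : D.reducedQuasiLattice q b =>
          (((∏ k, √(a k)) * √|(D.B l).det| : ℝ) : ℂ) • D.rep l γ F) ∧
        Set.range (fun γ : D.reducedQuasiLattice q b =>
          (((∏ k, √(a k)) * √|(D.B l).det| : ℝ) : ℂ) • D.rep l γ F) =
          gaborSystem ((((∏ k, √(a k)) * √|(D.B l).det| : ℝ) : ℂ) • F)
            (diagInv b) (D.B l * diagInv q)) ∧
      |(diagInv b * D.B l * diagInv q).det| ≤ 1 := by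
  have hIs : I ⊆ D.crossSection := fun l hl => (hI hl).1
  have hIa : I ⊆ Set.Icc 0 a := fun l hl => ⟨fun k => ((hI hl).2 k).1, fun k => ((hI hl).2 k).2⟩
  -- `T` is the representative witnessing membership in the multiplicity-free space, `φhat` an
  -- arbitrary one; uniqueness transfers the rank-one form from `T` to `φhat`.
  obtain ⟨T, hT, hTI⟩ := hφ
  have hF := AdmissibleBasis.ae_isParsevalFrame_rep ha hq hb hI_meas hIs hIa hu hframe hφhat
  filter_upwards [hF, ae_restrict_of_ae (hT.ae_eq hφhat), ae_restrict_of_ae hTI,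
    ae_restrict_of_ae D.ae_det_ne_zero, ae_restrict_mem hI_meas] with l hl hTl hTIl hdet hlI
  set c : ℂ := (((∏ k, √(a k)) * √|(D.B l).det| : ℝ) : ℂ) with hc
  let e := D.reducedQuasiLatticeEquiv hq hb
  have he : ∀ p, (e p : NilGroup D) = D.reducedPoint q b p := fun _ => rfl
  -- Since `‖u‖ = 1`, evaluating `v ⊗ u` at `u` returns `v`; this identifies `F`.
  refine ⟨⟨φhat l u, ?_, ⟨fun _ => Set.mem_univ _, fun w _ => ?_⟩, ?_⟩, ?_⟩
  · obtain ⟨v, hv⟩ := hTIl.1 hlI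
    rw [← hTl, hv]
    congr 1
    simp [AdmissibleBasis.tensor, inner_self_eq_norm_sq_to_K, hu]
  · rw [hasSum_sq_iff, ← hl w, ← e.tsum_eq]
    simp only [he, map_smul]
  · ext f
    constructor
    · rintro ⟨γ, rfl⟩
      obtain ⟨p, rfl⟩ := e.surjective γ
      refine ⟨p.2, p.1, ?_⟩
      simp only
      rw [← AdmissibleBasis.rep_reducedPoint, map_smul, he]
    · rintro ⟨n, k, rfl⟩
      refine ⟨e (k, n), ?_⟩
      simp only
      rw [he, ← map_smul, AdmissibleBasis.rep_reducedPoint]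
  -- The modulation lattice is generated by `C = B(λ) D(q)`, invertible because `det B(λ) ≠ 0`
  -- almost everywhere for `μ`.
  · rw [Matrix.mul_assoc]
    refine abs_det_mul_le_one_of_gabor hb ?_ (c • φhat l u) fun ψ => ?_
    · rw [Matrix.det_mul, diagInv, Matrix.det_diagonal]
      exact mul_ne_zero hdet (Finset.prod_pos fun j _ => one_div_pos.2 (hq j)).ne'
    · rw [← hl ψ, ENNReal.tsum_prod', ENNReal.tsum_comm]
      simp only [AdmissibleBasis.rep_reducedPoint]
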